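/- **Setting.** Let $\mathbb M=(M_p)_{p\ge 0}$ be a strongly regular sequence: $M_p>0$, $M_0=1$, $M_p^2\le M_{p-1}M_{p+1}$ for $p\ge1$; $M_{p+q}\le A_1^{p+q}M_pM_q$ for all $p,q\ge 0$ and some $A_1>0$; and $\sum_{q\ge p}\frac{M_q}{(q+1)M_{q+1}}\le A_2\frac{M_p}{M_{p+1}}$ for all $p\ge 0$ and some $A_2>0$. Put $M(t)=\sup_{p\ge0}\log(t^p/M_p)$ for $t>0$, $M(0)=0$, and $\omega=\omega(\mathbb M)=1/\limsup_{r\to\infty}\max\{0,\log M(r)/\log r\}$. A *proximate order* with limit $\rho$ is a nonnegative $C^1$ function $\rho(t)$ on some $(c,\infty)$ with $\rho(t)\to\rho$ and $t\rho'(t)\log t\to0$ as $t\to\infty$. Assume $\rho>0$ and that $\mathbb M$ admits $\rho(t)$, i.e. $\log t\,\bigl(\rho(t)-\log M(t)/\log t\bigr)$ is bounded for large $t$. Write $S_d(\theta)=\{|\arg z-d|<\theta/2\}$ for sectors of the Riemann surface of the logarithm. A *pair of kernel functions* for $\mathbb M$-summability consists of functions $e,E$ such that: 1. $e$ is holomorphic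 on $S_0(\omega\pi)$; there is $t_0>0$ such that every $z_0\in S_0(\omega\pi)$ has a neighbourhood $D\subseteq S_0(\omega\pi)$ with $\int_0^{t_0}\sup_{z\in D}|e(t/z)|\,\frac{dt}t<\infty$; and for every $\delta>0$ there are $k_1,k_2>0$ with $|e(z)|\le k_1e^{-M(|z|/k_2)}$ on $S_0(\omega\pi-\delta)$; 2. $e$ is real on the positive half-line; 3. $E$ is entire, $|E(z)|\le k_3e^{M(|z|/k_4)}$ on $\mathbb C$ for some $k_3,k_4>0$, and there is $\beta>0$ such that for all $0<\theta<2\pi-\omega\pi$ and $R>0$ there is $k_5>0$ with $|E(z)|\le k_5|z|^{-\beta}$ for $z\in S_\pi(\theta)$, $|z|\ge R$ (an empty condition if $\omega\ge2$); 4. $E(z)=\sum_{p\ge0}z^p/m(p)$ for $z\in\mathbb C$, where $m(s)=\int_0^\infty t^{s-1}e(t)\,dt$ for $\operatorname{Re}s\ge0$. The pair is *associated with $\rho(t)$* if $e(z)=c\,z^a\exp(-V(z))$ on $S_0(\omega\pi)$ for some $c,a>0$ and some $V\in MF(\gamma,\rho(t))$ with $\gamma\ge\omega$. Here $MF(\gamma,\rho(t))$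 is Maergoiz' class of holomorphic functions $V$ on $S_0(\gamma\pi)$ with: $V(rz)/V(r)\to z^{\rho}$ as $r\to\infty$, uniformly on compact subsets of $S_0(\gamma\pi)$; $V(\bar z)=\overline{V(z)}$; $V$ positive and strictly increasing on $(0,\infty)$ with $V(0^+)=0$; $t\mapsto V(e^t)$ strictly convex on $\mathbb R$; $\log V$ strictly concave on $(0,\infty)$; and $\log V(r)/\log r$ a proximate order with $\bigl(\rho(r)-\log V(r)/\log r\bigr)\log r\to0$ as $r\to\infty$. For an entire function $f$ put $M_f(r)=\max_{|z|=r}|f(z)|$. The function $\varrho(t)$ is a *proximate order of $f$* if it is a proximate order and $0<\limsup_{r\to\infty}\ln M_f(r)/r^{\varrho(r)}<\infty$. The generalized indicator of $f$ relative to $\varrho(t)$ is $$h_f(\theta)=\limsup_{r\to\infty}\frac{\ln|f(re^{i\theta})|}{r^{\varrho(r)}}\in[-\infty,\infty]\quad(\ln 0=-\infty),\qquad h_f^+=\max\{0,h_f\}.$$ **Corollary.** Let $\mathbb M$, $\rho(t)\to\rho>0$ be as above, let $(e,E)$ be a kernel pair for $\mathbb M$-summability associated with $\rho(t)$, let $m$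 be its moment function, and let $\lambda\in\mathbb C\setminus\{0\}$ with principal argument $\arg\lambda$. Then $t\mapsto\rho(|\lambda|t)$ is a proximate order, with limit $\rho$, of the entire function $z\mapsto E(\lambda z)$, and for the generalized indicator of $E(\lambda z)$ relative to it: * (i) for every real $\theta$ with $|\theta+\arg\lambda|\le\pi$, $$h^+_{E(\lambda z)}(\theta)=\begin{cases}|\lambda|^\rho\cos(\rho(\theta+\arg\lambda)) & \text{if } |\theta+\arg\lambda|\le\min\{\pi,\frac{\pi}{2\rho}\},\\ 0 & \text{if }\rho\ge\frac12\text{ and }\min\{\pi,\frac{\pi}{2\rho}\}\le|\theta+\arg\lambda|\le\pi;\end{cases}$$ * (ii) if $\rho>1$, then $h_{E(\lambda z)}(\theta)=h^+_{E(\lambda z)}(\theta)$ for all $\theta\in\mathbb R$; * (iii) if $\rho\le\frac12$, then $h^+_{E(\lambda z)}(\theta)=|\lambda|^\rho\cos(\rho(\theta+\arg\lambda))$ whenever $|\theta+\arg\lambda|\le\pi$; * (iv) if $\frac12<\rho\le1$ and there is an integer $k\ge1$ with $m(-k-1)\ne0$, then $h_{E(\lambda z)}(\theta)=h^+_{E(\lambda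 z)}(\theta)$ for all $\theta\in\mathbb R$. Here $m(-k-1)\neq 0$ means that $m$ has a meromorphic continuation from $\{\operatorname{Re}s>0\}$ to a connected open set containing $-k-1$, which is holomorphic at $-k-1$ with a nonzero value there. -/

import Mathlib

open Filter Topology Set MeasureTheory

noncomputable section

/-- Strongly regular sequences: `M 0 = 1`, positive, logarithmically convex, of moderate growth
and non-quasianalytic in the strong sense. -/
structure IsStronglyRegular (M : ℕ → ℝ) : Prop where
  pos : ∀ p, 0 < M p
  zero : M 0 = 1
  lc : ∀ p, 1 ≤ p → M p ^ 2 ≤ M (p - 1) * M (p + 1)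
  mg : ∃ A : ℝ, 0 < A ∧ ∀ p q, M (p + q) ≤ A ^ (p + q) * M p * M q
  snq : ∃ A : ℝ, 0 < A ∧ ∀ p : ℕ,
    Summable (fun j : ℕ => M (p + j) / (((p + j : ℕ) + 1 : ℝ) * M (p + j + 1))) ∧
    ∑' j : ℕ, M (p + j) / (((p + j : ℕ) + 1 : ℝ) * M (p + j + 1)) ≤ A * (M p / M (p + 1))

/-- The function `M(t) = sup_p log (t ^ p / M_p)` associated with a sequence. -/
def assocFun (M : ℕ → ℝ) (t : ℝ) : ℝ := ⨆ p : ℕ, Real.log (t ^ p / M p)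

/-- The order `ρ(M) = limsup_{r → ∞} max {0, log M(r) / log r}`. -/
def seqOrder (M : ℕ → ℝ) : ℝ :=
  limsup (fun r : ℝ => max 0 (Real.log (assocFun M r) / Real.log r)) atTop

/-- `ω(M) = 1 / ρ(M)`. -/
def omegaSeq (M : ℕ → ℝ) : ℝ := 1 / seqOrder M

/-- `ord` is a proximate order with limit `ρ`: a nonnegative continuously differentiable function
on some `(c, ∞)` with `ord r → ρ` and `r * ord' r * log r → 0`. -/
structure IsProximateOrder (ord : ℝ → ℝ) (ρ : ℝ) : Prop where
  regular : ∃ c : ℝ, (∀ t, c < t → 0 ≤ ord t) ∧ ContDiffOn ℝ 1 ord (Ioi c)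
  lim : Tendsto ord atTop (𝓝 ρ)
  lim_deriv : Tendsto (fun r : ℝ => r * deriv ord r * Real.log r) atTop (𝓝 0)

/-- The sequence `M` admits the proximate order `ord`: the function
`log t * (ord t - log M(t) / log t)` is bounded for large `t`. -/
def AdmitsProximateOrder (M : ℕ → ℝ) (ord : ℝ → ℝ) : Prop :=
  ∃ A B : ℝ, ∀ᶠ t : ℝ in atTop,
    A ≤ Real.log t * (ord t - Real.log (assocFun M t) / Real.log t) ∧
    Real.log t * (ord t - Real.log (assocFun M t) / Real.log t) ≤ B

/-- The sector `S_d(θ)` of the Riemann surface of the logarithm. A point `z` of that surface is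
represented by its logarithm `w = log |z| + i arg z`, an arbitrary complex number; thus
functions on sectors are functions of `w`, holomorphy in `z` is holomorphy in `w`,
`|z| = exp (re w)`, and the projection of `z` to the complex plane is `exp w`. -/
def logSector (d θ : ℝ) : Set ℂ := {w : ℂ | |w.im - d| < θ / 2}

/-- The moment function `m(s) = ∫_0^∞ t ^ (s - 1) e(t) dt`, with `e` a function of the logarithm. -/
def momentFun (e : ℂ → ℂ) (s : ℂ) : ℂ := mellin (fun t : ℝ => e (Real.log t : ℂ)) s

/-- Pairs of kernel functions for `M`-summability; `e` is a function of the logarithm `w` of the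
variable on the sector `S_0(ω(M) π)`, and `E` is a function on the complex plane. -/
structure IsKernelPair (M : ℕ → ℝ) (e E : ℂ → ℂ) : Prop where
  holo : DifferentiableOn ℂ e (logSector 0 (omegaSeq M * Real.pi))
  integrable_zero : ∃ t₀ : ℝ, 0 < t₀ ∧ ∀ w₀ ∈ logSector 0 (omegaSeq M * Real.pi),
    ∃ r₀ : ℝ, 0 < r₀ ∧ Metric.ball w₀ r₀ ⊆ logSector 0 (omegaSeq M * Real.pi) ∧
      ∫⁻ t in Ioo 0 t₀,
        (⨆ w ∈ Metric.ball w₀ r₀, ‖e ((Real.log t : ℂ) - w)‖ₑ) / ENNReal.ofReal t < ⊤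
  decay : ∀ δ : ℝ, 0 < δ → ∃ k₁ k₂ : ℝ, 0 < k₁ ∧ 0 < k₂ ∧
    ∀ w ∈ logSector 0 (omegaSeq M * Real.pi - δ),
      ‖e w‖ ≤ k₁ * Real.exp (-assocFun M (Real.exp w.re / k₂))
  real : ∀ x : ℝ, (e (x : ℂ)).im = 0
  entire : Differentiable ℂ E
  growth : ∃ k₃ k₄ : ℝ, 0 < k₃ ∧ 0 < k₄ ∧
    ∀ z : ℂ, ‖E z‖ ≤ k₃ * Real.exp (assocFun M (‖z‖ / k₄))
  decay_neg : ∃ β : ℝ, 0 < β ∧ ∀ θ R : ℝ, 0 < θ → θ < 2 * Real.pi - omegaSeq M * Real.pi → 0 < R →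
    ∃ k₅ : ℝ, 0 < k₅ ∧ ∀ w ∈ logSector Real.pi θ, R ≤ ‖Complex.exp w‖ →
      ‖E (Complex.exp w)‖ ≤ k₅ * ‖Complex.exp w‖ ^ (-β)
  series : ∀ z : ℂ, HasSum (fun p : ℕ => z ^ p / momentFun e p) (E z)

/-- Maergoiz' class `MF(γ, ord)` of analytic functions on the sector of opening `γ π`,
`V` being given as a function of the logarithm `w`, and `ρ` being the limit of `ord`. -/
structure IsMaergoizFun (γ : ℝ) (ord : ℝ → ℝ) (ρ : ℝ) (V : ℂ → ℂ) : Prop where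
  holo : DifferentiableOn ℂ V (logSector 0 (γ * Real.pi))
  regular : TendstoLocallyUniformlyOn
    (fun (r : ℝ) (w : ℂ) => V (w + (Real.log r : ℂ)) / V (Real.log r : ℂ))
    (fun w : ℂ => Complex.exp ((ρ : ℂ) * w)) atTop (logSector 0 (γ * Real.pi))
  conj : ∀ w ∈ logSector 0 (γ * Real.pi),
    V ((starRingEnd ℂ) w) = (starRingEnd ℂ) (V w)
  pos : ∀ x : ℝ, 0 < (V (x : ℂ)).re
  mono : StrictMono (fun x : ℝ => (V (x : ℂ)).re)
  zero : Tendsto (fun x : ℝ => (V (x : ℂ)).re) atBot (𝓝 0)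
  convex : StrictConvexOn ℝ univ (fun x : ℝ => (V (x : ℂ)).re)
  concave : StrictConcaveOn ℝ (Ioi 0) (fun r : ℝ => Real.log (V (Real.log r : ℂ)).re)
  order : IsProximateOrder (fun r : ℝ => Real.log (V (Real.log r : ℂ)).re / Real.log r) ρ
  equiv : Tendsto
    (fun r : ℝ => (ord r - Real.log (V (Real.log r : ℂ)).re / Real.log r) * Real.log r)
    atTop (𝓝 0)

/-- The kernel pair `(e, E)` for `M`-summability is associated with the proximate order `ord`
(with limit `ρ`): `e(z) = c z ^ a exp (-V(z))` on `S_0(ω(M) π)` for some `c, a > 0` and some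
Maergoiz function `V` of `ord` on a sector containing `S_0(ω(M) π)`. -/
def IsAssociatedKernelPair (M : ℕ → ℝ) (ord : ℝ → ℝ) (ρ : ℝ) (e E : ℂ → ℂ) : Prop :=
  IsKernelPair M e E ∧
    ∃ (γ : ℝ) (V : ℂ → ℂ) (c a : ℝ), omegaSeq M ≤ γ ∧ IsMaergoizFun γ ord ρ V ∧ 0 < c ∧ 0 < a ∧
      ∀ w ∈ logSector 0 (omegaSeq M * Real.pi),
        e w = (c : ℂ) * Complex.exp ((a : ℂ) * w) * Complex.exp (-V w)

/-- `M_f(r) = max {|f(z)| : |z| = r}`. -/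
def maxModulus (f : ℂ → ℂ) (r : ℝ) : ℝ := sSup ((fun z : ℂ => ‖f z‖) '' Metric.sphere 0 r)

/-- The type `limsup log M_f(r) / r ^ ord(r)` of `f` relative to `ord`. -/
def typeRel (ord : ℝ → ℝ) (f : ℂ → ℂ) : EReal :=
  limsup (fun r : ℝ => ((Real.log (maxModulus f r) / r ^ ord r : ℝ) : EReal)) atTop

/-- `ord` is a proximate order of the entire function `f`. -/
def IsProximateOrderOf (ord : ℝ → ℝ) (ρ : ℝ) (f : ℂ → ℂ) : Prop :=
  Differentiable ℂ f ∧ IsProximateOrder ord ρ ∧ 0 < typeRel ord f ∧ typeRel ord f < ⊤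

/-- The generalized indicator `h_f(θ) = limsup log |f(r exp(iθ))| / r ^ ord(r)` of `f` relative to
`ord`, as an extended real number (`log 0 = -∞`). -/
def genIndicator (ord : ℝ → ℝ) (f : ℂ → ℂ) (θ : ℝ) : EReal :=
  limsup (fun r : ℝ =>
    ENNReal.log ‖f ((r : ℂ) * Complex.exp ((θ : ℂ) * Complex.I))‖ₑ / ((r ^ ord r : ℝ) : EReal)) atTop

/-- `h_f⁺ = max {0, h_f}`. -/
def genIndicatorPlus (ord : ℝ → ℝ) (f : ℂ → ℂ) (θ : ℝ) : EReal :=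
  max 0 (genIndicator ord f θ)

/-- The function `m`, given on the right half-plane, has a meromorphic continuation along a
connected open set to the point `s`, where it is analytic (no pole) with a nonzero value. -/
def ContinuesToNonzero (m : ℂ → ℂ) (s : ℂ) : Prop :=
  ∃ (U : Set ℂ) (g : ℂ → ℂ), IsOpen U ∧ IsPreconnected U ∧ {z : ℂ | 0 < z.re} ⊆ U ∧ s ∈ U ∧
    MeromorphicOn g U ∧ (∀ z : ℂ, 0 < z.re → g z = m z) ∧ AnalyticAt ℂ g s ∧ g s ≠ 0

end

/-! Admitting `ord` forces `omegaSeq M = 1 / ρ`, so in logarithmic coordinates the function `V` of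
the kernel `c z^a exp(-V)` lives on the strip |Im w| < π/(2ρ), where V(w + x) ~ e^{ρw} V(x) as x →
∞. With Φ(s) = ∫ exp(sx - V(x)) dx (`laplaceExpNeg`) the moment function is m(s) = c Φ(s + a) and
E(z) = ∑ z^p / (c Φ(p + a)). Since r^{ord(|λ| r)} is asymptotic to V(log(|λ| r)) / |λ|^ρ
(`tendsto_div_rpow`), everything reduces to the indicator h of E relative to V, whose upper bounds
are expressed by `IndicatorLE`. The target for h⁺ is cos(ρθ) near the positive axis and 0 elsewhere.

On the positive ray h = 1. The bound h ≤ 1 holds in all directions by estimating moments. If h(0) <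
1, then E(e^x) exp(ax - V(x)) would be integrable, yet each term of the series contributes exactly
1/c to that integral (`not_indicatorLE`).

The basic tool is Phragmén–Lindelöf with comparison function exp(κV), whose indicator is an
arbitrary ρ-sinusoid (`indicatorLE_of_sinusoid`). For ρ > 1/2 the kernel axioms give power decay of
E beyond the angle π/(2ρ), and interpolation with h(0) ≤ 1 yields h ≤ cos(ρθ). For ρ ≤ 1/2 no decay
is available, and the missing bound h(π) ≤ cos(ρπ) comes from the residue formula ∑ (-1)^n e^{nL} /
Φ(n + a) = (1/2πi) ∫ π e^{(s-a)L} / (sin π(s-a) Φ(s)) ds over the boundary of a sector (up to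
finitely many terms). It requires a lower bound for |Φ| in the right half-plane, obtained by the
saddle point method (`eventually_le_norm_laplaceExpNeg`): the critical point solves V'(w) = s. On
the rays arg s = ±ρφ convexity of V bounds the integral by exp(cos(ρφ) V(L)) for every φ < π close
to π (`exists_norm_sum_le`). Conversely, a value of h below cos(ρθ) at ±θ would push h(0) below 1.

To show h ≥ 0 everywhere, suppose h is negative in some direction. If ρ > 1, the complementary
sector is wider than π/ρ. A negative value at one end of an interval of length π/ρ on which h ≤ 0
makes h = -∞ at its midpoint, and then h(0) = -∞, a contradiction. If 1/2 < ρ ≤ 1, negativity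
spreads to the direction π, so E(-t) decays faster than every power. The identity ∫ E(-ut) e(t) dt/t
= 1/(1+u) then gives the Mellin relation m(-σ) ∫ t^{σ-1} E(-t) dt = π / sin(πσ) for small Re σ > 0,
with the second factor holomorphic for Re σ > 0. Hence no meromorphic continuation of m can be
finite at a negative integer (`not_continuesToNonzero`). -/

noncomputable section

open Filter Topology Set MeasureTheory

/-! ### Regularly varying growth functions on a strip -/

/-- The growth function of a proximate order, as a function of the logarithm `w`: holomorphic on the
strip `|im w| < π / (2 ρ)`, regularly varying of order `ρ` there, real, positive, increasing and
convex on the real line. -/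
structure IsGrowthFun (ρ : ℝ) (V : ℂ → ℂ) : Prop where
  order_pos : 0 < ρ
  holo : DifferentiableOn ℂ V (logSector 0 (Real.pi / ρ))
  regular : TendstoLocallyUniformlyOn (fun (x : ℝ) (w : ℂ) => V (w + x) / V x)
    (fun w : ℂ => Complex.exp ((ρ : ℂ) * w)) atTop (logSector 0 (Real.pi / ρ))
  real : ∀ x : ℝ, (V x).im = 0
  pos : ∀ x : ℝ, 0 < (V x).re
  mono : StrictMono fun x : ℝ => (V x).re
  convex : ConvexOn ℝ univ fun x : ℝ => (V x).re
  order : Tendsto (fun x : ℝ => Real.log (V x).re / x) atTop (𝓝 ρ)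

theorem isOpen_logSector (d θ : ℝ) : IsOpen (logSector d θ) := by
  unfold logSector
  exact isOpen_lt (by fun_prop) (by fun_prop)

theorem mem_strip {ρ : ℝ} {w : ℂ} :
    w ∈ logSector 0 (Real.pi / ρ) ↔ |w.im| < Real.pi / (2 * ρ) := by
  unfold logSector
  rw [mem_ofPred_eq, sub_zero, div_div, mul_comm ρ 2]

namespace IsGrowthFun

variable {ρ : ℝ} {V : ℂ → ℂ} (hV : IsGrowthFun ρ V)
include hV

theorem coe_re (x : ℝ) : ((V x).re : ℂ) = V x := by
  apply Complex.ext <;> simp [hV.real x]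

theorem half_width_pos : 0 < Real.pi / (2 * ρ) := by
  have := hV.order_pos
  positivity

omit hV in
theorem add_mem {w : ℂ} (hw : w ∈ logSector 0 (Real.pi / ρ)) (x : ℝ) :
    w + x ∈ logSector 0 (Real.pi / ρ) := by
  rw [mem_strip] at *
  simpa using hw

theorem ofReal_mem (x : ℝ) : (x : ℂ) ∈ logSector 0 (Real.pi / ρ) := by
  rw [mem_strip]
  simpa using hV.half_width_pos

theorem analyticAt {w : ℂ} (hw : w ∈ logSector 0 (Real.pi / ρ)) : AnalyticAt ℂ V w :=
  hV.holo.analyticAt ((isOpen_logSector _ _).mem_nhds hw)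

theorem differentiableAt {w : ℂ} (hw : w ∈ logSector 0 (Real.pi / ρ)) : DifferentiableAt ℂ V w :=
  (hV.analyticAt hw).differentiableAt

theorem differentiableOn_shift (x : ℝ) :
    DifferentiableOn ℂ (fun w : ℂ => V (w + x) / V x) (logSector 0 (Real.pi / ρ)) := by
  intro w hw
  have h := hV.differentiableAt (add_mem hw x)
  have : DifferentiableAt ℂ (fun w : ℂ => V (w + x)) w :=
    DifferentiableAt.comp w h (by fun_prop)
  exact (this.div_const _).differentiableWithinAt

theorem uniform {K : Set ℂ} (hK : IsCompact K) (hKs : K ⊆ logSector 0 (Real.pi / ρ)) {ε : ℝ}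
    (hε : 0 < ε) : ∀ᶠ x : ℝ in atTop, ∀ w ∈ K,
      ‖V (w + x) - (V x).re * Complex.exp (ρ * w)‖ ≤ ε * (V x).re := by
  have h := (tendstoLocallyUniformlyOn_iff_forall_isCompact (isOpen_logSector _ _)).1
    hV.regular K hKs hK
  filter_upwards [Metric.tendstoUniformlyOn_iff.1 h ε hε] with x hx w hw
  have h1 := hx w hw
  have h2 := hV.pos x
  have h3 : V (w + x) - (V x).re * Complex.exp (ρ * w) =
      (V x).re * (V (w + x) / V x - Complex.exp (ρ * w)) := by
    have : V x ≠ 0 := by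
      rw [← hV.coe_re]
      exact_mod_cast h2.ne'
    rw [hV.coe_re]
    field_simp
  rw [dist_comm, dist_eq_norm] at h1
  rw [h3, norm_mul, Complex.norm_real, Real.norm_of_nonneg h2.le, mul_comm]
  gcongr

omit hV in
theorem deriv_shift (w : ℂ) (x : ℝ) :
    deriv (fun w : ℂ => V (w + x) / V x) w = deriv V (w + x) / V x := by
  rw [deriv_div_const, deriv_comp_add_const]

/-- Weierstrass: a locally uniform limit of holomorphic functions may be differentiated. So regular
variation passes to V' and, once more, to V'', with V itself as the normalisation. -/
theorem regular_deriv : TendstoLocallyUniformlyOn (fun (x : ℝ) (w : ℂ) => deriv V (w + x) / V x)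
    (fun w : ℂ => ρ * Complex.exp ((ρ : ℂ) * w)) atTop (logSector 0 (Real.pi / ρ)) := by
  have h := hV.regular.deriv (Eventually.of_forall fun x => hV.differentiableOn_shift x)
    (isOpen_logSector _ _)
  refine (h.congr fun x w hw => deriv_shift w x).congr_right fun w hw => ?_
  have : HasDerivAt (fun w : ℂ => Complex.exp ((ρ : ℂ) * w)) (Complex.exp (ρ * w) * (ρ * 1)) w :=
    ((hasDerivAt_id w).const_mul (ρ : ℂ)).cexp
  rw [this.deriv]
  ring

theorem regular_deriv_two :
    TendstoLocallyUniformlyOn (fun (x : ℝ) (w : ℂ) => deriv (deriv V) (w + x) / V x)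
    (fun w : ℂ => ρ ^ 2 * Complex.exp ((ρ : ℂ) * w)) atTop (logSector 0 (Real.pi / ρ)) := by
  have h := hV.regular_deriv.deriv (Eventually.of_forall fun x => ?_) (isOpen_logSector _ _)
  · refine (h.congr fun x w hw => ?_).congr_right fun w hw => ?_
    · simp only [Function.comp_apply]
      rw [deriv_div_const, deriv_comp_add_const]
    have : HasDerivAt (fun w : ℂ => ρ * Complex.exp ((ρ : ℂ) * w))
        (ρ * (Complex.exp (ρ * w) * (ρ * 1))) w :=
      (((hasDerivAt_id w).const_mul (ρ : ℂ)).cexp).const_mul _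
    rw [this.deriv]
    ring
  · intro w hw
    have h := (hV.analyticAt (add_mem hw x)).deriv.differentiableAt
    have : DifferentiableAt ℂ (fun w : ℂ => deriv V (w + x)) w :=
      DifferentiableAt.comp (f := fun w : ℂ => w + x) w h (by fun_prop)
    exact (this.div_const _).differentiableWithinAt

theorem uniform_deriv {K : Set ℂ} (hK : IsCompact K) (hKs : K ⊆ logSector 0 (Real.pi / ρ)) {ε : ℝ}
    (hε : 0 < ε) : ∀ᶠ x : ℝ in atTop, ∀ w ∈ K,
      ‖deriv V (w + x) / (V x).re - ρ * Complex.exp (ρ * w)‖ < ε := by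
  have h := (tendstoLocallyUniformlyOn_iff_forall_isCompact (isOpen_logSector _ _)).1
    hV.regular_deriv K hKs hK
  filter_upwards [Metric.tendstoUniformlyOn_iff.1 h ε hε] with x hx w hw
  have h1 := hx w hw
  rwa [dist_comm, dist_eq_norm, ← hV.coe_re] at h1

theorem uniform_deriv_two {K : Set ℂ} (hK : IsCompact K) (hKs : K ⊆ logSector 0 (Real.pi / ρ))
    {ε : ℝ} (hε : 0 < ε) : ∀ᶠ x : ℝ in atTop, ∀ w ∈ K,
      ‖deriv (deriv V) (w + x) / (V x).re - ρ ^ 2 * Complex.exp (ρ * w)‖ < ε := by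
  have h := (tendstoLocallyUniformlyOn_iff_forall_isCompact (isOpen_logSector _ _)).1
    hV.regular_deriv_two K hKs hK
  filter_upwards [Metric.tendstoUniformlyOn_iff.1 h ε hε] with x hx w hw
  have h1 := hx w hw
  rwa [dist_comm, dist_eq_norm, ← hV.coe_re] at h1

theorem eventually_le_exp {η : ℝ} (hη : 0 < η) :
    ∀ᶠ x : ℝ in atTop, (V x).re ≤ Real.exp ((ρ + η) * x) := by
  filter_upwards [hV.order.eventually_lt_const (show ρ < ρ + η by linarith), eventually_gt_atTop 0]
    with x hx h0
  rw [div_lt_iff₀ h0] at hx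
  rw [← Real.log_le_iff_le_exp (hV.pos x)]
  exact hx.le

theorem eventually_exp_le {η : ℝ} (hη : 0 < η) :
    ∀ᶠ x : ℝ in atTop, Real.exp ((ρ - η) * x) ≤ (V x).re := by
  filter_upwards [hV.order.eventually_const_lt (show ρ - η < ρ by linarith), eventually_gt_atTop 0]
    with x hx h0
  rw [lt_div_iff₀ h0] at hx
  rw [← Real.le_log_iff_exp_le (hV.pos x)]
  exact hx.le

theorem tendsto_atTop : Tendsto (fun x : ℝ => (V x).re) atTop atTop := by
  have hρ := hV.order_pos
  have h1 : Tendsto (fun x : ℝ => Real.exp ((ρ - ρ / 2) * x)) atTop atTop :=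
    Real.tendsto_exp_atTop.comp (tendsto_id.const_mul_atTop (by linarith))
  exact tendsto_atTop_mono' _ (hV.eventually_exp_le (by linarith)) h1

theorem hasDerivAt_re (x : ℝ) : HasDerivAt (fun x : ℝ => (V x).re) (deriv V x).re x :=
  (hV.differentiableAt (hV.ofReal_mem x)).hasDerivAt.real_of_complex

theorem deriv_im (x : ℝ) : (deriv V x).im = 0 := by
  have h := (hV.differentiableAt (hV.ofReal_mem x)).hasDerivAt.comp_ofReal
  have h1 : HasDerivAt (fun y : ℝ => (V y).im) (deriv V x).im x := by
    exact Complex.imCLM.hasFDerivAt.comp_hasDerivAt x h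
  have h2 : (fun y : ℝ => (V y).im) = fun _ => 0 := funext hV.real
  rw [h2] at h1
  exact h1.unique (hasDerivAt_const x 0)

/-- A convex function lies above its tangents. In the contour estimate this replaces the saddle
abscissa `x`, which depends on the integration variable, by the fixed point `L`. -/
theorem tangent_le (x y : ℝ) : (V x).re + (deriv V x).re * (y - x) ≤ (V y).re := by
  have h := hV.hasDerivAt_re x
  rcases lt_trichotomy x y with hxy | rfl | hxy
  · have := hV.convex.le_slope_of_hasDerivAt (mem_univ x) (mem_univ y) hxy h
    rw [slope_def_field, le_div_iff₀ (by linarith)] at this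
    linarith
  · simp
  · have := hV.convex.slope_le_of_hasDerivAt (mem_univ y) (mem_univ x) hxy h
    rw [slope_def_field, div_le_iff₀ (by linarith)] at this
    linarith

theorem tendsto_deriv_div : Tendsto (fun x : ℝ => (deriv V x).re / (V x).re) atTop (𝓝 ρ) := by
  rw [Metric.tendsto_nhds]
  intro ε hε
  filter_upwards [hV.uniform_deriv (K := {0}) isCompact_singleton
    (by simpa using hV.ofReal_mem 0) hε] with x hx
  have h := hx 0 rfl
  rw [zero_add, mul_zero, Complex.exp_zero, mul_one] at h
  have h2 : deriv V x / ((V x).re : ℂ) - ρ = (((deriv V x).re / (V x).re - ρ : ℝ) : ℂ) := by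
    have : deriv V x = ((deriv V x).re : ℂ) := by apply Complex.ext <;> simp [hV.deriv_im x]
    rw [this]
    push_cast
    simp
  rw [h2, Complex.norm_real] at h
  rwa [Real.dist_eq]

theorem tendsto_shift_div (t : ℝ) :
    Tendsto (fun x : ℝ => (V (x + t : ℝ)).re / (V x).re) atTop (𝓝 (Real.exp (ρ * t))) := by
  rw [Metric.tendsto_nhds]
  intro ε hε
  filter_upwards [hV.uniform (K := {(t : ℂ)}) isCompact_singleton
    (by simpa using hV.ofReal_mem t) (half_pos hε)] with x hx
  have h := hx t rfl
  have h1 := hV.pos x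
  have h2 : V (t + x) - (V x).re * Complex.exp (ρ * t) =
      (((V (x + t : ℝ)).re - (V x).re * Real.exp (ρ * t) : ℝ) : ℂ) := by
    rw [Complex.ofReal_sub, Complex.ofReal_mul, hV.coe_re, hV.coe_re]
    push_cast
    rw [add_comm]
  rw [h2, Complex.norm_real, Real.norm_eq_abs] at h
  rw [Real.dist_eq, div_sub' h1.ne', abs_div, abs_of_pos h1, div_lt_iff₀ h1]
  nlinarith

end IsGrowthFun

/-! ### Phragmén–Lindelöf comparison with sinusoids -/

/-- **Phragmén-Lindelöf principle** in a half-strip. -/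
theorem norm_le_of_half_strip {g : ℂ → ℂ} {X α C c B : ℝ} (hα : 0 < α)
    (hc : c < Real.pi / (2 * α)) (hC : 0 < C)
    (hd : ∀ w : ℂ, X ≤ w.re → |w.im| ≤ α → DifferentiableAt ℂ g w)
    (hleft : ∀ w : ℂ, w.re = X → |w.im| ≤ α → ‖g w‖ ≤ C)
    (hside : ∀ w : ℂ, X ≤ w.re → |w.im| = α → ‖g w‖ ≤ C)
    (hgrow : ∀ w : ℂ, X ≤ w.re → |w.im| ≤ α → ‖g w‖ ≤ Real.exp (B * Real.exp (c * w.re)))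
    {w : ℂ} (hw : X ≤ w.re) (hw' : |w.im| ≤ α) : ‖g w‖ ≤ C := by
  -- The damping factor is exp(-ε e^{c'w}): c' > c makes it beat the growth of `g`, and c'α < π/2
  -- keeps Re e^{c'w} positive on the closed half-strip.
  obtain ⟨c', hc1, hc2⟩ := exists_between (max_lt hc (show 0 < Real.pi / (2 * α) by positivity))
  have hc0 : 0 < c' := (le_max_right _ _).trans_lt hc1
  have hcc : c < c' := (le_max_left _ _).trans_lt hc1
  have hca : c' * α < Real.pi / 2 := by
    rw [lt_div_iff₀ (by positivity)] at hc2
    linarith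
  have hk : 0 < Real.cos (c' * α) :=
    Real.cos_pos_of_mem_Ioo ⟨by nlinarith [Real.pi_pos, mul_pos hc0 hα], hca⟩
  have hcos : ∀ y : ℝ, |y| ≤ α → Real.cos (c' * α) ≤ Real.cos (c' * y) := by
    intro y hy
    rw [← Real.cos_abs (c' * y), abs_mul, abs_of_pos hc0]
    apply Real.cos_le_cos_of_nonneg_of_le_pi (by positivity) (by linarith [Real.pi_pos])
    gcongr
  have hnorm : ∀ (ε : ℝ) (z : ℂ), ‖g z * Complex.exp (-ε * Complex.exp (c' * z))‖ =
      ‖g z‖ * Real.exp (-ε * (Real.exp (c' * z.re) * Real.cos (c' * z.im))) := by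
    intro ε z
    rw [norm_mul, Complex.norm_exp, ← Complex.ofReal_neg, Complex.re_ofReal_mul, Complex.exp_re,
      Complex.re_ofReal_mul, Complex.im_ofReal_mul]
  have key : ∀ ε : ℝ, 0 < ε →
      ‖g w‖ * Real.exp (-ε * (Real.exp (c' * w.re) * Real.cos (c' * w.im))) ≤ C := by
    intro ε hε
    have hlim : Tendsto (fun Y : ℝ => Real.exp (c * Y) *
        (B - ε * Real.cos (c' * α) * Real.exp ((c' - c) * Y)) - Real.log C) atTop atBot := by
      have h5 : Tendsto (fun Y : ℝ => Real.exp (c' * Y) *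
          (B * Real.exp (-((c' - c) * Y)) - ε * Real.cos (c' * α))) atTop atBot := by
        have h6 : Tendsto (fun Y : ℝ => B * Real.exp (-((c' - c) * Y)) - ε * Real.cos (c' * α))
            atTop (𝓝 (B * 0 - ε * Real.cos (c' * α))) := by
          refine ((Real.tendsto_exp_neg_atTop_nhds_zero.comp
            (tendsto_id.const_mul_atTop (sub_pos.2 hcc))).const_mul B).sub_const _
        have h7 : Tendsto (fun Y : ℝ => Real.exp (c' * Y)) atTop atTop :=
          Real.tendsto_exp_atTop.comp (tendsto_id.const_mul_atTop hc0)
        exact h7.atTop_mul_neg (by simp; positivity) h6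
      refine tendsto_atBot_add_const_right _ _ (h5.congr fun Y => ?_)
      have : Real.exp (c' * Y) = Real.exp (c * Y) * Real.exp ((c' - c) * Y) := by
        rw [← Real.exp_add]; ring_nf
      rw [this, Real.exp_neg]
      have := Real.exp_ne_zero ((c' - c) * Y)
      field_simp
    -- `Y` is far enough to the right for the damping to bring `g` below `C` on the edge Re w = Y,
    -- so the maximum principle applies on a bounded rectangle. Letting ε → 0 at the end removes the
    -- damping.
    obtain ⟨Y, hY1, hY2⟩ := ((hlim.eventually_le_atBot 0).and (eventually_gt_atTop w.re)).exists
    have hXY : X < Y := hw.trans_lt hY2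
    set U : Set ℂ := Ioo X Y ×ℂ Ioo (-α) α with hU
    have hUcl : closure U = Icc X Y ×ℂ Icc (-α) α := by
      rw [hU, Complex.closure_reProdIm, closure_Ioo hXY.ne, closure_Ioo (by linarith)]
    have hUo : IsOpen U := isOpen_Ioo.reProdIm isOpen_Ioo
    have hdiff : DifferentiableOn ℂ (fun z => g z * Complex.exp (-ε * Complex.exp (c' * z)))
        (closure U) := by
      intro z hz
      rw [hUcl, Complex.mem_reProdIm] at hz
      have h1 := hd z hz.1.1 (abs_le.2 hz.2)
      exact (h1.mul (by fun_prop)).differentiableWithinAt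
    have hle : ∀ z ∈ frontier U, ‖g z * Complex.exp (-ε * Complex.exp (c' * z))‖ ≤ C := by
      intro z hz
      rw [hUo.frontier_eq, hUcl] at hz
      obtain ⟨⟨⟨h1, h2⟩, h3⟩, h4⟩ := hz
      have h3' : |z.im| ≤ α := abs_le.2 h3
      rw [hnorm]
      have hcz := hcos _ h3'
      have hle1 : Real.exp (-ε * (Real.exp (c' * z.re) * Real.cos (c' * z.im))) ≤ 1 := by
        rw [Real.exp_le_one_iff, neg_mul, neg_nonpos]
        have := hk.trans_le hcz
        positivity
      have hfin : ‖g z‖ ≤ C →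
          ‖g z‖ * Real.exp (-ε * (Real.exp (c' * z.re) * Real.cos (c' * z.im))) ≤ C := fun h =>
        (mul_le_of_le_one_right (norm_nonneg _) hle1).trans h
      rcases h1.eq_or_lt with h1 | h1
      · exact hfin (hleft z h1.symm h3')
      rcases h3'.eq_or_lt with h5 | h5
      · exact hfin (hside z h1.le h5)
      rcases h2.eq_or_lt with h2 | h2
      · have h6 := hgrow z h1.le h3'
        rw [h2] at h6 ⊢
        refine (mul_le_mul_of_nonneg_right h6 (Real.exp_pos _).le).trans ?_
        rw [← Real.exp_add, ← Real.le_log_iff_exp_le hC]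
        have h7 : Real.exp (c' * Y) = Real.exp (c * Y) * Real.exp ((c' - c) * Y) := by
          rw [← Real.exp_add]; ring_nf
        have h8 : ε * Real.exp (c' * Y) * Real.cos (c' * α) ≤
            ε * Real.exp (c' * Y) * Real.cos (c' * z.im) := by gcongr
        rw [h7] at h8 ⊢
        linarith
      · exact absurd ⟨⟨h1, h2⟩, abs_lt.1 h5⟩ h4
    have := Complex.norm_le_of_forall_mem_frontier_norm_le
      ((Metric.isBounded_Ioo X Y).reProdIm (Metric.isBounded_Ioo (-α) α)) hdiff.diffContOnCl hle
      (z := w) (by rw [← hU, hUcl]; exact ⟨⟨hw, hY2.le⟩, abs_le.1 hw'⟩)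
    rwa [hnorm] at this
  have hlim : Tendsto (fun ε : ℝ =>
      ‖g w‖ * Real.exp (-ε * (Real.exp (c' * w.re) * Real.cos (c' * w.im)))) (𝓝[>] 0)
      (𝓝 (‖g w‖ * Real.exp (-0 * (Real.exp (c' * w.re) * Real.cos (c' * w.im))))) :=
    (Continuous.tendsto (by fun_prop) _).mono_left nhdsWithin_le_nhds
  simp only [neg_zero, zero_mul, Real.exp_zero, mul_one] at hlim
  exact le_of_tendsto hlim (eventually_nhdsWithin_of_forall fun ε hε => key ε hε)

/-- The indicator of `F` (a function of the logarithm of the variable) relative to the growth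
function `V` is at most `A` in the direction `θ`. -/
def IndicatorLE (V F : ℂ → ℂ) (θ A : ℝ) : Prop :=
  ∀ ε : ℝ, 0 < ε → ∀ᶠ x : ℝ in atTop,
    ‖F (x + θ * Complex.I)‖ ≤ Real.exp ((A + ε) * (V x).re)

/-- `F` has finite type relative to the growth function `V`, in all directions. -/
def HasFiniteType (V F : ℂ → ℂ) : Prop :=
  ∃ C : ℝ, 0 ≤ C ∧ ∀ᶠ x : ℝ in atTop, ∀ y : ℝ,
    ‖F (x + y * Complex.I)‖ ≤ Real.exp (C * (V x).re)

/-- Every ρ-sinusoid is Re(κ e^{iρβ}) for a constant κ. Adding `δ` to κ adds δ cos(ρβ), which is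
positive for |β| < π/(2ρ) and serves as slack. -/
theorem re_sinusoid_mul_exp (p q δ ρ θ β : ℝ) :
    (((p - q * Complex.I) * Complex.exp (ρ * θ * Complex.I) + δ) *
      Complex.exp (ρ * (β * Complex.I))).re =
      p * Real.cos (ρ * (θ + β)) + q * Real.sin (ρ * (θ + β)) + δ * Real.cos (ρ * β) := by
  have : ((p - q * Complex.I) * Complex.exp (ρ * θ * Complex.I) + δ) *
      Complex.exp (ρ * (β * Complex.I)) =
      (p - q * Complex.I) * Complex.exp ((ρ * (θ + β) : ℝ) * Complex.I) +
        δ * Complex.exp ((ρ * β : ℝ) * Complex.I) := by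
    rw [add_mul, mul_assoc, ← Complex.exp_add]
    push_cast
    ring_nf
  rw [this, Complex.exp_mul_I, Complex.exp_mul_I, ← Complex.ofReal_cos, ← Complex.ofReal_sin,
    ← Complex.ofReal_cos, ← Complex.ofReal_sin]
  simp [-Complex.ofReal_cos, -Complex.ofReal_sin, Complex.ofReal_re, Complex.ofReal_im]

theorem IsGrowthFun.eventually_norm_vertical_le {ρ : ℝ} {V : ℂ → ℂ} (hV : IsGrowthFun ρ V)
    {α : ℝ} (hα : α < Real.pi / (2 * ρ)) {η : ℝ} (hη : 0 < η) :
    ∀ᶠ x : ℝ in atTop, ∀ β : ℝ, |β| ≤ α →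
      ‖V (x + β * Complex.I) - (V x).re * Complex.exp (ρ * (β * Complex.I))‖ ≤ η * (V x).re := by
  have hKc : IsCompact ({0} ×ℂ Icc (-α) α) := isCompact_singleton.reProdIm isCompact_Icc
  have hKs : {0} ×ℂ Icc (-α) α ⊆ logSector 0 (Real.pi / ρ) := fun w hw => by
    rw [mem_strip]
    exact (abs_le.2 hw.2).trans_lt hα
  filter_upwards [hV.uniform hKc hKs hη] with x hx β hβ
  have h := hx (β * Complex.I) (by simpa [Complex.mem_reProdIm] using abs_le.1 hβ)
  rwa [add_comm] at h

theorem IsGrowthFun.eventually_re_mul_le {ρ : ℝ} {V : ℂ → ℂ} (hV : IsGrowthFun ρ V) (κ : ℂ)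
    {α : ℝ} (hα : α < Real.pi / (2 * ρ)) {η : ℝ} (hη : 0 < η) :
    ∀ᶠ x : ℝ in atTop, ∀ β : ℝ, |β| ≤ α →
      |(κ * V (x + β * Complex.I)).re -
        (V x).re * (κ * Complex.exp (ρ * (β * Complex.I))).re| ≤ η * (V x).re := by
  have hN0 : 0 < ‖κ‖ + 1 := by positivity
  filter_upwards [hV.eventually_norm_vertical_le hα (show 0 < η / (‖κ‖ + 1) by positivity)]
    with x hx β hβ
  have h := hx β hβ
  have h2 : (κ * V (x + β * Complex.I)).re -
      (V x).re * (κ * Complex.exp (ρ * (β * Complex.I))).re =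
      (κ * (V (x + β * Complex.I) - (V x).re * Complex.exp (ρ * (β * Complex.I)))).re := by
    rw [mul_sub, Complex.sub_re, ← Complex.re_ofReal_mul, mul_left_comm κ]
  rw [h2]
  refine (Complex.abs_re_le_norm _).trans ?_
  rw [norm_mul]
  calc ‖κ‖ * _ ≤ (‖κ‖ + 1) * (η / (‖κ‖ + 1) * (V x).re) := by
        gcongr
        linarith
    _ = η * (V x).re := by field_simp

/-- The half-strip principle is applied to F(w + iθ) exp(-κ V(w)), with θ the bisector of [θ₁, θ₃].
The comparison function exp(κV) has no zeros, and its indicator is the given sinusoid plus δ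
cos(ρβ). An opening below π/ρ makes that slack positive on both edges, keeps the half-strip inside
the domain of V and makes growth of order ρ admissible. -/
theorem IsGrowthFun.indicatorLE_of_sinusoid {ρ : ℝ} {V F : ℂ → ℂ} (hV : IsGrowthFun ρ V)
    (hF : Differentiable ℂ F) (hFt : HasFiniteType V F) {θ₁ θ₂ θ₃ p q : ℝ}
    (h12 : θ₁ ≤ θ₂) (h23 : θ₂ ≤ θ₃) (h13 : θ₁ < θ₃) (hlt : θ₃ - θ₁ < Real.pi / ρ)
    (h1 : IndicatorLE V F θ₁ (p * Real.cos (ρ * θ₁) + q * Real.sin (ρ * θ₁)))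
    (h3 : IndicatorLE V F θ₃ (p * Real.cos (ρ * θ₃) + q * Real.sin (ρ * θ₃))) :
    IndicatorLE V F θ₂ (p * Real.cos (ρ * θ₂) + q * Real.sin (ρ * θ₂)) := by
  have hρ := hV.order_pos
  intro ε hε
  obtain ⟨θ, hθ⟩ : ∃ θ : ℝ, θ = (θ₁ + θ₃) / 2 := ⟨_, rfl⟩
  obtain ⟨α, hα⟩ : ∃ α : ℝ, α = (θ₃ - θ₁) / 2 := ⟨_, rfl⟩
  have hα0 : 0 < α := by rw [hα]; linarith
  have hρα : ρ * α < Real.pi / 2 := by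
    rw [lt_div_iff₀ hρ] at hlt
    rw [hα]; linarith
  have hρα0 : 0 < ρ * α := by positivity
  have hαs : α < Real.pi / (2 * ρ) := by
    rw [lt_div_iff₀ (by positivity)]; linarith
  have hk : 0 < Real.cos (ρ * α) :=
    Real.cos_pos_of_mem_Ioo ⟨by linarith [Real.pi_pos], hρα⟩
  obtain ⟨δ, hδ⟩ : ∃ δ : ℝ, δ = ε / 4 := ⟨_, rfl⟩
  have hδ0 : 0 < δ := by rw [hδ]; positivity
  obtain ⟨κ, hκ⟩ : ∃ κ : ℂ, κ = (p - q * Complex.I) * Complex.exp (ρ * θ * Complex.I) + δ :=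
    ⟨_, rfl⟩
  -- Half of the slack on the edges: one `η` pays for the indicator bounds on the two rays, the
  -- other for replacing Re(κV) by its asymptotic value.
  obtain ⟨η, hη⟩ : ∃ η : ℝ, η = δ * Real.cos (ρ * α) / 2 := ⟨_, rfl⟩
  have hη0 : 0 < η := by rw [hη]; positivity
  have hηδ : η ≤ δ := by
    have := Real.cos_le_one (ρ * α)
    rw [hη]; nlinarith
  have hre : ∀ β : ℝ, (κ * Complex.exp (ρ * (β * Complex.I))).re =
      p * Real.cos (ρ * (θ + β)) + q * Real.sin (ρ * (θ + β)) + δ * Real.cos (ρ * β) := fun β => by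
    rw [hκ, re_sinusoid_mul_exp]
  have hclose := hV.eventually_re_mul_le κ hαs hη0
  obtain ⟨C, hC0, hC⟩ := hFt
  obtain ⟨c, hc1, hc2⟩ : ∃ c, ρ < c ∧ c < Real.pi / (2 * α) := by
    apply exists_between
    rw [lt_div_iff₀ (by positivity)]
    linarith
  have hVexp := hV.eventually_le_exp (sub_pos.2 hc1)
  rw [add_sub_cancel] at hVexp
  obtain ⟨X, hX⟩ := eventually_atTop.1
    (hclose.and (hC.and (hVexp.and ((h1 η hη0).and (h3 η hη0)))))
  obtain ⟨g, hg⟩ : ∃ g : ℂ → ℂ, g = fun w => F (w + θ * Complex.I) * Complex.exp (-(κ * V w)) :=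
    ⟨_, rfl⟩
  have hnorm : ∀ w, ‖g w‖ = ‖F (w + θ * Complex.I)‖ * Real.exp (-(κ * V w).re) := by
    intro w
    rw [hg, norm_mul, Complex.norm_exp, Complex.neg_re]
  have hdg : ∀ w : ℂ, |w.im| ≤ α → DifferentiableAt ℂ g w := by
    intro w hw
    have h := hV.differentiableAt (mem_strip.2 (hw.trans_lt hαs))
    have h' : DifferentiableAt ℂ (fun w => F (w + θ * Complex.I)) w :=
      (hF _).comp (f := fun w => w + θ * Complex.I) w (by fun_prop)
    rw [hg]
    exact h'.mul ((h.const_mul κ).neg.cexp)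
  have hws : ∀ w : ℂ, w = w.re + w.im * Complex.I := fun w => (Complex.re_add_im w).symm
  obtain ⟨D, hD⟩ : ∃ D : ℝ, ∀ w : ℂ, w.re = X → |w.im| ≤ α → ‖g w‖ ≤ D := by
    have hcomp : IsCompact ({X} ×ℂ Icc (-α) α) := isCompact_singleton.reProdIm isCompact_Icc
    have hcont : ContinuousOn g ({X} ×ℂ Icc (-α) α) := fun w hw =>
      (hdg w (abs_le.2 hw.2)).continuousAt.continuousWithinAt
    obtain ⟨D, hD⟩ := hcomp.exists_bound_of_continuousOn hcont
    exact ⟨D, fun w hw hw' => hD w ⟨hw, abs_le.1 hw'⟩⟩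
  obtain ⟨D', hD'⟩ : ∃ D' : ℝ, D' = max D 1 := ⟨_, rfl⟩
  have hD1 : 1 ≤ D' := hD' ▸ le_max_right _ _
  have hDD : D ≤ D' := hD' ▸ le_max_left _ _
  have hray : ∀ (x β : ℝ), X ≤ x → |β| = α → ∀ θ' : ℝ, θ' = θ + β →
      ‖F (x + θ' * Complex.I)‖ ≤
        Real.exp ((p * Real.cos (ρ * θ') + q * Real.sin (ρ * θ') + η) * (V x).re) →
      ‖g (x + β * Complex.I)‖ ≤ 1 := by
    intro x β hx hβ θ' hθ' hF'
    have h := abs_le.1 ((hX x hx).1 β hβ.le)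
    rw [hre, ← hθ'] at h
    have hb : Real.cos (ρ * β) = Real.cos (ρ * α) := by
      rw [← hβ, ← Real.cos_abs (ρ * β), abs_mul, abs_of_pos hρ]
    rw [hb] at h
    have h5 : (x : ℂ) + β * Complex.I + θ * Complex.I = x + θ' * Complex.I := by
      rw [hθ']; push_cast; ring
    rw [hnorm, h5]
    refine (mul_le_mul_of_nonneg_right hF' (Real.exp_pos _).le).trans ?_
    rw [← Real.exp_add, Real.exp_le_one_iff]
    have h6 : δ * Real.cos (ρ * α) = 2 * η := by rw [hη]; ring
    rw [h6] at h
    nlinarith [hV.pos x]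
  have hmain : ∀ w : ℂ, X ≤ w.re → |w.im| ≤ α → ‖g w‖ ≤ D' := by
    intro w hw hw'
    refine norm_le_of_half_strip (B := C + (‖κ‖ + η)) (c := c) hα0 hc2 (by linarith)
      (fun z _ hz => hdg z hz) (fun z hz hz' => (hD z hz hz').trans hDD) ?_ ?_ hw hw'
    · intro z hz hz'
      refine le_trans ?_ hD1
      rw [hws z]
      rcases abs_eq hα0.le |>.1 hz' with h | h
      · exact hray _ _ hz hz' θ₃ (by rw [h, hθ, hα]; ring) (hX _ hz).2.2.2.2
      · exact hray _ _ hz hz' θ₁ (by rw [h, hθ, hα]; ring) (hX _ hz).2.2.2.1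
    · intro z hz hz'
      obtain ⟨ha, hb, hc, -⟩ := hX _ hz
      have ha := abs_le.1 (ha _ hz')
      rw [← hws] at ha
      have hb := hb (z.im + θ)
      have h5 : (z.re : ℂ) + ((z.im + θ : ℝ) : ℂ) * Complex.I = z + θ * Complex.I := by
        conv_rhs => rw [hws z]
        push_cast; ring
      rw [h5] at hb
      have hv := hV.pos z.re
      have h6 : -(κ * Complex.exp (ρ * (z.im * Complex.I))).re ≤ ‖κ‖ := by
        have := (abs_le.1 (Complex.abs_re_le_norm
          (κ * Complex.exp (ρ * (z.im * Complex.I))))).1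
        have h7 : ‖Complex.exp (ρ * (z.im * Complex.I))‖ = 1 := by
          rw [← mul_assoc, ← Complex.ofReal_mul, Complex.norm_exp_ofReal_mul_I]
        rw [norm_mul, h7] at this
        linarith
      rw [hnorm]
      refine (mul_le_mul_of_nonneg_right hb (Real.exp_pos _).le).trans ?_
      rw [← Real.exp_add]
      apply Real.exp_le_exp.2
      calc C * (V z.re).re + -(κ * V z).re ≤ (C + (‖κ‖ + η)) * (V z.re).re := by nlinarith
        _ ≤ (C + (‖κ‖ + η)) * Real.exp (c * z.re) := by gcongr
  obtain ⟨β, hβ⟩ : ∃ β : ℝ, β = θ₂ - θ := ⟨_, rfl⟩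
  have hβα : |β| ≤ α := by
    rw [abs_le, hβ, hθ, hα]
    constructor <;> linarith
  have hlarge := hV.tendsto_atTop.eventually_ge_atTop (Real.log D' / δ)
  filter_upwards [eventually_ge_atTop X, hlarge] with x hx hxl
  have hm := hmain (x + β * Complex.I) (by simpa using hx) (by simpa using hβα)
  have h := abs_le.1 ((hX x hx).1 β hβα)
  rw [hre] at h
  rw [hnorm] at hm
  have h5 : (x : ℂ) + β * Complex.I + θ * Complex.I = x + θ₂ * Complex.I := by
    rw [hβ]; push_cast; ring
  rw [h5, Real.exp_neg, ← div_eq_mul_inv, div_le_iff₀ (Real.exp_pos _)] at hm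
  refine hm.trans ?_
  rw [div_le_iff₀ hδ0] at hxl
  rw [← Real.exp_log (by linarith : 0 < D'), ← Real.exp_add]
  apply Real.exp_le_exp.2
  have h9 : θ + β = θ₂ := by rw [hβ]; ring
  rw [h9] at h
  have hv := hV.pos x
  have h10 := Real.cos_le_one (ρ * β)
  have h11 : δ * Real.cos (ρ * β) * (V x).re ≤ δ * (V x).re := by
    apply mul_le_mul_of_nonneg_right _ hv.le
    nlinarith
  have h12 : η * (V x).re ≤ δ * (V x).re := by gcongr
  have h13 : ε = 4 * δ := by rw [hδ]; ring
  rw [h13]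
  nlinarith

/-! ### The Laplace transform and its contour shifts -/

/-- The two-sided Laplace transform `s ↦ ∫ exp (s x - V(x)) dx` of `exp (-V)`. -/
def laplaceExpNeg (V : ℂ → ℂ) (s : ℂ) : ℂ := ∫ x : ℝ, Complex.exp (s * x - V x)

/-- `exp (-V(w))` is `O(exp (-a re w))` on closed substrips. -/
def HasStripBound (ρ a : ℝ) (V : ℂ → ℂ) : Prop :=
  ∀ α : ℝ, α < Real.pi / (2 * ρ) → ∃ B : ℝ, ∀ w : ℂ, |w.im| ≤ α → -(V w).re ≤ B - a * w.re

theorem integrable_exp_neg_mul_abs {ε : ℝ} (hε : 0 < ε) :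
    Integrable fun x : ℝ => Real.exp (-ε * |x|) := by
  have h1 : IntegrableOn (fun x : ℝ => Real.exp (-ε * |x|)) (Ioi 0) :=
    (integrableOn_exp_mul_Ioi (neg_lt_zero.2 hε) 0).congr_fun
      (fun x hx => by rw [abs_of_pos hx]) measurableSet_Ioi
  have h2 : IntegrableOn (fun x : ℝ => Real.exp (-ε * |x|)) (Iic 0) :=
    (integrableOn_exp_mul_Iic hε 0).congr_fun
      (fun x hx => by rw [abs_of_nonpos hx]; ring_nf) measurableSet_Iic
  rw [← integrableOn_univ, ← Iic_union_Ioi (a := (0 : ℝ))]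
  exact h2.union h1

/-- Horizontal lines of integration may be shifted within a strip of exponential decay. -/
theorem integral_horizontal_shift {f : ℂ → ℂ} {α C ε : ℝ} (hε : 0 < ε)
    (hd : ∀ w : ℂ, |w.im| ≤ α → DifferentiableAt ℂ f w)
    (hb : ∀ w : ℂ, |w.im| ≤ α → ‖f w‖ ≤ C * Real.exp (-ε * |w.re|)) {β : ℝ} (hβ : |β| ≤ α) :
    ∫ x : ℝ, f (x + β * Complex.I) = ∫ x : ℝ, f x := by
  have hcont : ∀ b : ℝ, |b| ≤ α → Continuous fun x : ℝ => f (x + b * Complex.I) := by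
    intro b hb'
    rw [continuous_iff_continuousAt]
    intro x
    exact (hd _ (by simpa using hb')).continuousAt.comp
      (f := fun x : ℝ => (x : ℂ) + b * Complex.I) (by fun_prop)
  have hint : ∀ b : ℝ, |b| ≤ α → Integrable fun x : ℝ => f (x + b * Complex.I) := by
    intro b hb'
    refine ((integrable_exp_neg_mul_abs hε).const_mul C).mono'
      (hcont b hb').aestronglyMeasurable (Eventually.of_forall fun x => ?_)
    simpa using hb (x + b * Complex.I) (by simpa using hb')
  have hα : 0 ≤ α := (abs_nonneg β).trans hβ
  have huIcc : ∀ y ∈ uIcc 0 β, |y| ≤ α := by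
    intro y hy
    rcases le_total 0 β with h | h
    · rw [uIcc_of_le h] at hy
      rw [abs_of_nonneg hy.1]
      exact hy.2.trans ((le_abs_self _).trans hβ)
    · rw [uIcc_of_ge h] at hy
      rw [abs_of_nonpos hy.2]
      exact (neg_le_neg hy.1).trans ((neg_le_abs _).trans hβ)
  have hrect : ∀ T : ℝ, (∫ x in (-T)..T, f x) - (∫ x in (-T)..T, f (x + β * Complex.I)) =
      Complex.I • (∫ y in (0 : ℝ)..β, f (-T + y * Complex.I)) -
        Complex.I • (∫ y in (0 : ℝ)..β, f (T + y * Complex.I)) := by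
    intro T
    have h := Complex.integral_boundary_rect_eq_zero_of_differentiableOn f (-T : ℝ)
      (T + β * Complex.I) (fun w hw => by
        rw [Complex.mem_reProdIm] at hw
        refine (hd w (huIcc _ ?_)).differentiableWithinAt
        simpa using hw.2)
    simp at h
    simp only [smul_eq_mul]
    linear_combination h
  have hvert : ∀ T : ℝ, ‖∫ y in (0 : ℝ)..β, f (T + y * Complex.I)‖ ≤
      C * Real.exp (-ε * |T|) * |β - 0| := by
    intro T
    refine intervalIntegral.norm_integral_le_of_norm_le_const fun y hy => ?_
    simpa using hb (T + y * Complex.I) (by simpa using huIcc y (uIoc_subset_uIcc hy))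
  have hlim0 : Tendsto (fun T : ℝ => C * Real.exp (-ε * |T|) * |β - 0|) atTop (𝓝 0) := by
    have h1 : Tendsto (fun T : ℝ => Real.exp (-ε * |T|)) atTop (𝓝 0) :=
      Real.tendsto_exp_atBot.comp
        ((tendsto_abs_atTop_atTop).const_mul_atTop_of_neg (neg_lt_zero.2 hε))
    simpa using (h1.const_mul C).mul_const (|β - 0|)
  have hv1 : Tendsto (fun T : ℝ => ∫ y in (0 : ℝ)..β, f (T + y * Complex.I)) atTop (𝓝 0) :=
    squeeze_zero_norm hvert hlim0
  have hv2 : Tendsto (fun T : ℝ => ∫ y in (0 : ℝ)..β, f (-T + y * Complex.I)) atTop (𝓝 0) := by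
    refine squeeze_zero_norm (fun T => ?_) hlim0
    have := hvert (-T)
    rw [abs_neg] at this
    simpa using this
  have h0 := hint 0 (by simpa using hα)
  simp only [Complex.ofReal_zero, zero_mul, add_zero] at h0
  have hl1 := intervalIntegral_tendsto_integral h0 tendsto_neg_atTop_atBot tendsto_id
  have hl2 := intervalIntegral_tendsto_integral (hint β hβ) tendsto_neg_atTop_atBot tendsto_id
  have hl3 := hl1.sub hl2
  have hl4 : Tendsto (fun T : ℝ => (∫ x in (-T)..T, f x) -
      (∫ x in (-T)..T, f (x + β * Complex.I))) atTop (𝓝 0) := by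
    simp_rw [hrect]
    simpa using (hv2.const_smul Complex.I).sub (hv1.const_smul Complex.I)
  exact (sub_eq_zero.1 (tendsto_nhds_unique hl3 hl4)).symm

namespace IsGrowthFun

variable {ρ a : ℝ} {V : ℂ → ℂ} (hV : IsGrowthFun ρ V)
include hV

theorem cos_pos {α : ℝ} (hα0 : 0 ≤ α) (hα : α < Real.pi / (2 * ρ)) : 0 < Real.cos (ρ * α) := by
  have hρ := hV.order_pos
  rw [lt_div_iff₀ (by positivity)] at hα
  refine Real.cos_pos_of_mem_Ioo ⟨?_, by linarith⟩
  have := Real.pi_pos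
  nlinarith [mul_nonneg hρ.le hα0]

theorem cos_le_cos {α β : ℝ} (hα : α < Real.pi / (2 * ρ)) (hβ : |β| ≤ α) :
    Real.cos (ρ * α) ≤ Real.cos (ρ * β) := by
  have hρ := hV.order_pos
  rw [lt_div_iff₀ (by positivity)] at hα
  rw [← Real.cos_abs (ρ * β), abs_mul, abs_of_pos hρ]
  apply Real.cos_le_cos_of_nonneg_of_le_pi (by positivity) (by linarith [Real.pi_pos])
  gcongr

omit hV in
theorem exp_mul_I_re (β : ℝ) : (Complex.exp (ρ * (β * Complex.I))).re = Real.cos (ρ * β) := by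
  rw [← mul_assoc, ← Complex.ofReal_mul, Complex.exp_ofReal_mul_I_re]

theorem eventually_le_re {α : ℝ} (hα0 : 0 ≤ α) (hα : α < Real.pi / (2 * ρ)) :
    ∀ᶠ x : ℝ in atTop, ∀ β : ℝ, |β| ≤ α →
      Real.cos (ρ * α) / 2 * (V x).re ≤ (V (x + β * Complex.I)).re := by
  have hk := hV.cos_pos hα0 hα
  filter_upwards [hV.eventually_re_mul_le 1 hα (half_pos hk)] with x hx β hβ
  have h := (abs_le.1 (hx β hβ)).1
  rw [one_mul, one_mul, exp_mul_I_re] at h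
  have := hV.cos_le_cos hα hβ
  nlinarith [hV.pos x]

/-- Exponential decay of the integrand `exp (s w - V(w))` on closed substrips. -/
theorem exists_integrand_bound (hB : HasStripBound ρ a V) {α : ℝ} (hα0 : 0 ≤ α)
    (hα : α < Real.pi / (2 * ρ)) {s : ℂ} (hs : a < s.re) :
    ∃ C ε : ℝ, 0 < ε ∧ ∀ w : ℂ, |w.im| ≤ α →
      ‖Complex.exp (s * w - V w)‖ ≤ C * Real.exp (-ε * |w.re|) := by
  have hk := hV.cos_pos hα0 hα
  obtain ⟨B, hB⟩ := hB α hα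
  have hρ := hV.order_pos
  have hlin : ∀ᶠ x : ℝ in atTop, (|s.re| + 1) * x ≤ Real.cos (ρ * α) / 2 * (V x).re := by
    have h1 : Tendsto (fun x : ℝ => Real.exp ((ρ - ρ / 2) * x) / x) atTop atTop := by
      have := (Real.tendsto_exp_div_pow_atTop 1).comp
        (tendsto_id.const_mul_atTop (show 0 < ρ - ρ / 2 by linarith))
      have h2 := this.const_mul_atTop (show 0 < ρ - ρ / 2 by linarith)
      refine h2.congr fun x => ?_
      simp only [Function.comp_apply, id, pow_one]
      have : ρ - ρ / 2 ≠ 0 := by linarith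
      field_simp
    filter_upwards [hV.eventually_exp_le (show 0 < ρ / 2 by linarith), eventually_gt_atTop 0,
      h1.eventually_ge_atTop ((|s.re| + 1) / (Real.cos (ρ * α) / 2))] with x hx h0 h2
    rw [div_le_div_iff₀ (by positivity) h0] at h2
    nlinarith
  obtain ⟨X, hX⟩ := eventually_atTop.1 ((hV.eventually_le_re hα0 hα).and
    (hlin.and (eventually_ge_atTop 0)))
  have hX0 : 0 ≤ X := (hX X le_rfl).2.2
  -- On the left the strip bound leaves exp((Re s - a) Re w). On the right V dominates (|Re s| + 1)
  -- Re w, leaving a surplus of exp(-Re w). The minimum serves both ends.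
  obtain ⟨ε, hε⟩ : ∃ ε, ε = min 1 (s.re - a) := ⟨_, rfl⟩
  have hε0 : 0 < ε := hε ▸ lt_min one_pos (sub_pos.2 hs)
  have hε1 : ε ≤ 1 := hε ▸ min_le_left _ _
  have hε2 : ε ≤ s.re - a := hε ▸ min_le_right _ _
  refine ⟨Real.exp (|s.im| * α + |B| + (s.re - a + ε) * X), ε, hε0, fun w hw => ?_⟩
  rw [Complex.norm_exp, ← Real.exp_add, Complex.sub_re, Complex.mul_re]
  apply Real.exp_le_exp.2
  have h1 : -(s.im * w.im) ≤ |s.im| * α := by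
    refine (neg_le_abs _).trans ?_
    rw [abs_mul]
    gcongr
  have hBa := le_abs_self B
  have hBb := abs_nonneg B
  rcases le_total w.re X with h | h
  · have h2 := hB w hw
    rcases le_total 0 w.re with h0 | h0
    · rw [abs_of_nonneg h0]; nlinarith
    · rw [abs_of_nonpos h0]; nlinarith
  · obtain ⟨h2, h3, h4⟩ := hX _ h
    have h2 := h2 _ hw
    rw [Complex.re_add_im] at h2
    rw [abs_of_nonneg h4]
    have h5 := le_abs_self s.re
    nlinarith

theorem laplaceExpNeg_shift (hB : HasStripBound ρ a V) {β : ℝ} (hβ : |β| < Real.pi / (2 * ρ))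
    {s : ℂ} (hs : a < s.re) :
    laplaceExpNeg V s =
      ∫ x : ℝ, Complex.exp (s * (x + β * Complex.I) - V (x + β * Complex.I)) := by
  obtain ⟨C, ε, hε, h⟩ := hV.exists_integrand_bound hB (abs_nonneg β) hβ hs
  rw [integral_horizontal_shift (f := fun w => Complex.exp (s * w - V w)) hε (fun w hw => ?_) h
    le_rfl, laplaceExpNeg]
  have := hV.differentiableAt (mem_strip.2 (hw.trans_lt hβ))
  fun_prop

theorem continuous_ofReal : Continuous fun x : ℝ => V x := continuous_iff_continuousAt.2 fun x =>
  (hV.differentiableAt (hV.ofReal_mem x)).continuousAt.comp Complex.continuous_ofReal.continuousAt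

end IsGrowthFun

/-! ### Laplace's method at a saddle point -/

/-- Near 0 the lower bound m on f'' gives m t²/2. Beyond |t| = 1 convexity lets f grow at least
linearly, with the slope already reached on the unit interval. Only one-sided information is needed:
f may be uncontrolled to the left of `L`. -/
theorem half_mul_min_le_of_hasDerivAt {f f' f'' : ℝ → ℝ} {m L : ℝ} (hL : L ≤ -1)
    (h1 : ∀ t, L ≤ t → HasDerivAt f (f' t) t) (h2 : ∀ t, L ≤ t → HasDerivAt f' (f'' t) t)
    (h0 : f 0 = 0) (h0' : f' 0 = 0) (hm0 : 0 ≤ m) (hm : ∀ t, |t| ≤ 1 → m ≤ f'' t)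
    (hnn : ∀ t, L ≤ t → 0 ≤ f'' t) {t : ℝ} (ht : L ≤ t) : m / 2 * min (t ^ 2) |t| ≤ f t := by
  have hconv : ConvexOn ℝ (Ici L) f := by
    refine convexOn_of_hasDerivWithinAt2_nonneg (convex_Ici L) (f' := f') (f'' := f'')
      (fun x hx => (h1 x hx).continuousAt.continuousWithinAt)
      (fun x hx => (h1 x (interior_subset hx)).hasDerivWithinAt)
      (fun x hx => (h2 x (interior_subset hx)).hasDerivWithinAt)
      (fun x hx => hnn x (interior_subset hx))
  have hconv' : ConvexOn ℝ (Icc (-1) 1) fun t => f t - m / 2 * t ^ 2 := by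
    refine convexOn_of_hasDerivWithinAt2_nonneg (convex_Icc _ _) (f' := fun t => f' t - m * t)
      (f'' := fun t => f'' t - m) (fun x hx => ?_) (fun x hx => ?_) (fun x hx => ?_)
      (fun x hx => ?_)
    · exact ((h1 x (hL.trans hx.1)).continuousAt.sub (by fun_prop)).continuousWithinAt
    · have hx := interior_subset hx
      have : HasDerivAt (fun t : ℝ => m / 2 * t ^ 2) (m * x) x := by
        convert! ((hasDerivAt_id x).pow 2).const_mul (m / 2) using 1
        simp; ring
      exact ((h1 x (hL.trans hx.1)).sub this).hasDerivWithinAt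
    · have hx := interior_subset hx
      have : HasDerivAt (fun t : ℝ => m * t) m x := by
        simpa using (hasDerivAt_id x).const_mul m
      exact ((h2 x (hL.trans hx.1)).sub this).hasDerivWithinAt
    · have hx := interior_subset hx
      exact sub_nonneg.2 (hm x (abs_le.2 hx))
  have hsmall : ∀ s : ℝ, |s| ≤ 1 → m / 2 * s ^ 2 ≤ f s := by
    intro s hs
    have hd : HasDerivAt (fun t => f t - m / 2 * t ^ 2) 0 0 := by
      have : HasDerivAt (fun t : ℝ => m / 2 * t ^ 2) 0 0 := by
        convert! ((hasDerivAt_id (0 : ℝ)).pow 2).const_mul (m / 2) using 1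
        simp
      have h := (h1 0 (by linarith)).sub this
      rwa [h0', sub_zero] at h
    have h0m : (0 : ℝ) ∈ Icc (-1 : ℝ) 1 := by constructor <;> norm_num
    have hsm := abs_le.1 hs
    rcases lt_trichotomy 0 s with h | h | h
    · have := hconv'.le_slope_of_hasDerivAt h0m hsm h hd
      rw [slope_def_field, le_div_iff₀ (by linarith)] at this
      simp [h0] at this
      linarith
    · rw [← h, h0]; simp
    · have := hconv'.slope_le_of_hasDerivAt hsm h0m h hd
      rw [slope_def_field, div_le_iff₀ (by linarith)] at this
      simp [h0] at this
      linarith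
  have hm2 : 0 ≤ m / 2 := by positivity
  rcases le_total |t| 1 with h | h
  · exact (mul_le_mul_of_nonneg_left (min_le_left _ _) hm2).trans (hsmall t h)
  refine (mul_le_mul_of_nonneg_left (min_le_right _ _) hm2).trans ?_
  have hz : (0 : ℝ) ∈ Ici L := by simp only [mem_Ici]; linarith
  have ht0 : 0 < |t| := by linarith
  -- Convexity between 0 and `t`, evaluated at t/|t|, where the quadratic bound equals m/2.
  have hc := hconv.2 hz ht (show 0 ≤ 1 - 1 / |t| by rw [sub_nonneg, div_le_one ht0]; exact h)
    (show 0 ≤ 1 / |t| by positivity) (by ring)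
  simp only [smul_eq_mul, mul_zero, zero_add, h0] at hc
  have h3 := hsmall (1 / |t| * t) (by
    rw [abs_mul, abs_of_pos (by positivity : 0 < 1 / |t|), one_div_mul_cancel ht0.ne'])
  have h4 : (1 / |t| * t) ^ 2 = 1 := by
    rw [mul_pow, div_pow, sq_abs, one_pow, one_div_mul_cancel]
    rw [← sq_abs]; positivity
  rw [h4] at h3
  have h5 := h3.trans hc
  rw [one_div, inv_mul_eq_div, le_div_iff₀ ht0] at h5
  linarith

namespace IsGrowthFun

variable {ρ a : ℝ} {V : ℂ → ℂ} (hV : IsGrowthFun ρ V)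
include hV

omit hV in
theorem rect_subset_strip {α : ℝ} (hα : α < Real.pi / (2 * ρ)) (l r : ℝ) :
    Icc l r ×ℂ Icc (-α) α ⊆ logSector 0 (Real.pi / ρ) := fun w hw => by
  rw [mem_strip]
  exact (abs_le.2 hw.2).trans_lt hα

theorem eventually_deriv_two_re {α : ℝ} (hα0 : 0 ≤ α) (hα : α < Real.pi / (2 * ρ)) :
    ∃ m : ℝ, 0 < m ∧ ∀ᶠ x : ℝ in atTop, ∀ β : ℝ, |β| ≤ α → ∀ t : ℝ, |t| ≤ 1 →
      m * (V x).re ≤ (deriv (deriv V) (x + β * Complex.I + t)).re := by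
  have hk := hV.cos_pos hα0 hα
  have hρ := hV.order_pos
  obtain ⟨m, hm⟩ : ∃ m, m = ρ ^ 2 * (Real.exp (-ρ) * Real.cos (ρ * α)) / 2 := ⟨_, rfl⟩
  have hm0 : 0 < m := by rw [hm]; positivity
  refine ⟨m, hm0, ?_⟩
  filter_upwards [hV.uniform_deriv_two (isCompact_Icc.reProdIm isCompact_Icc)
    (rect_subset_strip hα (-1) 1) hm0] with x hx β hβ t ht
  have h := hx (t + β * Complex.I) ⟨by simpa using abs_le.1 ht, by simpa using abs_le.1 hβ⟩
  have h1 := (abs_le.1 ((Complex.abs_re_le_norm _).trans h.le)).1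
  have h2 : (t : ℂ) + β * Complex.I + x = x + β * Complex.I + t := by ring
  rw [h2, Complex.sub_re, Complex.div_ofReal_re] at h1
  have h3 : ((ρ : ℂ) ^ 2 * Complex.exp (ρ * (t + β * Complex.I))).re =
      ρ ^ 2 * (Real.exp (ρ * t) * Real.cos (ρ * β)) := by
    rw [← Complex.ofReal_pow, Complex.re_ofReal_mul, Complex.exp_re]
    simp
  rw [h3] at h1
  have h4 : Real.exp (-ρ) * Real.cos (ρ * α) ≤ Real.exp (ρ * t) * Real.cos (ρ * β) := by
    apply mul_le_mul _ (hV.cos_le_cos hα hβ) hk.le (Real.exp_pos _).le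
    apply Real.exp_le_exp.2
    nlinarith [(abs_le.1 ht).1]
  have h5 : ρ ^ 2 * (Real.exp (-ρ) * Real.cos (ρ * α)) ≤
      ρ ^ 2 * (Real.exp (ρ * t) * Real.cos (ρ * β)) := by gcongr
  have h6 : m ≤ (deriv (deriv V) (x + β * Complex.I + t)).re / (V x).re := by linarith
  rwa [le_div_iff₀ (hV.pos x)] at h6

theorem eventually_deriv_re {α : ℝ} (hα0 : 0 ≤ α) (hα : α < Real.pi / (2 * ρ)) :
    ∃ k : ℝ, 0 < k ∧ ∀ᶠ x : ℝ in atTop, ∀ β : ℝ, |β| ≤ α →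
      k * (V x).re ≤ (deriv V (x + β * Complex.I)).re := by
  have hk := hV.cos_pos hα0 hα
  have hρ := hV.order_pos
  have hm0 : 0 < ρ * Real.cos (ρ * α) / 2 := by positivity
  refine ⟨_, hm0, ?_⟩
  filter_upwards [hV.uniform_deriv (isCompact_Icc.reProdIm isCompact_Icc)
    (rect_subset_strip hα 0 0) hm0] with x hx β hβ
  have h := hx (β * Complex.I) ⟨by simp, by simpa using abs_le.1 hβ⟩
  have h1 := (abs_le.1 ((Complex.abs_re_le_norm _).trans h.le)).1
  rw [add_comm, Complex.sub_re, Complex.div_ofReal_re, Complex.re_ofReal_mul, exp_mul_I_re] at h1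
  have h5 : ρ * Real.cos (ρ * α) ≤ ρ * Real.cos (ρ * β) := by
    gcongr
    exact hV.cos_le_cos hα hβ
  have h6 : ρ * Real.cos (ρ * α) / 2 ≤ (deriv V (x + β * Complex.I)).re / (V x).re := by linarith
  rwa [le_div_iff₀ (hV.pos x)] at h6

/-- Along the horizontal line through the saddle, Re V is convex to the right of a fixed abscissa,
with second derivative at least of order V(x) near the saddle, so the preceding lemma applies there.
Farther left regular variation says nothing, and the strip bound takes over: the linear term Re
V'(w₀)·(-t), of size at least k V(x)|t|, outweighs all other terms. -/
theorem eventually_saddle_gap (ha : 0 ≤ a) (hB : HasStripBound ρ a V) {α : ℝ} (hα0 : 0 ≤ α)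
    (hα : α < Real.pi / (2 * ρ)) :
    ∃ κ : ℝ, 0 < κ ∧ ∀ᶠ x : ℝ in atTop, ∀ β : ℝ, |β| ≤ α → ∀ t : ℝ,
      κ * (V x).re * min (t ^ 2) |t| ≤ (V (x + β * Complex.I + t) - V (x + β * Complex.I) -
        deriv V (x + β * Complex.I) * t).re := by
  obtain ⟨m, hm0, hm⟩ := hV.eventually_deriv_two_re hα0 hα
  obtain ⟨k, hk0, hk⟩ := hV.eventually_deriv_re hα0 hα
  obtain ⟨B, hB⟩ := hB α hα
  obtain ⟨X, hX⟩ := eventually_atTop.1 hm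
  have hv := hV.tendsto_atTop
  refine ⟨min (m / 2) (k / 4), by positivity, ?_⟩
  filter_upwards [hm, hk, hV.eventually_norm_vertical_le hα one_pos, eventually_ge_atTop 0,
    eventually_ge_atTop (X + 1), eventually_ge_atTop (X + 8 / k),
    hv.eventually_ge_atTop (4 * a / k), hv.eventually_ge_atTop (4 * |B| / k)]
    with x hmx hkx hVx hx0 hxX hxk hva hvB β hβ t
  have hvx := hV.pos x
  have hstrip : ∀ z : ℂ, z.im = 0 → x + β * Complex.I + z ∈ logSector 0 (Real.pi / ρ) := by
    intro z hz
    rw [mem_strip]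
    simpa [hz] using hβ.trans_lt hα
  rcases le_total (X - x) t with ht | ht
  · have key := half_mul_min_le_of_hasDerivAt (L := X - x) (m := m * (V x).re)
      (f := fun t : ℝ => (V (x + β * Complex.I + t) - V (x + β * Complex.I) -
        deriv V (x + β * Complex.I) * t).re)
      (f' := fun t : ℝ => (deriv V (x + β * Complex.I + t) - deriv V (x + β * Complex.I)).re)
      (f'' := fun t : ℝ => (deriv (deriv V) (x + β * Complex.I + t)).re) (t := t)
      (by linarith) ?_ ?_ (by simp) (by simp) (by positivity) (hmx β hβ) ?_ ht
    · refine le_trans ?_ key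
      have h1 : min (m / 2) (k / 4) ≤ m / 2 := min_le_left _ _
      have h2 : 0 ≤ min (t ^ 2) |t| := by positivity
      have h3 : m * (V x).re / 2 = m / 2 * (V x).re := by ring
      rw [h3]
      gcongr
    · intro t _
      have h1 : HasDerivAt (fun z : ℂ => V (x + β * Complex.I + z))
          (deriv V (x + β * Complex.I + t)) t :=
        (hV.differentiableAt (hstrip t (by simp))).hasDerivAt.comp_const_add _ _
      have h2 : HasDerivAt (fun z : ℂ => deriv V (x + β * Complex.I) * z)
          (deriv V (x + β * Complex.I)) (t : ℂ) := by
        simpa using (hasDerivAt_id (t : ℂ)).const_mul (deriv V (x + β * Complex.I))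
      exact ((h1.sub_const _).sub h2).real_of_complex
    · intro t _
      have h1 : HasDerivAt (fun z : ℂ => deriv V (x + β * Complex.I + z))
          (deriv (deriv V) (x + β * Complex.I + t)) t :=
        (hV.analyticAt (hstrip t (by simp))).deriv.differentiableAt.hasDerivAt.comp_const_add _ _
      exact (h1.sub_const _).real_of_complex
    · intro t ht
      have h := hX (x + t) (by linarith) β hβ 0 (by simp)
      have h2 : ((x + t : ℝ) : ℂ) + β * Complex.I + (0 : ℝ) = x + β * Complex.I + t := by
        push_cast; ring
      rw [h2] at h
      exact le_trans (mul_pos hm0 (hV.pos _)).le h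
  -- Here |t| is large (at least 8/k) and V(x) exceeds 4a/k and 4|B|/k, so each unwanted term is at
  -- most a quarter of k V(x)|t|.
  · have ht1 : t ≤ -1 := by linarith
    have habs : |t| = -t := abs_of_neg (by linarith)
    have h1 := hB (x + β * Complex.I + t) (by simpa using hβ)
    have h2 := hkx β hβ
    have h3 : (V (x + β * Complex.I)).re ≤ 2 * (V x).re := by
      have h4 := (Complex.re_le_norm _).trans (hVx β hβ)
      rw [Complex.sub_re, Complex.re_ofReal_mul, exp_mul_I_re] at h4
      nlinarith [Real.cos_le_one (ρ * β)]
    have h5 : (V (x + β * Complex.I + t) - V (x + β * Complex.I) -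
        deriv V (x + β * Complex.I) * t).re = (V (x + β * Complex.I + t)).re -
        (V (x + β * Complex.I)).re - (deriv V (x + β * Complex.I)).re * t := by
      simp
    rw [h5]
    have h6 : min (m / 2) (k / 4) * (V x).re * min (t ^ 2) |t| ≤ k / 4 * (V x).re * |t| := by
      gcongr
      · exact min_le_right _ _
      · exact min_le_right _ _
    refine h6.trans ?_
    have hre : (x + β * Complex.I + t : ℂ).re = x + t := by simp
    rw [hre] at h1
    rw [div_le_iff₀ hk0] at hva hvB
    have h7 : 8 / k ≤ -t := by linarith
    rw [div_le_iff₀ hk0] at h7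
    rw [habs]
    have hBa := neg_abs_le B
    have hBb := le_abs_self B
    have e1 : a * (-t) ≤ k / 4 * (V x).re * (-t) := by
      apply mul_le_mul_of_nonneg_right _ (by linarith)
      linarith
    have e2 : |B| ≤ k / 4 * (V x).re * (-t) := by nlinarith
    have e3 : 2 * (V x).re ≤ k / 4 * (V x).re * (-t) := by nlinarith
    have e4 : (deriv V (x + β * Complex.I)).re * (-t) ≥ k * (V x).re * (-t) :=
      mul_le_mul_of_nonneg_right h2 (by linarith)
    have e5 : 0 ≤ a * x := mul_nonneg ha hx0
    nlinarith

/-- Second order expansion of `V`, uniformly on vertical segments. -/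
theorem exists_taylor_two {α : ℝ} (hα : α < Real.pi / (2 * ρ)) {η : ℝ} (hη : 0 < η) :
    ∃ δ : ℝ, 0 < δ ∧ ∀ᶠ x : ℝ in atTop, ∀ β : ℝ, |β| ≤ α → ∀ h : ℂ, ‖h‖ ≤ δ →
      ‖V (x + β * Complex.I + h) - V (x + β * Complex.I) - deriv V (x + β * Complex.I) * h -
        deriv (deriv V) (x + β * Complex.I) * h ^ 2 / 2‖ ≤ η * (V x).re * ‖h‖ ^ 2 := by
  have hρ := hV.order_pos
  obtain ⟨d, hd0, hd⟩ := exists_between (sub_pos.2 hα)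
  -- `d` keeps the enlarged segment inside the strip, 1/ρ permits the linear estimate of e^z - 1,
  -- and the last bound makes ρ² e^{ρw} vary by at most η/2.
  obtain ⟨δ, hδ⟩ : ∃ δ, δ = min d (min (1 / ρ) (η / (4 * ρ ^ 3))) := ⟨_, rfl⟩
  have hδ0 : 0 < δ := by rw [hδ]; positivity
  have hδd : δ ≤ d := hδ ▸ min_le_left _ _
  have hδ1 : ρ * δ ≤ 1 := by
    have : δ ≤ 1 / ρ := hδ ▸ (min_le_right _ _).trans (min_le_left _ _)
    rwa [le_div_iff₀ hρ, mul_comm] at this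
  have hδ2 : ρ ^ 2 * (2 * (ρ * δ)) ≤ η / 2 := by
    have : δ ≤ η / (4 * ρ ^ 3) := hδ ▸ (min_le_right _ _).trans (min_le_right _ _)
    rw [le_div_iff₀ (by positivity)] at this
    linarith
  refine ⟨δ, hδ0, ?_⟩
  have hαd : α + d < Real.pi / (2 * ρ) := by linarith
  filter_upwards [hV.uniform_deriv_two (isCompact_Icc.reProdIm isCompact_Icc)
    (rect_subset_strip hαd (-d) d) (show 0 < η / 4 by positivity)] with x hx β hβ h hh
  have hvx := hV.pos x
  have hstrip : ∀ z : ℂ, ‖z‖ ≤ δ → x + β * Complex.I + z ∈ logSector 0 (Real.pi / ρ) := by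
    intro z hz
    rw [mem_strip]
    have := (Complex.abs_im_le_norm z).trans hz
    have h2 : |(x + β * Complex.I + z : ℂ).im| ≤ |β| + |z.im| := by simpa using abs_add_le β z.im
    linarith
  have hbase := hstrip 0 (by simpa using hδ0.le)
  rw [add_zero] at hbase
  have hb2 : ∀ z : ℂ, ‖z‖ ≤ ‖h‖ → ‖deriv (deriv V) (x + β * Complex.I + z) -
      deriv (deriv V) (x + β * Complex.I)‖ ≤ η * (V x).re := by
    intro z hz
    have hzδ := hz.trans hh
    have h1 := hx (z + β * Complex.I) ⟨by
      have := abs_le.1 ((Complex.abs_re_le_norm z).trans (hzδ.trans hδd))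
      simpa using this, by
      have := abs_le.1 ((Complex.abs_im_le_norm z).trans (hzδ.trans hδd))
      have := abs_le.1 hβ
      have hi : (z + β * Complex.I).im = z.im + β := by simp
      rw [mem_preimage, hi, mem_Icc]
      constructor <;> linarith⟩
    have h2 := hx (β * Complex.I) ⟨by simpa using hd0.le, by
      have := abs_le.1 hβ
      have hi : (β * Complex.I).im = β := by simp
      rw [mem_preimage, hi, mem_Icc]
      constructor <;> linarith⟩
    have e1 : z + β * Complex.I + x = x + β * Complex.I + z := by ring
    have e2 : β * Complex.I + x = x + β * Complex.I := by ring
    rw [e1] at h1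
    rw [e2] at h2
    have h3 : ‖(ρ : ℂ) ^ 2 * Complex.exp (ρ * (z + β * Complex.I)) -
        ρ ^ 2 * Complex.exp (ρ * (β * Complex.I))‖ ≤ η / 2 := by
      have : (ρ : ℂ) ^ 2 * Complex.exp (ρ * (z + β * Complex.I)) -
          ρ ^ 2 * Complex.exp (ρ * (β * Complex.I)) =
          (ρ ^ 2 : ℝ) * (Complex.exp ((ρ * β : ℝ) * Complex.I) * (Complex.exp (ρ * z) - 1)) := by
        rw [mul_add, Complex.exp_add]
        push_cast
        ring_nf
      have hz1 : ‖(ρ : ℂ) * z‖ ≤ ρ * δ := by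
        rw [norm_mul, Complex.norm_real, Real.norm_of_nonneg hρ.le]
        gcongr
      rw [this, norm_mul, norm_mul, Complex.norm_exp_ofReal_mul_I, Complex.norm_real,
        Real.norm_of_nonneg (by positivity), one_mul]
      refine le_trans ?_ hδ2
      gcongr
      refine (Complex.norm_exp_sub_one_le (hz1.trans hδ1)).trans ?_
      gcongr
    have h4 : ‖deriv (deriv V) (x + β * Complex.I + z) / (V x).re -
        deriv (deriv V) (x + β * Complex.I) / (V x).re‖ ≤ η := by
      have := (norm_add_le _ _).trans (add_le_add ((norm_sub_le _ _).trans
        (add_le_add h1.le h2.le)) h3)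
      refine le_trans (le_of_eq ?_) (this.trans (by linarith))
      congr 1
      ring
    rw [← sub_div, norm_div, Complex.norm_real, Real.norm_of_nonneg hvx.le, div_le_iff₀ hvx] at h4
    exact h4
  have hd2 : ∀ z : ℂ, ‖z‖ ≤ ‖h‖ → HasDerivAt (fun z : ℂ => deriv V (x + β * Complex.I + z) -
      deriv V (x + β * Complex.I) - deriv (deriv V) (x + β * Complex.I) * z)
      (deriv (deriv V) (x + β * Complex.I + z) - deriv (deriv V) (x + β * Complex.I)) z := by
    intro z hz
    have h1 : HasDerivAt (fun z : ℂ => deriv V (x + β * Complex.I + z))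
        (deriv (deriv V) (x + β * Complex.I + z)) z :=
      (hV.analyticAt (hstrip z (hz.trans hh))).deriv.differentiableAt.hasDerivAt.comp_const_add _ _
    have h2 : HasDerivAt (fun z : ℂ => deriv (deriv V) (x + β * Complex.I) * z)
        (deriv (deriv V) (x + β * Complex.I)) z := by
      simpa using (hasDerivAt_id z).const_mul (deriv (deriv V) (x + β * Complex.I))
    exact (h1.sub_const _).sub h2
  have hd1 : ∀ z : ℂ, ‖z‖ ≤ ‖h‖ → HasDerivAt (fun z : ℂ => V (x + β * Complex.I + z) -
      V (x + β * Complex.I) - deriv V (x + β * Complex.I) * z -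
      deriv (deriv V) (x + β * Complex.I) * z ^ 2 / 2)
      (deriv V (x + β * Complex.I + z) - deriv V (x + β * Complex.I) -
        deriv (deriv V) (x + β * Complex.I) * z) z := by
    intro z hz
    have h1 : HasDerivAt (fun z : ℂ => V (x + β * Complex.I + z))
        (deriv V (x + β * Complex.I + z)) z :=
      (hV.differentiableAt (hstrip z (hz.trans hh))).hasDerivAt.comp_const_add _ _
    have h2 : HasDerivAt (fun z : ℂ => deriv V (x + β * Complex.I) * z)
        (deriv V (x + β * Complex.I)) z := by
      simpa using (hasDerivAt_id z).const_mul (deriv V (x + β * Complex.I))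
    have h3 : HasDerivAt (fun z : ℂ => deriv (deriv V) (x + β * Complex.I) * z ^ 2 / 2)
        (deriv (deriv V) (x + β * Complex.I) * z) z := by
      convert! (((hasDerivAt_id z).pow 2).const_mul
        (deriv (deriv V) (x + β * Complex.I))).div_const 2 using 1
      simp; ring
    exact ((h1.sub_const _).sub h2).sub h3
  have hball : ∀ z ∈ Metric.closedBall (0 : ℂ) ‖h‖, ‖z‖ ≤ ‖h‖ := fun z hz => by simpa using hz
  have h0b : (0 : ℂ) ∈ Metric.closedBall (0 : ℂ) ‖h‖ := by simp
  have hs1 : ∀ z : ℂ, ‖z‖ ≤ ‖h‖ → ‖deriv V (x + β * Complex.I + z) -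
      deriv V (x + β * Complex.I) - deriv (deriv V) (x + β * Complex.I) * z‖ ≤
      η * (V x).re * ‖h‖ := by
    intro z hz
    have := (convex_closedBall (0 : ℂ) ‖h‖).norm_image_sub_le_of_norm_hasDerivWithin_le
      (fun z hz => (hd2 z (hball z hz)).hasDerivWithinAt) (fun z hz => hb2 z (hball z hz))
      h0b (y := z) (by simpa using hz)
    simp only [add_zero, sub_self, mul_zero, sub_zero] at this
    exact this.trans (by gcongr)
  have := (convex_closedBall (0 : ℂ) ‖h‖).norm_image_sub_le_of_norm_hasDerivWithin_le
      (fun z hz => (hd1 z (hball z hz)).hasDerivWithinAt) (fun z hz => hs1 z (hball z hz))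
      h0b (y := h) (by simp)
  simp only [add_zero, sub_self, mul_zero, sub_zero] at this
  refine le_trans (le_of_eq ?_) (this.trans (le_of_eq (by ring)))
  simp

end IsGrowthFun

namespace IsGrowthFun

variable {ρ a : ℝ} {V : ℂ → ℂ} (hV : IsGrowthFun ρ V)
include hV

theorem eventually_deriv_two_norm_le {α : ℝ} (hα : α < Real.pi / (2 * ρ)) :
    ∀ᶠ x : ℝ in atTop, ∀ β : ℝ, |β| ≤ α →
      ‖deriv (deriv V) (x + β * Complex.I)‖ ≤ (ρ ^ 2 + 1) * (V x).re := by
  filter_upwards [hV.uniform_deriv_two (isCompact_Icc.reProdIm isCompact_Icc)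
    (rect_subset_strip hα 0 0) one_pos] with x hx β hβ
  have h := hx (β * Complex.I) ⟨by simp, by simpa using abs_le.1 hβ⟩
  have h1 := norm_le_norm_add_norm_sub' (deriv (deriv V) (β * Complex.I + x) / (V x).re)
    ((ρ : ℂ) ^ 2 * Complex.exp (ρ * (β * Complex.I)))
  have h2 : ‖(ρ : ℂ) ^ 2 * Complex.exp (ρ * (β * Complex.I))‖ = ρ ^ 2 := by
    rw [norm_mul, ← mul_assoc, ← Complex.ofReal_mul, Complex.norm_exp_ofReal_mul_I,
      ← Complex.ofReal_pow, Complex.norm_real, Real.norm_of_nonneg (by positivity), mul_one]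
  have hvx := hV.pos x
  rw [h2, norm_div, Complex.norm_real, Real.norm_of_nonneg hvx.le] at h1
  rw [add_comm (x : ℂ), ← div_le_iff₀ hvx]
  linarith

/-- The rescaled exponent at the point `x + i β`. -/
def _root_.saddleExponent (V : ℂ → ℂ) (p : ℝ × ℝ) (y : ℝ) : ℂ :=
  -(V (p.1 + p.2 * Complex.I + (y / √(V p.1).re : ℝ)) - V (p.1 + p.2 * Complex.I) -
    deriv V (p.1 + p.2 * Complex.I) * (y / √(V p.1).re : ℝ))

theorem continuous_saddleExponent {p : ℝ × ℝ} (hp : |p.2| < Real.pi / (2 * ρ)) :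
    Continuous (saddleExponent V p) := by
  rw [continuous_iff_continuousAt]
  intro y
  have h1 : ContinuousAt V (p.1 + p.2 * Complex.I + (y / √(V p.1).re : ℝ)) :=
    (hV.differentiableAt (mem_strip.2 (by
      have : ((p.1 : ℂ) + p.2 * Complex.I + (y / √(V p.1).re : ℝ)).im = p.2 := by
        simp only [Complex.add_im, Complex.ofReal_im, Complex.mul_im, Complex.I_im, Complex.I_re,
          Complex.ofReal_re]
        ring
      rwa [this]))).continuousAt
  have h2 : ContinuousAt (fun y : ℝ => V (p.1 + p.2 * Complex.I + (y / √(V p.1).re : ℝ))) y :=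
    ContinuousAt.comp (f := fun y : ℝ => (p.1 : ℂ) + p.2 * Complex.I + (y / √(V p.1).re : ℝ)) h1
      (Continuous.continuousAt (by fun_prop))
  exact ((h2.sub continuousAt_const).sub (Continuous.continuousAt (by fun_prop))).neg

/-- After the scaling t = y/√V(x) the integrand approaches the Gaussian exp(-q y²), where q =
V''(w₀)/(2V(x)), and the saddle gap supplies an integrable majorant. The Gaussian integral has
modulus √(π/|q|), and |q| ≤ (ρ² + 1)/2. -/
theorem tendsto_integral_saddleExponent (ha : 0 ≤ a) (hB : HasStripBound ρ a V) {α : ℝ}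
    (hα0 : 0 ≤ α) (hα : α < Real.pi / (2 * ρ)) :
    ∀ᶠ p : ℝ × ℝ in atTop ×ˢ 𝓟 (Icc (-α) α),
      Real.sqrt (Real.pi / (ρ ^ 2 + 1)) ≤ ‖∫ y : ℝ, Complex.exp (saddleExponent V p y)‖ := by
  have hρ := hV.order_pos
  obtain ⟨κ, hκ0, hκ⟩ := hV.eventually_saddle_gap ha hB hα0 hα
  obtain ⟨m, hm0, hm⟩ := hV.eventually_deriv_two_re hα0 hα
  -- Convergence along this product filter is convergence in `x` uniformly in `β`, so a single use
  -- of dominated convergence gives the uniform statement.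
  set l : Filter (ℝ × ℝ) := atTop ×ˢ 𝓟 (Icc (-α) α) with hl
  have hto : ∀ {P : ℝ → ℝ → Prop}, (∀ᶠ x in atTop, ∀ β, |β| ≤ α → P x β) →
      ∀ᶠ p : ℝ × ℝ in l, P p.1 p.2 := by
    intro P hP
    rw [hl, Filter.eventually_prod_principal_iff]
    filter_upwards [hP] with x hx β hβ using hx β (abs_le.2 hβ)
  have hV1 : ∀ᶠ p : ℝ × ℝ in l, 1 ≤ (V p.1).re :=
    hto (P := fun x _ => 1 ≤ (V x).re)
      ((hV.tendsto_atTop.eventually_ge_atTop 1).mono fun x hx _ _ => hx)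
  have hstrip : ∀ᶠ p : ℝ × ℝ in l, |p.2| < Real.pi / (2 * ρ) :=
    hto (P := fun _ β => |β| < Real.pi / (2 * ρ))
      (Eventually.of_forall fun x β hβ => hβ.trans_lt hα)
  set q : ℝ × ℝ → ℂ := fun p => deriv (deriv V) (p.1 + p.2 * Complex.I) / (V p.1).re / 2 with hq
  have hqre : ∀ᶠ p : ℝ × ℝ in l, m / 2 ≤ (q p).re := by
    have := hto (P := fun x β => m * (V x).re ≤ (deriv (deriv V) (x + β * Complex.I)).re)
      (hm.mono fun x hx β hβ => by simpa using hx β hβ 0 (by simp))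
    filter_upwards [this] with p hp
    have h2 : (q p).re = (deriv (deriv V) (p.1 + p.2 * Complex.I)).re / (V p.1).re / 2 := by
      rw [hq, ← Complex.ofReal_ofNat, Complex.div_ofReal_re, Complex.div_ofReal_re]
    rw [h2]
    rw [← le_div_iff₀ (hV.pos _)] at hp
    linarith
  have hqnorm : ∀ᶠ p : ℝ × ℝ in l, ‖q p‖ ≤ (ρ ^ 2 + 1) / 2 := by
    filter_upwards [hto (hV.eventually_deriv_two_norm_le hα)] with p hp
    rw [hq, norm_div, norm_div, Complex.norm_real, Real.norm_of_nonneg (hV.pos _).le]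
    rw [← div_le_iff₀ (hV.pos _)] at hp
    simpa using div_le_div_of_nonneg_right hp (show (0 : ℝ) ≤ 2 by norm_num)
  have hgap : ∀ᶠ p : ℝ × ℝ in l, ∀ y : ℝ, (saddleExponent V p y).re ≤ κ - κ * |y| := by
    filter_upwards [hto hκ, hV1] with p hp hp1 y
    have h := hp (y / √(V p.1).re)
    rw [saddleExponent, Complex.neg_re]
    have hs1 : 1 ≤ √(V p.1).re := Real.one_le_sqrt.2 hp1
    have hs0 : 0 < √(V p.1).re := by linarith
    have h2 : |y| - 1 ≤ (V p.1).re * min ((y / √(V p.1).re) ^ 2) |y / √(V p.1).re| := by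
      rw [mul_min_of_nonneg _ _ (hV.pos _).le, le_min_iff]
      constructor
      · rw [div_pow, Real.sq_sqrt (hV.pos _).le, mul_div_cancel₀ _ (hV.pos _).ne', ← sq_abs]
        nlinarith [sq_nonneg (|y| - 1), abs_nonneg y]
      · rw [abs_div, abs_of_pos hs0]
        have : (V p.1).re * (|y| / √(V p.1).re) = √(V p.1).re * |y| := by
          rw [mul_div_assoc', div_eq_iff hs0.ne']
          nth_rw 1 [← Real.sq_sqrt (hV.pos p.1).le]
          ring
        rw [this]
        nlinarith [abs_nonneg y]
    have h3 := mul_le_mul_of_nonneg_left h2 hκ0.le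
    nlinarith
  have hbound1 : ∀ᶠ p : ℝ × ℝ in l, ∀ y : ℝ,
      ‖Complex.exp (saddleExponent V p y)‖ ≤ Real.exp κ * Real.exp (-κ * |y|) := by
    filter_upwards [hgap] with p hp y
    rw [Complex.norm_exp, ← Real.exp_add]
    apply Real.exp_le_exp.2
    linarith [hp y]
  have hbound2 : ∀ᶠ p : ℝ × ℝ in l, ∀ y : ℝ,
      ‖Complex.exp (-q p * (y : ℂ) ^ 2)‖ ≤ Real.exp (m / 2) * Real.exp (-(m / 2) * |y|) := by
    filter_upwards [hqre] with p hp y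
    rw [Complex.norm_exp, ← Real.exp_add, ← Complex.ofReal_pow, Complex.re_mul_ofReal,
      Complex.neg_re]
    apply Real.exp_le_exp.2
    have : |y| - 1 ≤ y ^ 2 := by
      rw [← sq_abs]
      nlinarith [sq_nonneg (|y| - 1), abs_nonneg y]
    nlinarith [sq_nonneg y]
  have hI1 : Integrable fun y : ℝ => Real.exp κ * Real.exp (-κ * |y|) :=
    (integrable_exp_neg_mul_abs hκ0).const_mul _
  have hI2 : Integrable fun y : ℝ => Real.exp (m / 2) * Real.exp (-(m / 2) * |y|) :=
    (integrable_exp_neg_mul_abs (half_pos hm0)).const_mul _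
  have hlim : Tendsto (fun p : ℝ × ℝ => ∫ y : ℝ, (Complex.exp (saddleExponent V p y) -
      Complex.exp (-q p * (y : ℂ) ^ 2))) l (𝓝 (∫ y : ℝ, (0 : ℂ))) := by
    refine tendsto_integral_filter_of_dominated_convergence
      (fun y => Real.exp κ * Real.exp (-κ * |y|) + Real.exp (m / 2) * Real.exp (-(m / 2) * |y|))
      ?_ ?_ (hI1.add hI2) ?_
    · filter_upwards [hstrip] with p hp
      have := hV.continuous_saddleExponent hp
      exact Continuous.aestronglyMeasurable (by fun_prop)
    · filter_upwards [hbound1, hbound2] with p h1 h2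
      exact Eventually.of_forall fun y => (norm_sub_le _ _).trans (add_le_add (h1 y) (h2 y))
    · refine Eventually.of_forall fun y => ?_
      have hdiff : Tendsto (fun p => saddleExponent V p y + q p * (y : ℂ) ^ 2) l (𝓝 0) := by
        rw [Metric.tendsto_nhds]
        intro ε hε
        obtain ⟨δ, hδ0, hδ⟩ := hV.exists_taylor_two hα
          (show 0 < ε / 2 / (y ^ 2 + 1) by positivity)
        have hvl : ∀ᶠ p : ℝ × ℝ in l, (|y| / δ) ^ 2 ≤ (V p.1).re :=
          hto (P := fun x _ => (|y| / δ) ^ 2 ≤ (V x).re)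
            ((hV.tendsto_atTop.eventually_ge_atTop _).mono fun x hx _ _ => hx)
        filter_upwards [hto hδ, hvl] with p hp hpv
        have hv := hV.pos p.1
        have hs0 : 0 < √(V p.1).re := Real.sqrt_pos.2 hv
        have hs : ‖((y / √(V p.1).re : ℝ) : ℂ)‖ ≤ δ := by
          rw [Complex.norm_real, Real.norm_eq_abs, abs_div, abs_of_pos hs0, div_le_iff₀ hs0,
            ← div_le_iff₀' hδ0]
          exact Real.le_sqrt_of_sq_le hpv
        have h := hp _ hs
        have h2 : ((y / √(V p.1).re : ℝ) : ℂ) ^ 2 = y ^ 2 / (V p.1).re := by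
          rw [← Complex.ofReal_pow, div_pow, Real.sq_sqrt hv.le]
          push_cast
          rfl
        have h3 : saddleExponent V p y + q p * (y : ℂ) ^ 2 =
            -(V (p.1 + p.2 * Complex.I + (y / √(V p.1).re : ℝ)) - V (p.1 + p.2 * Complex.I) -
              deriv V (p.1 + p.2 * Complex.I) * (y / √(V p.1).re : ℝ) -
              deriv (deriv V) (p.1 + p.2 * Complex.I) * ((y / √(V p.1).re : ℝ) : ℂ) ^ 2 / 2) := by
          rw [saddleExponent, hq, h2]
          ring
        have h4 : ‖((y / √(V p.1).re : ℝ) : ℂ)‖ ^ 2 = y ^ 2 / (V p.1).re := by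
          rw [← norm_pow, h2, ← Complex.ofReal_pow, ← Complex.ofReal_div, Complex.norm_real,
            Real.norm_of_nonneg (by positivity)]
        rw [dist_zero_right, h3, norm_neg]
        refine h.trans_lt ?_
        rw [h4]
        have h5 : ε / 2 / (y ^ 2 + 1) * (V p.1).re * (y ^ 2 / (V p.1).re) =
            ε / 2 * (y ^ 2 / (y ^ 2 + 1)) := by
          field_simp
        rw [h5]
        have h6 : y ^ 2 / (y ^ 2 + 1) ≤ 1 := by
          rw [div_le_one (by positivity)]; linarith
        nlinarith
      have hexp : Tendsto (fun p => Complex.exp (saddleExponent V p y + q p * (y : ℂ) ^ 2) - 1) l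
          (𝓝 0) := by
        have := (Complex.continuous_exp.tendsto 0).comp hdiff
        rw [Complex.exp_zero] at this
        simpa using this.sub_const 1
      refine squeeze_zero_norm' ?_ (tendsto_zero_iff_norm_tendsto_zero.1 hexp)
      filter_upwards [hqre] with p hp
      have h1 : Complex.exp (saddleExponent V p y) - Complex.exp (-q p * (y : ℂ) ^ 2) =
          Complex.exp (-q p * (y : ℂ) ^ 2) *
            (Complex.exp (saddleExponent V p y + q p * (y : ℂ) ^ 2) - 1) := by
        rw [mul_sub, ← Complex.exp_add, mul_one]
        congr 2
        ring
      rw [h1, norm_mul]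
      apply mul_le_of_le_one_left (norm_nonneg _)
      rw [Complex.norm_exp, Real.exp_le_one_iff, ← Complex.ofReal_pow, Complex.re_mul_ofReal,
        Complex.neg_re]
      nlinarith [sq_nonneg y]
  rw [integral_zero] at hlim
  have hc0 : 0 < Real.sqrt (Real.pi / (ρ ^ 2 + 1)) := by
    have := Real.pi_pos
    positivity
  have hc2 : Real.sqrt (Real.pi / ((ρ ^ 2 + 1) / 2)) =
      Real.sqrt 2 * Real.sqrt (Real.pi / (ρ ^ 2 + 1)) := by
    rw [← Real.sqrt_mul (by norm_num)]
    congr 1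
    field_simp
  -- The Gaussian exceeds the target by the factor √2 ≥ 1.4, so an error of 0.4 times the target is
  -- affordable.
  have hsq : 1.4 ≤ Real.sqrt 2 := Real.le_sqrt_of_sq_le (by norm_num)
  filter_upwards [hbound1, hbound2, hqre, hqnorm, hstrip,
    (Metric.tendsto_nhds.1 hlim) (0.4 * Real.sqrt (Real.pi / (ρ ^ 2 + 1))) (by positivity)]
    with p h1 h2 h3 h4 h5 h6
  have hi1 : Integrable fun y : ℝ => Complex.exp (saddleExponent V p y) := by
    have := hV.continuous_saddleExponent h5
    exact hI1.mono' (Continuous.aestronglyMeasurable (by fun_prop)) (Eventually.of_forall h1)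
  have hi2 : Integrable fun y : ℝ => Complex.exp (-q p * (y : ℂ) ^ 2) :=
    hI2.mono' (Continuous.aestronglyMeasurable (by fun_prop)) (Eventually.of_forall h2)
  rw [integral_sub hi1 hi2, dist_zero_right, integral_gaussian_complex (by linarith)] at h6
  have hq0 : q p ≠ 0 := by
    intro h
    rw [h] at h3
    simp at h3
    linarith
  have h7 : ‖((Real.pi : ℂ) / q p) ^ (1 / 2 : ℂ)‖ = Real.sqrt (Real.pi / ‖q p‖) := by
    have := Complex.norm_cpow_real ((Real.pi : ℂ) / q p) (1 / 2)
    push_cast at this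
    rw [this, norm_div, Complex.norm_real, Real.norm_of_nonneg Real.pi_pos.le, Real.sqrt_eq_rpow]
  have h8 : Real.sqrt (Real.pi / ((ρ ^ 2 + 1) / 2)) ≤ Real.sqrt (Real.pi / ‖q p‖) := by
    apply Real.sqrt_le_sqrt
    have := norm_pos_iff.2 hq0
    have := Real.pi_pos
    gcongr
  have h9 := norm_sub_norm_le (((Real.pi : ℂ) / q p) ^ (1 / 2 : ℂ))
    (∫ y : ℝ, Complex.exp (saddleExponent V p y))
  rw [norm_sub_rev] at h9
  rw [h7] at h9
  nlinarith

/-- Lower bound for the Laplace transform at the values of `V'`. -/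
theorem eventually_le_norm_laplaceExpNeg_deriv (ha : 0 ≤ a) (hB : HasStripBound ρ a V) {α : ℝ}
    (hα0 : 0 ≤ α) (hα : α < Real.pi / (2 * ρ)) :
    ∀ᶠ x : ℝ in atTop, ∀ β : ℝ, |β| ≤ α →
      Real.sqrt (Real.pi / (ρ ^ 2 + 1)) / √(V x).re *
        Real.exp (deriv V (x + β * Complex.I) * (x + β * Complex.I) - V (x + β * Complex.I)).re ≤
      ‖laplaceExpNeg V (deriv V (x + β * Complex.I))‖ := by
  obtain ⟨k, hk0, hk⟩ := hV.eventually_deriv_re hα0 hα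
  have h := hV.tendsto_integral_saddleExponent ha hB hα0 hα
  rw [Filter.eventually_prod_principal_iff] at h
  filter_upwards [h, hk, hV.tendsto_atTop.eventually_gt_atTop (a / k)] with x hx hkx hvx β hβ
  have hx := hx β (abs_le.1 hβ)
  have hre : a < (deriv V (x + β * Complex.I)).re := by
    rw [div_lt_iff₀ hk0] at hvx
    linarith [hkx β hβ]
  have hs0 : 0 < √(V x).re := Real.sqrt_pos.2 (hV.pos x)
  rw [hV.laplaceExpNeg_shift hB (hβ.trans_lt hα) hre]
  set s := deriv V (x + β * Complex.I) with hs
  set f : ℝ → ℂ := fun t => Complex.exp (s * (t + β * Complex.I) - V (t + β * Complex.I)) with hf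
  have h1 : ∀ y : ℝ, f (x + y / √(V x).re) =
      Complex.exp (s * (x + β * Complex.I) - V (x + β * Complex.I)) *
        Complex.exp (saddleExponent V (x, β) y) := by
    intro y
    rw [hf, ← Complex.exp_add, saddleExponent]
    simp only [← hs]
    have e : ((x + y / √(V x).re : ℝ) : ℂ) + β * Complex.I =
      x + β * Complex.I + (y / √(V x).re : ℝ) := by push_cast; ring
    rw [e]
    congr 1
    ring
  have h2 : ∫ y : ℝ, f (x + y / √(V x).re) = √(V x).re * ∫ t : ℝ, f t := by
    rw [Measure.integral_comp_div (fun y => f (x + y)), integral_add_left_eq_self f x,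
      abs_of_pos hs0]
    simp
  simp_rw [h1] at h2
  rw [integral_const_mul] at h2
  have h3 := congrArg norm h2
  rw [norm_mul, norm_mul, Complex.norm_real, Real.norm_of_nonneg hs0.le, Complex.norm_exp] at h3
  rw [div_mul_eq_mul_div, div_le_iff₀ hs0, mul_comm ‖_‖, ← h3, mul_comm]
  gcongr

end IsGrowthFun

/-! ### Solving the saddle point equation -/

namespace IsGrowthFun

variable {ρ a : ℝ} {V : ℂ → ℂ} (hV : IsGrowthFun ρ V)
include hV

omit hV in
theorem mem_rect_of_mem_closedBall {α δ β : ℝ} (hβ : |β| ≤ α) {z : ℂ}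
    (hz : z ∈ Metric.closedBall (β * Complex.I) δ) :
    z ∈ Icc (-δ) δ ×ℂ Icc (-(α + δ)) (α + δ) := by
  rw [mem_closedBall_iff_norm] at hz
  have h1 := abs_le.1 ((Complex.abs_re_le_norm _).trans hz)
  have h2 := abs_le.1 ((Complex.abs_im_le_norm _).trans hz)
  have h3 := abs_le.1 hβ
  have e1 : (z - β * Complex.I).re = z.re := by simp
  have e2 : (z - β * Complex.I).im = z.im - β := by simp
  rw [e1] at h1
  rw [e2] at h2
  refine ⟨h1, ?_⟩
  rw [mem_preimage, mem_Icc]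
  constructor <;> linarith

/-- The saddle point equation `V'(w) = s` is solvable close to the expected point. -/
theorem eventually_exists_saddle {α δ : ℝ} (hα : α + δ < Real.pi / (2 * ρ)) (hδ : 0 < δ)
    (hδ1 : ρ * δ ≤ 1 / 2) :
    ∀ᶠ x : ℝ in atTop, ∀ β : ℝ, |β| ≤ α → ∃ u ∈ Metric.closedBall (β * Complex.I) δ,
      deriv V (x + u) = (deriv V x).re * Complex.exp (ρ * (β * Complex.I)) := by
  have hρ := hV.order_pos
  -- With ρ²δ = 16η the image of the disc contains a ball of radius (8η - 2η)/2 = 3η about f(c),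
  -- while the target value is within 2η of f(c).
  obtain ⟨η, hη⟩ : ∃ η, η = ρ ^ 2 * δ / 16 := ⟨_, rfl⟩
  have hη0 : 0 < η := by rw [hη]; positivity
  have hcomp : IsCompact (Icc (-δ) δ ×ℂ Icc (-(α + δ)) (α + δ)) :=
    isCompact_Icc.reProdIm isCompact_Icc
  have hKs := rect_subset_strip hα (-δ) δ
  filter_upwards [hV.uniform_deriv hcomp hKs hη0,
    hV.uniform_deriv_two hcomp hKs (show 0 < ρ ^ 2 by positivity),
    (Metric.tendsto_nhds.1 hV.tendsto_deriv_div) η hη0] with x hx hx2 hx0 β hβ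
  have hvx := hV.pos x
  have hvx' : ((V x).re : ℂ) ≠ 0 := by exact_mod_cast hvx.ne'
  set c : ℂ := β * Complex.I with hc
  have hball : ∀ z ∈ Metric.closedBall c δ, z ∈ Icc (-δ) δ ×ℂ Icc (-(α + δ)) (α + δ) :=
    fun z hz => mem_rect_of_mem_closedBall hβ hz
  have hcm : c ∈ Metric.closedBall c δ := Metric.mem_closedBall_self hδ.le
  have hexp1 : ‖Complex.exp (ρ * c)‖ = 1 := by
    rw [hc, ← mul_assoc, ← Complex.ofReal_mul, Complex.norm_exp_ofReal_mul_I]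
  set f : ℂ → ℂ := fun u => deriv V (u + x) / (V x).re with hf
  have hdf : ∀ z ∈ Metric.closedBall c δ,
      HasDerivAt f (deriv (deriv V) (z + x) / (V x).re) z := by
    intro z hz
    have h1 : HasDerivAt (fun u : ℂ => deriv V (u + x)) (deriv (deriv V) (z + x)) z :=
      (hV.analyticAt (add_mem (hKs (hball z hz)) x)).deriv.differentiableAt.hasDerivAt.comp_add_const
        _ _
    exact h1.div_const _
  -- Quantitative open mapping theorem for V'(u + x)/V(x) ≈ ρ e^{ρu}: on the circle of radius δ the
  -- model differs from its value at the centre by at least ρ²δ/2.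
  have hsub := DiffContOnCl.ball_subset_image_closedBall (f := f) (z₀ := c) (r := δ)
    (ε := ρ ^ 2 * δ / 2 - 2 * η)
    (by
      apply DifferentiableOn.diffContOnCl
      rw [closure_ball _ hδ.ne']
      exact fun z hz => (hdf z hz).differentiableAt.differentiableWithinAt) hδ
    (by
      intro z hz
      have hzb := Metric.sphere_subset_closedBall hz
      have h1 := hx z (hball z hzb)
      have h2 := hx c (hball c hcm)
      have hz' : ‖z - c‖ = δ := mem_sphere_iff_norm.1 hz
      have h3 : ρ ^ 2 * δ / 2 ≤ ‖ρ * Complex.exp (ρ * z) - ρ * Complex.exp (ρ * c)‖ := by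
        have e : ρ * Complex.exp (ρ * z) - ρ * Complex.exp (ρ * c) =
            ρ * (Complex.exp (ρ * c) * (Complex.exp (ρ * (z - c)) - 1)) := by
          rw [mul_sub (Complex.exp _), ← Complex.exp_add]
          ring_nf
        have hn : ‖(ρ : ℂ) * (z - c)‖ = ρ * δ := by
          rw [norm_mul, Complex.norm_real, Real.norm_of_nonneg hρ.le, hz']
        have h4 := Complex.norm_exp_sub_one_sub_id_le (x := (ρ : ℂ) * (z - c)) (by rw [hn]; linarith)
        rw [hn] at h4
        have h5 := norm_le_norm_add_norm_sub' ((ρ : ℂ) * (z - c)) (Complex.exp (ρ * (z - c)) - 1)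
        rw [hn, norm_sub_rev ((ρ : ℂ) * (z - c))] at h5
        rw [e, norm_mul, norm_mul, hexp1, Complex.norm_real, Real.norm_of_nonneg hρ.le, one_mul]
        have h6 : ρ * δ / 2 ≤ ‖Complex.exp (ρ * (z - c)) - 1‖ := by nlinarith
        nlinarith
      have h4 : ρ * Complex.exp (ρ * z) - ρ * Complex.exp (ρ * c) =
          (f z - f c) - (deriv V (z + x) / (V x).re - ρ * Complex.exp (ρ * z)) +
          (deriv V (c + x) / (V x).re - ρ * Complex.exp (ρ * c)) := by
        rw [hf]; ring
      rw [h4] at h3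
      have h5 := h3.trans ((norm_add_le _ _).trans (add_le_add_left (norm_sub_le _ _) _))
      linarith)
    (by
      have hd := hdf c hcm
      have hne : deriv (deriv V) (c + x) / (V x).re ≠ 0 := by
        intro h0
        have h2 := hx2 c (hball c hcm)
        rw [h0, zero_sub, norm_neg, norm_mul, hexp1, ← Complex.ofReal_pow, Complex.norm_real,
          Real.norm_of_nonneg (by positivity)] at h2
        linarith
      exact (hd.eventually_ne hne).frequently.filter_mono nhdsWithin_le_nhds)
  have hmem : ((deriv V x).re * Complex.exp (ρ * c) / (V x).re : ℂ) ∈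
      Metric.ball (f c) ((ρ ^ 2 * δ / 2 - 2 * η) / 2) := by
    rw [mem_ball_iff_norm]
    have h2 := hx c (hball c hcm)
    have h3 : ((deriv V x).re * Complex.exp (ρ * c) / (V x).re : ℂ) - f c =
        (((deriv V x).re / (V x).re - ρ : ℝ) : ℂ) * Complex.exp (ρ * c) -
          (deriv V (c + x) / (V x).re - ρ * Complex.exp (ρ * c)) := by
      rw [hf]; push_cast; ring
    rw [h3]
    refine (norm_sub_le _ _).trans_lt ?_
    rw [norm_mul, hexp1, mul_one, Complex.norm_real]
    rw [Real.dist_eq] at hx0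
    rw [Real.norm_eq_abs]
    have : ρ ^ 2 * δ = 16 * η := by rw [hη]; ring
    rw [this]
    linarith
  obtain ⟨u, hu, hu'⟩ := hsub hmem
  refine ⟨u, hu, ?_⟩
  rw [hf] at hu'
  simp only at hu'
  rw [div_left_inj' hvx'] at hu'
  rw [add_comm, hu']

/-- Lower bound for the Laplace transform of `exp (-V)` in the right half-plane. -/
theorem eventually_le_norm_laplaceExpNeg (ha : 0 ≤ a) (hB : HasStripBound ρ a V) {α ε : ℝ}
    (hα0 : 0 ≤ α) (hα : α < Real.pi / (2 * ρ)) (hε : 0 < ε) :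
    ∀ᶠ x : ℝ in atTop, ∀ β : ℝ, |β| ≤ α →
      Real.exp ((deriv V x).re * (Real.cos (ρ * β) * x - β * Real.sin (ρ * β)) -
        (Real.cos (ρ * β) + ε) * (V x).re) ≤
      ‖laplaceExpNeg V ((deriv V x).re * Complex.exp (ρ * (β * Complex.I)))‖ := by
  have hρ := hV.order_pos
  obtain ⟨d, hd0, hd⟩ := exists_between (sub_pos.2 hα)
  -- The true saddle x + u is within `δ` of x + iβ. The last entry bounds the resulting change of
  -- Re(sw - V(w)) by (ε/4) V(x), apart from the asymptotic error of V. The entry 1 allows V(x + Re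
  -- u) to be compared with V(x + 1).
  obtain ⟨δ, hδ⟩ : ∃ δ, δ = min d (min (1 / (2 * ρ)) (min 1 (ε / (12 * (ρ + 1))))) := ⟨_, rfl⟩
  have hδ0 : 0 < δ := by rw [hδ]; positivity
  have hδd : δ ≤ d := hδ ▸ min_le_left _ _
  have hδ1 : ρ * δ ≤ 1 / 2 := by
    have : δ ≤ 1 / (2 * ρ) := hδ ▸ (min_le_right _ _).trans (min_le_left _ _)
    rw [le_div_iff₀ (by positivity)] at this
    linarith
  have hδ11 : δ ≤ 1 :=
    hδ ▸ (min_le_right _ _).trans ((min_le_right _ _).trans (min_le_left _ _))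
  have hδε : 3 * (ρ + 1) * δ ≤ ε / 4 := by
    have : δ ≤ ε / (12 * (ρ + 1)) :=
      hδ ▸ (min_le_right _ _).trans ((min_le_right _ _).trans (min_le_right _ _))
    rw [le_div_iff₀ (by positivity)] at this
    linarith
  have hαδ : α + δ < Real.pi / (2 * ρ) := by linarith
  obtain ⟨X, hX⟩ := eventually_atTop.1
    (hV.eventually_le_norm_laplaceExpNeg_deriv ha hB (by linarith : 0 ≤ α + δ) hαδ)
  -- The factor V^{-1/2} of the Gaussian integral is absorbed into exp(-(ε/4) V(x)). The constant
  -- 2e^ρ bounds V(x + 1)/V(x).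
  have hsqrt : ∀ᶠ x : ℝ in atTop, √(2 * Real.exp ρ * (V x).re) * Real.exp (-(ε / 4) * (V x).re) ≤
      √(Real.pi / (ρ ^ 2 + 1)) := by
    have h1 := (tendsto_rpow_mul_exp_neg_mul_atTop_nhds_zero (1 / 2) (ε / 4) (by positivity)).comp
      hV.tendsto_atTop
    have h2 := h1.const_mul √(2 * Real.exp ρ)
    rw [mul_zero] at h2
    have hpos : 0 < √(Real.pi / (ρ ^ 2 + 1)) := by
      have := Real.pi_pos
      positivity
    filter_upwards [h2.eventually_le_const hpos] with x hx
    rw [Real.sqrt_mul (by positivity), mul_assoc, Real.sqrt_eq_rpow (V x).re]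
    exact hx
  filter_upwards [hV.eventually_exists_saddle hαδ hδ0 hδ1, eventually_ge_atTop (X + 1), hsqrt,
    hV.uniform (isCompact_Icc.reProdIm isCompact_Icc) (rect_subset_strip hαδ (-δ) δ)
      (show 0 < ε / 4 by positivity),
    (hV.tendsto_shift_div 1).eventually_le_const
      (show Real.exp (ρ * 1) < 2 * Real.exp ρ by rw [mul_one]; linarith [Real.exp_pos ρ]),
    hV.tendsto_deriv_div.eventually_le_const (show ρ < ρ + 1 by linarith),
    hV.tendsto_deriv_div.eventually_const_le (show 0 < ρ from hρ)]
    with x hx hxX hxs hxV hxt hxd hxd0 β hβ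
  have hvx := hV.pos x
  obtain ⟨u, hu, hVu⟩ := hx β hβ
  have hum := mem_rect_of_mem_closedBall hβ hu
  rw [div_le_iff₀ hvx] at hxt hxd
  have hd0' : 0 ≤ (deriv V x).re := by
    rw [le_div_iff₀ hvx, zero_mul] at hxd0
    exact hxd0
  have hu1 : u.re ∈ Icc (-δ) δ := hum.1
  have hu2 : |u.im| ≤ α + δ := abs_le.2 hum.2
  have hmain := hX (x + u.re) (by linarith [hu1.1]) u.im hu2
  have e1 : ((x + u.re : ℝ) : ℂ) + u.im * Complex.I = x + u := by
    conv_rhs => rw [← Complex.re_add_im u]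
    push_cast; ring
  rw [e1, hVu] at hmain
  refine le_trans ?_ hmain
  set s : ℂ := (deriv V x).re * Complex.exp (ρ * (β * Complex.I)) with hs
  have hexp1 : ‖Complex.exp (ρ * (β * Complex.I))‖ = 1 := by
    rw [← mul_assoc, ← Complex.ofReal_mul, Complex.norm_exp_ofReal_mul_I]
  have hsn : ‖s‖ ≤ (ρ + 1) * (V x).re := by
    rw [hs, norm_mul, hexp1, mul_one, Complex.norm_real, Real.norm_of_nonneg hd0']
    exact hxd
  have hun : ‖u - β * Complex.I‖ ≤ δ := mem_closedBall_iff_norm.1 hu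
  have hsre : (s * (x + β * Complex.I)).re =
      (deriv V x).re * (Real.cos (ρ * β) * x - β * Real.sin (ρ * β)) := by
    rw [hs, mul_assoc, Complex.re_ofReal_mul, ← mul_assoc (ρ : ℂ), ← Complex.ofReal_mul,
      Complex.mul_re, Complex.exp_ofReal_mul_I_re, Complex.exp_ofReal_mul_I_im]
    simp
    ring_nf
    simp
  have h1 : (deriv V x).re * (Real.cos (ρ * β) * x - β * Real.sin (ρ * β)) -
      (ρ + 1) * (V x).re * δ ≤ (s * (x + u)).re := by
    have h2 : s * (x + u) = s * (x + β * Complex.I) + s * (u - β * Complex.I) := by ring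
    rw [h2, Complex.add_re, hsre]
    have h3 : ‖s * (u - β * Complex.I)‖ ≤ (ρ + 1) * (V x).re * δ := by
      rw [norm_mul]; gcongr
    linarith [(abs_le.1 ((Complex.abs_re_le_norm _).trans h3)).1]
  have h2 : (V (x + u)).re ≤ (Real.cos (ρ * β) + ε / 4 + 2 * (ρ * δ)) * (V x).re := by
    have h3 := hxV u hum
    rw [add_comm u] at h3
    have h4 : ‖((V x).re : ℂ) * Complex.exp (ρ * u) -
        (V x).re * Complex.exp (ρ * (β * Complex.I))‖ ≤ (V x).re * (2 * (ρ * δ)) := by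
      have e : ((V x).re : ℂ) * Complex.exp (ρ * u) -
          (V x).re * Complex.exp (ρ * (β * Complex.I)) = (V x).re *
            (Complex.exp (ρ * (β * Complex.I)) *
              (Complex.exp (ρ * (u - β * Complex.I)) - 1)) := by
        rw [mul_sub (Complex.exp _), ← Complex.exp_add]
        ring_nf
      rw [e, norm_mul, norm_mul, hexp1, Complex.norm_real, Real.norm_of_nonneg hvx.le, one_mul]
      have hn : ‖(ρ : ℂ) * (u - β * Complex.I)‖ ≤ ρ * δ := by
        rw [norm_mul, Complex.norm_real, Real.norm_of_nonneg hρ.le]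
        gcongr
      gcongr
      exact (Complex.norm_exp_sub_one_le (by linarith)).trans (by linarith)
    have h5 := (norm_add_le _ _).trans (add_le_add h3 h4)
    rw [sub_add_sub_cancel] at h5
    have h6 := (abs_le.1 ((Complex.abs_re_le_norm _).trans h5)).2
    rw [Complex.sub_re, Complex.re_ofReal_mul, exp_mul_I_re] at h6
    linarith
  have h3 : Real.exp (-(ε / 4) * (V x).re) ≤
      √(Real.pi / (ρ ^ 2 + 1)) / √(V (x + u.re : ℝ)).re := by
    rw [le_div_iff₀ (Real.sqrt_pos.2 (hV.pos _)), mul_comm]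
    refine le_trans ?_ hxs
    gcongr
    refine le_trans ?_ hxt
    exact hV.mono.monotone (by linarith [hu1.2])
  refine le_trans ?_ (mul_le_mul_of_nonneg_right h3 (Real.exp_pos _).le)
  rw [← Real.exp_add]
  apply Real.exp_le_exp.2
  rw [Complex.sub_re]
  have h4 := mul_le_mul_of_nonneg_right hδε hvx.le
  have h5 : 0 ≤ δ * (V x).re := by positivity
  nlinarith

end IsGrowthFun

/-! ### Rectangular contours and residues at simple poles -/

/-- The integral of `f` along the boundary of the rectangle `[l, r] × [-ψ, ψ]`. -/
def rectIntegral (f : ℂ → ℂ) (l r ψ : ℝ) : ℂ :=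
  (∫ x in l..r, f (x - ψ * Complex.I)) - (∫ x in l..r, f (x + ψ * Complex.I)) +
    Complex.I * (∫ y in (-ψ)..ψ, f (r + y * Complex.I)) -
    Complex.I * ∫ y in (-ψ)..ψ, f (l + y * Complex.I)

theorem rectIntegral_eq_zero {f : ℂ → ℂ} {l r ψ : ℝ} (hlr : l ≤ r) (hψ : 0 ≤ ψ)
    (hf : DifferentiableOn ℂ f (Icc l r ×ℂ Icc (-ψ) ψ)) : rectIntegral f l r ψ = 0 := by
  have h := Complex.integral_boundary_rect_eq_zero_of_differentiableOn f
    (l - ψ * Complex.I) (r + ψ * Complex.I) (by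
      simpa [uIcc_of_le hlr, uIcc_of_le (neg_le_self hψ)] using hf)
  simp only [Complex.sub_re, Complex.ofReal_re, Complex.mul_re, Complex.I_re, mul_zero,
    Complex.ofReal_im, Complex.I_im, mul_one, sub_self, sub_zero, Complex.add_re, add_zero,
    Complex.sub_im, Complex.mul_im, zero_sub, Complex.add_im, zero_add,
    smul_eq_mul, Complex.ofReal_neg, neg_mul, ← sub_eq_add_neg] at h
  exact h

theorem rectIntegral_congr {f g : ℂ → ℂ} {l r ψ p : ℝ} (hlp : l < p) (hpr : p < r) (hψ : 0 < ψ)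
    (h : ∀ z ∈ Icc l r ×ℂ Icc (-ψ) ψ, z ≠ p → f z = g z) :
    rectIntegral f l r ψ = rectIntegral g l r ψ := by
  have hlr := (hlp.trans hpr).le
  unfold rectIntegral
  congr 1
  · congr 1
    · congr 1
      · refine intervalIntegral.integral_congr fun x hx => ?_
        rw [uIcc_of_le hlr] at hx
        refine h _ ⟨by simpa using hx, by simp [hψ.le]⟩ fun h => ?_
        have := congrArg Complex.im h
        simp at this
        exact hψ.ne' this
      · refine intervalIntegral.integral_congr fun x hx => ?_
        rw [uIcc_of_le hlr] at hx
        refine h _ ⟨by simpa using hx, by simp [hψ.le]⟩ fun h => ?_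
        have := congrArg Complex.im h
        simp at this
        exact hψ.ne' this
    · congr 1
      refine intervalIntegral.integral_congr fun y hy => ?_
      rw [uIcc_of_le (by linarith)] at hy
      refine h _ ⟨by simp [hlr], by simpa using hy⟩ fun h => ?_
      have := congrArg Complex.re h
      simp at this
      linarith
  · congr 1
    refine intervalIntegral.integral_congr fun y hy => ?_
    rw [uIcc_of_le (by linarith)] at hy
    refine h _ ⟨by simp [hlr], by simpa using hy⟩ fun h => ?_
    have := congrArg Complex.re h
    simp at this
    linarith

theorem rectIntegral_add {f g : ℂ → ℂ} {l r ψ p : ℝ} (hlp : l < p) (hpr : p < r) (hψ : 0 < ψ)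
    (hf : ∀ z ∈ Icc l r ×ℂ Icc (-ψ) ψ, z ≠ p → ContinuousWithinAt f (Icc l r ×ℂ Icc (-ψ) ψ) z)
    (hg : ∀ z ∈ Icc l r ×ℂ Icc (-ψ) ψ, z ≠ p → ContinuousWithinAt g (Icc l r ×ℂ Icc (-ψ) ψ) z) :
    rectIntegral (fun z => f z + g z) l r ψ = rectIntegral f l r ψ + rectIntegral g l r ψ := by
  have hlr := (hlp.trans hpr).le
  have hψ' : -ψ ≤ ψ := by linarith
  have key : ∀ (f : ℂ → ℂ) (_ : ∀ z ∈ Icc l r ×ℂ Icc (-ψ) ψ, z ≠ p →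
      ContinuousWithinAt f (Icc l r ×ℂ Icc (-ψ) ψ) z),
      IntervalIntegrable (fun x : ℝ => f (x - ψ * Complex.I)) volume l r ∧
      IntervalIntegrable (fun x : ℝ => f (x + ψ * Complex.I)) volume l r ∧
      IntervalIntegrable (fun y : ℝ => f (r + y * Complex.I)) volume (-ψ) ψ ∧
      IntervalIntegrable (fun y : ℝ => f (l + y * Complex.I)) volume (-ψ) ψ := by
    intro f hf
    refine ⟨?_, ?_, ?_, ?_⟩
    · refine ContinuousOn.intervalIntegrable fun x hx => ?_
      rw [uIcc_of_le hlr] at hx ⊢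
      refine (hf (x - ψ * Complex.I) ⟨by simpa using hx, by simp [hψ.le]⟩ fun h => ?_).comp
        (f := fun x : ℝ => (x : ℂ) - ψ * Complex.I)
        (Continuous.continuousWithinAt (by fun_prop)) fun y hy => ?_
      · have := congrArg Complex.im h
        simp at this
        exact hψ.ne' this
      · exact ⟨by simpa using hy, by simp [hψ.le]⟩
    · refine ContinuousOn.intervalIntegrable fun x hx => ?_
      rw [uIcc_of_le hlr] at hx ⊢
      refine (hf (x + ψ * Complex.I) ⟨by simpa using hx, by simp [hψ.le]⟩ fun h => ?_).comp
        (f := fun x : ℝ => (x : ℂ) + ψ * Complex.I)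
        (Continuous.continuousWithinAt (by fun_prop)) fun y hy => ?_
      · have := congrArg Complex.im h
        simp at this
        exact hψ.ne' this
      · exact ⟨by simpa using hy, by simp [hψ.le]⟩
    · refine ContinuousOn.intervalIntegrable fun x hx => ?_
      rw [uIcc_of_le hψ'] at hx ⊢
      refine (hf (r + x * Complex.I) ⟨by simp [hlr], by simpa using hx⟩ fun h => ?_).comp
        (f := fun x : ℝ => (r : ℂ) + x * Complex.I)
        (Continuous.continuousWithinAt (by fun_prop)) fun y hy => ?_
      · have := congrArg Complex.re h
        simp at this
        linarith
      · exact ⟨by simp [hlr], by simpa using hy⟩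
    · refine ContinuousOn.intervalIntegrable fun x hx => ?_
      rw [uIcc_of_le hψ'] at hx ⊢
      refine (hf (l + x * Complex.I) ⟨by simp [hlr], by simpa using hx⟩ fun h => ?_).comp
        (f := fun x : ℝ => (l : ℂ) + x * Complex.I)
        (Continuous.continuousWithinAt (by fun_prop)) fun y hy => ?_
      · have := congrArg Complex.re h
        simp at this
        linarith
      · exact ⟨by simp [hlr], by simpa using hy⟩
  obtain ⟨f1, f2, f3, f4⟩ := key f hf
  obtain ⟨g1, g2, g3, g4⟩ := key g hg
  unfold rectIntegral
  rw [intervalIntegral.integral_add f1 g1, intervalIntegral.integral_add f2 g2,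
    intervalIntegral.integral_add f3 g3, intervalIntegral.integral_add f4 g4]
  ring

theorem rectIntegral_const_mul (c : ℂ) (f : ℂ → ℂ) (l r ψ : ℝ) :
    rectIntegral (fun z => c * f z) l r ψ = c * rectIntegral f l r ψ := by
  unfold rectIntegral
  simp only [intervalIntegral.integral_const_mul]
  ring

/-- The principal logarithm of z - p is a primitive on the bottom, right and top sides. The left
side crosses the cut, so log(p - z) is used there, and the mismatches at the two left corners
contribute πi each. -/
theorem rectIntegral_inv_sub {l r ψ p : ℝ} (hlp : l < p) (hpr : p < r) (hψ : 0 < ψ) :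
    rectIntegral (fun z => (z - p)⁻¹) l r ψ = 2 * Real.pi * Complex.I := by
  have hhor : ∀ b : ℝ, b ≠ 0 → ∫ x in l..r, ((x : ℂ) + b * Complex.I - p)⁻¹ =
      Complex.log (r + b * Complex.I - p) - Complex.log (l + b * Complex.I - p) := by
    intro b hb
    have hmem : ∀ x : ℝ, (x : ℂ) + b * Complex.I - p ∈ Complex.slitPlane := fun x =>
      Or.inr (by simpa using hb)
    have hd : ∀ x : ℝ, HasDerivAt (fun x : ℝ => Complex.log ((x : ℂ) + b * Complex.I - p))
        ((x : ℂ) + b * Complex.I - p)⁻¹ x := by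
      intro x
      have h1 : HasDerivAt (fun x : ℝ => (x : ℂ) + b * Complex.I - p) 1 x :=
        ((Complex.ofRealCLM.hasDerivAt (x := x)).add_const (b * Complex.I)).sub_const (p : ℂ)
      simpa using h1.clog_real (hmem x)
    refine intervalIntegral.integral_eq_sub_of_hasDerivAt (fun x _ => hd x) ?_
    refine Continuous.intervalIntegrable ?_ _ _
    exact Continuous.inv₀ (by fun_prop) fun x => Complex.slitPlane_ne_zero (hmem x)
  have hright : Complex.I * ∫ y in (-ψ)..ψ, ((r : ℂ) + y * Complex.I - p)⁻¹ =
      Complex.log (r + ψ * Complex.I - p) - Complex.log (r - ψ * Complex.I - p) := by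
    have hmem : ∀ y : ℝ, (r : ℂ) + y * Complex.I - p ∈ Complex.slitPlane := fun y =>
      Or.inl (by simpa using hpr)
    have hd : ∀ y : ℝ, HasDerivAt (fun y : ℝ => Complex.log ((r : ℂ) + y * Complex.I - p))
        (Complex.I * ((r : ℂ) + y * Complex.I - p)⁻¹) y := by
      intro y
      have h1 : HasDerivAt (fun y : ℝ => (r : ℂ) + y * Complex.I - p) Complex.I y := by
        simpa using (((Complex.ofRealCLM.hasDerivAt (x := y)).mul_const Complex.I).const_add
          (r : ℂ)).sub_const (p : ℂ)
      simpa [div_eq_mul_inv] using h1.clog_real (hmem y)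
    rw [← intervalIntegral.integral_const_mul,
      intervalIntegral.integral_eq_sub_of_hasDerivAt (fun y _ => hd y)]
    · simp [sub_eq_add_neg]
    refine Continuous.intervalIntegrable ?_ _ _
    exact continuous_const.mul
      (Continuous.inv₀ (by fun_prop) fun x => Complex.slitPlane_ne_zero (hmem x))
  have hleft : Complex.I * ∫ y in (-ψ)..ψ, ((l : ℂ) + y * Complex.I - p)⁻¹ =
      Complex.log (p - l - ψ * Complex.I) - Complex.log (p - l + ψ * Complex.I) := by
    have hmem : ∀ y : ℝ, (p : ℂ) - l - y * Complex.I ∈ Complex.slitPlane := fun y =>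
      Or.inl (by simpa using hlp)
    have hd : ∀ y : ℝ, HasDerivAt (fun y : ℝ => Complex.log ((p : ℂ) - l - y * Complex.I))
        (Complex.I * ((l : ℂ) + y * Complex.I - p)⁻¹) y := by
      intro y
      have h1 : HasDerivAt (fun y : ℝ => (p : ℂ) - l - y * Complex.I) (-Complex.I) y := by
        simpa using ((Complex.ofRealCLM.hasDerivAt (x := y)).mul_const Complex.I).const_sub
          ((p : ℂ) - l)
      have h2 := h1.clog_real (hmem y)
      convert! h2 using 1
      have : (l : ℂ) + y * Complex.I - p = -((p : ℂ) - l - y * Complex.I) := by ring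
      rw [this, inv_neg, div_eq_mul_inv]
      ring
    rw [← intervalIntegral.integral_const_mul,
      intervalIntegral.integral_eq_sub_of_hasDerivAt (fun y _ => hd y)]
    · simp [sub_eq_add_neg]
    refine Continuous.intervalIntegrable ?_ _ _
    refine continuous_const.mul (Continuous.inv₀ (by fun_prop) fun x h => ?_)
    have := Complex.slitPlane_ne_zero (hmem x)
    exact this (by linear_combination -h)
  have hbot := hhor (-ψ) (by linarith)
  have htop := hhor ψ hψ.ne'
  simp only [Complex.ofReal_neg, neg_mul, ← sub_eq_add_neg] at hbot
  unfold rectIntegral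
  rw [hbot, htop, hright, hleft]
  have e1 : Complex.log (l + ψ * Complex.I - p) =
      Complex.log (p - l - ψ * Complex.I) + Real.pi * Complex.I := by
    have h := Complex.arg_neg_eq_arg_add_pi_of_im_neg (x := (p : ℂ) - l - ψ * Complex.I)
      (by simpa using hψ)
    have h2 : (l : ℂ) + ψ * Complex.I - p = -((p : ℂ) - l - ψ * Complex.I) := by ring
    rw [h2, Complex.log, Complex.log, norm_neg, h]
    push_cast
    ring
  have e2 : Complex.log (l - ψ * Complex.I - p) =
      Complex.log (p - l + ψ * Complex.I) - Real.pi * Complex.I := by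
    have h := Complex.arg_neg_eq_arg_sub_pi_of_im_pos (x := (p : ℂ) - l + ψ * Complex.I)
      (by simpa using hψ)
    have h2 : (l : ℂ) - ψ * Complex.I - p = -((p : ℂ) - l + ψ * Complex.I) := by ring
    rw [h2, Complex.log, Complex.log, norm_neg, h]
    push_cast
    ring
  rw [e1, e2]
  ring

/-- The residue theorem for a quotient with a simple pole in a rectangle. -/
theorem rectIntegral_div {N D : ℂ → ℂ} {l r ψ p : ℝ} (hlp : l < p) (hpr : p < r) (hψ : 0 < ψ)
    (hN : DifferentiableOn ℂ N (Icc l r ×ℂ Icc (-ψ) ψ)) (hD : Differentiable ℂ D)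
    (hDp : D p = 0) (hD' : deriv D p ≠ 0)
    (hD0 : ∀ z ∈ Icc l r ×ℂ Icc (-ψ) ψ, z ≠ p → D z ≠ 0) :
    rectIntegral (fun z => N z / D z) l r ψ = 2 * Real.pi * Complex.I * (N p / deriv D p) := by
  set R : Set ℂ := Icc l r ×ℂ Icc (-ψ) ψ with hR
  have hRp : R ∈ 𝓝 (p : ℂ) := by
    have : Ioo l r ×ℂ Ioo (-ψ) ψ ∈ 𝓝 (p : ℂ) :=
      (isOpen_Ioo.reProdIm isOpen_Ioo).mem_nhds ⟨by simp [hlp, hpr], by simp [hψ]⟩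
    exact mem_of_superset this fun z hz => ⟨Ioo_subset_Icc_self hz.1, Ioo_subset_Icc_self hz.2⟩
  have hDs : Differentiable ℂ (dslope D p) := by
    rw [← differentiableOn_univ]
    exact (Complex.differentiableOn_dslope univ_mem).2 hD.differentiableOn
  have hds : ∀ z : ℂ, D z = (z - p) * dslope D p z := fun z => by
    have := sub_smul_dslope D (p : ℂ) z
    rw [hDp, sub_zero, smul_eq_mul] at this
    exact this.symm
  have hDs0 : ∀ z ∈ R, dslope D p z ≠ 0 := by
    intro z hz
    by_cases h : z = p
    · rw [h, dslope_same]; exact hD'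
    · have := hD0 z hz h
      rw [hds z] at this
      exact right_ne_zero_of_mul this
  -- Dividing out the simple zero gives N/D = H(z)/(z - p) with H holomorphic on the rectangle, and
  -- a further divided difference splits off H(p)/(z - p), where H(p) = N(p)/D'(p).
  set H : ℂ → ℂ := fun z => N z / dslope D p z with hH
  have hHd : DifferentiableOn ℂ H R := hN.div hDs.differentiableOn hDs0
  have hHs : DifferentiableOn ℂ (dslope H p) R := (Complex.differentiableOn_dslope hRp).2 hHd
  have h1 : rectIntegral (fun z => N z / D z) l r ψ =
      rectIntegral (fun z => dslope H p z + H p * (z - p)⁻¹) l r ψ := by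
    refine rectIntegral_congr hlp hpr hψ fun z hz hzp => ?_
    have hz0 : z - p ≠ 0 := sub_ne_zero.2 hzp
    have h2 := sub_smul_dslope H (p : ℂ) z
    rw [smul_eq_mul] at h2
    have h3 : N z / D z = H z * (z - p)⁻¹ := by
      rw [hds z, hH]
      have := hDs0 z hz
      field_simp
    rw [h3, eq_comm, ← sub_eq_zero]
    have h4 : H z = (z - p) * dslope H p z + H p := by rw [h2]; ring
    rw [h4]
    field_simp
    ring
  rw [h1, rectIntegral_add hlp hpr hψ (fun z hz _ => hHs.continuousOn z hz) (fun z _ hzp => ?_),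
    rectIntegral_eq_zero (hlp.trans hpr).le hψ.le hHs, rectIntegral_const_mul,
    rectIntegral_inv_sub hlp hpr hψ, hH]
  · simp only [dslope_same]
    ring
  · exact (continuousAt_const.mul ((continuousAt_id.sub continuousAt_const).inv₀
      (sub_ne_zero.2 hzp))).continuousWithinAt

/-! ### Lower bounds for the sine off its zeros -/

theorem abs_exp_sub_exp_le_norm_sin (z : ℂ) :
    (Real.exp |z.im| - Real.exp (-|z.im|)) / 2 ≤ ‖Complex.sin z‖ := by
  have h1 : ‖Complex.exp (-z * Complex.I)‖ = Real.exp z.im := by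
    rw [Complex.norm_exp]; simp
  have h2 : ‖Complex.exp (z * Complex.I)‖ = Real.exp (-z.im) := by
    rw [Complex.norm_exp]; simp
  have h3 : ‖Complex.sin z‖ =
      ‖Complex.exp (-z * Complex.I) - Complex.exp (z * Complex.I)‖ / 2 := by
    rw [Complex.sin, norm_div, norm_mul, Complex.norm_I, mul_one]
    simp
  rw [h3]
  apply div_le_div_of_nonneg_right _ (by norm_num)
  rcases le_total 0 z.im with h | h
  · rw [abs_of_nonneg h, ← h1, ← h2]
    exact norm_sub_norm_le _ _
  · rw [abs_of_nonpos h, neg_neg, ← h1, ← h2, norm_sub_rev]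
    exact norm_sub_norm_le _ _

theorem abs_sin_re_le_norm_sin (z : ℂ) : |Real.sin z.re| ≤ ‖Complex.sin z‖ := by
  refine le_trans ?_ (Complex.abs_re_le_norm _)
  have h : (Complex.sin z).re = Real.sin z.re * Real.cosh z.im := by
    rw [Complex.sin_eq, ← Complex.ofReal_sin, ← Complex.ofReal_cosh, ← Complex.ofReal_cos,
      ← Complex.ofReal_sinh]
    simp [-Complex.ofReal_cos, -Complex.ofReal_sin, -Complex.ofReal_cosh, -Complex.ofReal_sinh]
  rw [h, abs_mul, abs_of_pos (Real.cosh_pos _)]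
  exact le_mul_of_one_le_right (abs_nonneg _) (Real.one_le_cosh _)

theorem exp_div_four_le_norm_sin {z : ℂ} (hz : 1 ≤ |z.im|) :
    Real.exp |z.im| / 4 ≤ ‖Complex.sin z‖ := by
  refine le_trans ?_ (abs_exp_sub_exp_le_norm_sin z)
  have h1 : Real.exp (-|z.im|) ≤ Real.exp |z.im| / 2 := by
    have h2 : Real.exp |z.im| = Real.exp (-|z.im|) * Real.exp (2 * |z.im|) := by
      rw [← Real.exp_add]; ring_nf
    have h3 : 2 ≤ Real.exp (2 * |z.im|) := by linarith [Real.add_one_le_exp (2 * |z.im|)]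
    rw [h2]
    nlinarith [Real.exp_pos (-|z.im|)]
  linarith

/-- `sin (π (s - a))` is bounded below on the circles of radius `n + a + 1 / 2`. -/
theorem quarter_le_norm_sin_arc {a : ℝ} {n : ℕ} (ha : 0 ≤ a) (hn : 1 ≤ n) {s : ℂ}
    (hs : ‖s‖ = n + a + 1 / 2) (hre : 0 ≤ s.re) : 1 / 4 ≤ ‖Complex.sin (Real.pi * (s - a))‖ := by
  have hπ := Real.pi_gt_three
  have hn1 : (1 : ℝ) ≤ n := by exact_mod_cast hn
  have him : ((Real.pi : ℂ) * (s - a)).im = Real.pi * s.im := by simp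
  have hree : ((Real.pi : ℂ) * (s - a)).re = Real.pi * (s.re - a) := by simp
  -- Away from the real axis the sine is exponentially large. Close to it, the circle forces Re s to
  -- within 1/4 of n + a + 1/2, where the real sine is ± a cosine of an angle at most π/4.
  rcases le_total (1 / 2) |s.im| with h | h
  · have h1 : 1 ≤ |((Real.pi : ℂ) * (s - a)).im| := by
      rw [him, abs_mul, abs_of_pos Real.pi_pos]
      nlinarith
    refine le_trans ?_ (exp_div_four_le_norm_sin h1)
    have := Real.one_le_exp (abs_nonneg ((Real.pi : ℂ) * (s - a)).im)
    linarith
  · refine le_trans ?_ (abs_sin_re_le_norm_sin _)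
    rw [hree]
    have h1 := Complex.sq_norm s
    rw [Complex.normSq_apply, hs] at h1
    have h2 : s.im * s.im ≤ 1 / 4 := by
      have := abs_le.1 h
      nlinarith
    have h3 : s.re ≤ n + a + 1 / 2 := hs ▸ (Complex.re_le_norm s)
    have h4 : n + a + 1 / 2 - s.re ≤ 1 / 4 := by nlinarith
    have h5 : Real.pi * (s.re - a) =
        (n : ℝ) * Real.pi + (Real.pi / 2 - Real.pi * (n + a + 1 / 2 - s.re)) := by ring
    rw [h5, add_comm, Real.sin_add_nat_mul_pi, Real.sin_pi_div_two_sub, abs_mul, abs_pow, abs_neg,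
      abs_one, one_pow, one_mul]
    refine le_trans ?_ (le_abs_self _)
    have h6 := Real.one_sub_sq_div_two_le_cos (x := Real.pi * (n + a + 1 / 2 - s.re))
    have h7 := Real.pi_lt_d2
    have h8 : Real.pi * (n + a + 1 / 2 - s.re) ≤ 0.7875 := by nlinarith
    have h9 : 0 ≤ Real.pi * (n + a + 1 / 2 - s.re) := by
      apply mul_nonneg <;> linarith
    nlinarith

/-! ### Mellin transforms in logarithmic coordinates, and bounds for the Laplace transform in polar
coordinates -/

theorem exp_image_univ : Real.exp '' univ = Ioi 0 := by
  rw [image_univ, Real.range_exp]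

theorem ofReal_exp_cpow_mul (x : ℝ) (s : ℂ) :
    ((Real.exp x : ℝ) : ℂ) ^ (s - 1) * (Real.exp x : ℝ) = Complex.exp (s * x) := by
  rw [Complex.ofReal_exp, Complex.cpow_def_of_ne_zero (Complex.exp_ne_zero _),
    ← Complex.ofReal_exp, ← Complex.ofReal_log (Real.exp_pos x).le, Real.log_exp,
    Complex.ofReal_exp, ← Complex.exp_add]
  congr 1
  ring

theorem mellin_comp_log (f : ℝ → ℂ) (s : ℂ) :
    mellin (fun t => f (Real.log t)) s = ∫ x : ℝ, Complex.exp (s * x) * f x := by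
  rw [mellin, ← exp_image_univ, integral_image_eq_integral_abs_deriv_smul MeasurableSet.univ
    (fun x _ => (Real.hasDerivAt_exp x).hasDerivWithinAt) Real.exp_injective.injOn,
    setIntegral_univ]
  congr 1
  ext x
  rw [abs_of_pos (Real.exp_pos x), Real.log_exp, ← ofReal_exp_cpow_mul, smul_eq_mul,
    Complex.real_smul]
  ring

namespace IsGrowthFun

variable {ρ a : ℝ} {V : ℂ → ℂ} (hV : IsGrowthFun ρ V)
include hV

theorem eventually_mul_le (b : ℝ) : ∀ᶠ x : ℝ in atTop, b * x ≤ (V x).re := by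
  have hρ := hV.order_pos
  have h1 : Tendsto (fun x : ℝ => Real.exp ((ρ - ρ / 2) * x) / x) atTop atTop := by
    have := (Real.tendsto_exp_div_pow_atTop 1).comp
      (tendsto_id.const_mul_atTop (show 0 < ρ - ρ / 2 by linarith))
    have h2 := this.const_mul_atTop (show 0 < ρ - ρ / 2 by linarith)
    refine h2.congr fun x => ?_
    simp only [Function.comp_apply, id, pow_one]
    have : ρ - ρ / 2 ≠ 0 := by linarith
    field_simp
  filter_upwards [hV.eventually_exp_le (show 0 < ρ / 2 by linarith), eventually_gt_atTop 0,
    h1.eventually_ge_atTop b] with x hx h0 h2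
  rw [le_div_iff₀ h0] at h2
  linarith

omit hV in
theorem laplaceExpNeg_eq_mellin (s : ℂ) :
    laplaceExpNeg V s = mellin (fun t => Complex.exp (-V (Real.log t : ℝ))) s := by
  rw [mellin_comp_log (fun x => Complex.exp (-V x)), laplaceExpNeg]
  congr 1
  ext x
  rw [← Complex.exp_add]
  rfl

omit hV in
theorem norm_exp_neg (x : ℝ) : ‖Complex.exp (-V x)‖ = Real.exp (-(V x).re) := by
  rw [Complex.norm_exp, Complex.neg_re]

theorem exp_neg_isBigO_top (b : ℝ) :
    (fun t : ℝ => Complex.exp (-V (Real.log t : ℝ))) =O[atTop] fun t : ℝ => t ^ (-b) := by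
  refine Asymptotics.IsBigO.of_bound 1 ?_
  filter_upwards [Real.tendsto_log_atTop.eventually (hV.eventually_mul_le b), eventually_gt_atTop 0]
    with t ht h0
  rw [one_mul, norm_exp_neg, Real.norm_of_nonneg (Real.rpow_nonneg h0.le _),
    Real.rpow_def_of_pos h0]
  apply Real.exp_le_exp.2
  linarith

theorem exp_neg_isBigO_zero :
    (fun t : ℝ => Complex.exp (-V (Real.log t : ℝ))) =O[𝓝[>] 0] fun t : ℝ => t ^ (-(0 : ℝ)) := by
  refine Asymptotics.IsBigO.of_bound 1 (Eventually.of_forall fun t => ?_)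
  rw [norm_exp_neg, neg_zero, Real.rpow_zero, norm_one, one_mul, Real.exp_le_one_iff]
  linarith [hV.pos (Real.log t)]

theorem continuousOn_exp_neg_log :
    ContinuousOn (fun t : ℝ => Complex.exp (-V (Real.log t : ℝ))) (Ioi 0) := by
  have h : ContinuousOn (fun t : ℝ => V (Real.log t : ℝ)) (Ioi 0) :=
    hV.continuous_ofReal.comp_continuousOn
      (Real.continuousOn_log.mono fun t ht => (ne_of_gt ht : t ≠ 0))
  exact h.neg.cexp

theorem differentiableAt_laplaceExpNeg {s : ℂ} (hs : 0 < s.re) :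
    DifferentiableAt ℂ (laplaceExpNeg V) s := by
  rw [funext laplaceExpNeg_eq_mellin]
  exact mellin_differentiableAt_of_isBigO_rpow
    (hV.continuousOn_exp_neg_log.locallyIntegrableOn measurableSet_Ioi)
    (hV.exp_neg_isBigO_top (s.re + 1)) (by linarith) hV.exp_neg_isBigO_zero hs

theorem tendsto_deriv_atTop : Tendsto (fun x : ℝ => (deriv V x).re) atTop atTop := by
  have h := hV.tendsto_deriv_div.pos_mul_atTop hV.order_pos hV.tendsto_atTop
  refine h.congr fun x => ?_
  rw [div_mul_cancel₀ _ (hV.pos x).ne']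

theorem continuous_deriv_re : Continuous fun x : ℝ => (deriv V x).re := by
  rw [continuous_iff_continuousAt]
  intro x
  have := (hV.analyticAt (hV.ofReal_mem x)).deriv.continuousAt
  exact Complex.continuous_re.continuousAt.comp
    (this.comp Complex.continuous_ofReal.continuousAt)

theorem eventually_exists_deriv_eq (X : ℝ) :
    ∀ᶠ y : ℝ in atTop, ∃ x, X ≤ x ∧ (deriv V x).re = Real.exp y := by
  filter_upwards [Real.tendsto_exp_atTop.eventually_ge_atTop (deriv V X).re] with y hy
  obtain ⟨x₁, h1, h2⟩ := ((hV.tendsto_deriv_atTop.eventually_ge_atTop (Real.exp y)).and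
    (eventually_ge_atTop X)).exists
  obtain ⟨x, hx, hx'⟩ := intermediate_value_Icc h2 hV.continuous_deriv_re.continuousOn ⟨hy, h1⟩
  exact ⟨x, hx.1, hx'⟩

/-- V' is continuous on the line and tends to infinity, so each large radius e^y is V'(x) for some
large real x. Putting α = ρβ turns the saddle point bound into one at s = e^{y + iα}. The comparison
of V(x) with e^y comes from V'/V → ρ. -/
theorem eventually_exists_lower_bound (ha : 0 ≤ a) (hB : HasStripBound ρ a V) {φ ε : ℝ}
    (hφ0 : 0 ≤ φ) (hφ : φ < Real.pi / (2 * ρ)) (hε : 0 < ε) (X : ℝ) :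
    ∀ᶠ y : ℝ in atTop, ∃ x, X ≤ x ∧ (deriv V x).re = Real.exp y ∧
      (V x).re ≤ 2 / ρ * Real.exp y ∧ ∀ α : ℝ, |α| ≤ ρ * φ →
        Real.exp (Real.exp y * (Real.cos α * x - α / ρ * Real.sin α) -
          (Real.cos α + ε) * (V x).re) ≤ ‖laplaceExpNeg V (Complex.exp (y + α * Complex.I))‖ := by
  have hρ := hV.order_pos
  obtain ⟨X₁, hX₁⟩ := eventually_atTop.1 ((hV.eventually_le_norm_laplaceExpNeg ha hB hφ0 hφ hε).and
    (hV.tendsto_deriv_div.eventually_const_le (show ρ / 2 < ρ by linarith)))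
  filter_upwards [hV.eventually_exists_deriv_eq (max X X₁)] with y hy
  obtain ⟨x, hx, hxy⟩ := hy
  obtain ⟨h1, h2⟩ := hX₁ x ((le_max_right _ _).trans hx)
  refine ⟨x, (le_max_left _ _).trans hx, hxy, ?_, fun α hα => ?_⟩
  · rw [hxy, le_div_iff₀ (hV.pos x)] at h2
    rw [div_mul_eq_mul_div, le_div_iff₀ hρ]
    linarith
  · have h3 := h1 (α / ρ) (by rw [abs_div, abs_of_pos hρ, div_le_iff₀ hρ]; linarith)
    have e1 : ρ * (α / ρ) = α := by field_simp
    have e2 : (ρ : ℂ) * ((α / ρ : ℝ) * Complex.I) = α * Complex.I := by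
      rw [← mul_assoc, ← Complex.ofReal_mul, e1]
    rw [e1, e2, hxy, Complex.ofReal_exp, ← Complex.exp_add] at h3
    exact h3

end IsGrowthFun

/-! ### The alternating series as an integral over the boundary of a sector -/

/-- The numerator of the kernel of the wedge integral. -/
def wedgeNum (V : ℂ → ℂ) (a L : ℝ) (z : ℂ) : ℂ :=
  Complex.exp ((Complex.exp z - a) * L) *
    (Real.pi * (Complex.exp z / laplaceExpNeg V (Complex.exp z)))

/-- The denominator of the kernel of the wedge integral. -/
def wedgeDen (a : ℝ) (z : ℂ) : ℂ := Complex.sin (Real.pi * (Complex.exp z - a))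

theorem differentiable_wedgeDen (a : ℝ) : Differentiable ℂ (wedgeDen a) := by
  unfold wedgeDen
  fun_prop

/-- Zeros occur where e^z = k + a with k an integer. Since |Im z| < π/2, such a point is real and
positive, so z is its real logarithm. The sides at n + a ± 1/2 leave only k = n. -/
theorem wedgeDen_eq_zero {a : ℝ} {n : ℕ} {ψ : ℝ} (ha : 0 < a) (hn : 1 ≤ n)
    (hψ : ψ < Real.pi / 2) {z : ℂ}
    (hz : z ∈ Icc (Real.log (n + a - 1 / 2)) (Real.log (n + a + 1 / 2)) ×ℂ Icc (-ψ) ψ)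
    (h : wedgeDen a z = 0) : z = (Real.log (n + a) : ℝ) := by
  have hn1 : (1 : ℝ) ≤ n := by exact_mod_cast hn
  rw [wedgeDen, Complex.sin_eq_zero_iff] at h
  obtain ⟨k, hk⟩ := h
  have hπ : (Real.pi : ℂ) ≠ 0 := by exact_mod_cast Real.pi_ne_zero
  have h1 : Complex.exp z = ((k + a : ℝ) : ℂ) := by
    have : (Real.pi : ℂ) * (Complex.exp z - a - k) = 0 := by linear_combination hk
    have := (mul_eq_zero.1 this).resolve_left hπ
    push_cast
    linear_combination this
  have him := abs_le.2 hz.2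
  have hcos : 0 < Real.cos z.im := Real.cos_pos_of_mem_Ioo
    ⟨by linarith [(abs_le.1 him).1], by linarith [(abs_le.1 him).2]⟩
  have hre : 0 < (k + a : ℝ) := by
    have := congrArg Complex.re h1
    rw [Complex.ofReal_re, Complex.exp_re] at this
    rw [← this]
    positivity
  have hzlog : z = (Real.log (k + a) : ℝ) := by
    rw [Complex.ofReal_log hre.le, ← h1, Complex.log_exp]
    · linarith [(abs_le.1 him).1, Real.pi_pos]
    · linarith [(abs_le.1 him).2, Real.pi_pos]
  have hzre : z.re = Real.log (k + a) := by rw [hzlog, Complex.ofReal_re]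
  have hl := hz.1
  rw [mem_preimage, hzre] at hl
  have h2 := (Real.log_le_log_iff (by linarith) hre).1 hl.1
  have h3 := (Real.log_le_log_iff hre (by linarith)).1 hl.2
  have h4 : k = n := by
    have h5 : (n : ℝ) - 1 < k := by linarith
    have h6 : (k : ℝ) < n + 1 := by linarith
    have h7 : (n : ℤ) - 1 < k := by exact_mod_cast h5
    have h8 : k < n + 1 := by exact_mod_cast h6
    omega
  rw [hzlog, h4]
  simp

theorem wedgeDen_log {a : ℝ} {n : ℕ} (ha : 0 < a) : wedgeDen a (Real.log (n + a) : ℝ) = 0 := by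
  have : 0 < (n : ℝ) + a := by positivity
  rw [wedgeDen, ← Complex.ofReal_exp, Real.exp_log this]
  push_cast
  rw [add_sub_cancel_right, mul_comm, Complex.sin_nat_mul_pi]

theorem deriv_wedgeDen_log {a : ℝ} {n : ℕ} (ha : 0 < a) :
    deriv (wedgeDen a) (Real.log (n + a) : ℝ) = (-1) ^ n * (Real.pi * (n + a)) := by
  have h0 : 0 < (n : ℝ) + a := by positivity
  have h1 : ∀ z : ℂ, HasDerivAt (wedgeDen a)
      (Complex.cos (Real.pi * (Complex.exp z - a)) * (Real.pi * Complex.exp z)) z := by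
    intro z
    exact (((Complex.hasDerivAt_exp z).sub_const (a : ℂ)).const_mul (Real.pi : ℂ)).csin
  rw [(h1 _).deriv, ← Complex.ofReal_exp, Real.exp_log h0]
  push_cast
  have h2 : Complex.cos (n * Real.pi) = (-1) ^ n := by
    exact_mod_cast congrArg Complex.ofReal (Real.cos_nat_mul_pi n)
  rw [add_sub_cancel_right, mul_comm (Real.pi : ℂ) n, h2]

/-- With s = e^z the factors π and e^z of the numerator cancel the factor π(n + a) in the derivative
of the denominator, so the residue is exactly the n-th term of the series. -/
theorem IsGrowthFun.rectIntegral_wedge {ρ a : ℝ} {V : ℂ → ℂ} (hV : IsGrowthFun ρ V) (ha : 0 < a)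
    {n : ℕ} (hn : 1 ≤ n) {ψ : ℝ} (hψ0 : 0 < ψ) (hψ : ψ < Real.pi / 2)
    (hne : ∀ z : ℂ, Real.log (n + a - 1 / 2) ≤ z.re → |z.im| ≤ ψ →
      laplaceExpNeg V (Complex.exp z) ≠ 0) (L : ℝ) :
    rectIntegral (fun z => wedgeNum V a L z / wedgeDen a z) (Real.log (n + a - 1 / 2))
      (Real.log (n + a + 1 / 2)) ψ =
      2 * Real.pi * Complex.I *
        ((-1) ^ n * (Real.exp (n * L) : ℝ) / laplaceExpNeg V ((n : ℂ) + a)) := by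
  have hn1 : (1 : ℝ) ≤ n := by exact_mod_cast hn
  have h0 : 0 < (n : ℝ) + a := by positivity
  have h0' : ((n : ℂ) + a) ≠ 0 := by exact_mod_cast h0.ne'
  have hπ : (Real.pi : ℂ) ≠ 0 := by exact_mod_cast Real.pi_ne_zero
  have hl1 : Real.log (n + a - 1 / 2) < Real.log (n + a) :=
    Real.log_lt_log (by linarith) (by linarith)
  have hl2 : Real.log (n + a) < Real.log (n + a + 1 / 2) :=
    Real.log_lt_log (by linarith) (by linarith)
  have hd := deriv_wedgeDen_log (n := n) ha
  have hs1 : ((-1 : ℂ)) ^ n ≠ 0 := pow_ne_zero _ (by norm_num)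
  rw [rectIntegral_div hl1 hl2 hψ0 (fun z hz => ?_) (differentiable_wedgeDen a) (wedgeDen_log ha)
    (by rw [hd]; exact mul_ne_zero hs1 (mul_ne_zero hπ h0'))
    (fun z hz hzp h => hzp (wedgeDen_eq_zero ha hn hψ hz h)), hd, wedgeNum]
  · have e1 : Complex.exp (Real.log (n + a) : ℝ) = (n : ℂ) + a := by
      rw [← Complex.ofReal_exp, Real.exp_log h0]
      push_cast
      rfl
    rw [e1, add_sub_cancel_right]
    have h1 : laplaceExpNeg V ((n : ℂ) + a) ≠ 0 := by
      have := hne (Real.log (n + a) : ℝ) (by rw [Complex.ofReal_re]; exact hl1.le)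
        (by rw [Complex.ofReal_im, abs_zero]; exact hψ0.le)
      rwa [e1] at this
    congr 1
    push_cast
    rcases neg_one_pow_eq_or ℂ n with h | h <;> rw [h] <;> field_simp
  · have h1 := hne z hz.1.1 (abs_le.2 hz.2)
    have him := abs_le.2 hz.2
    have h2 : 0 < (Complex.exp z).re := by
      rw [Complex.exp_re]
      have : 0 < Real.cos z.im := Real.cos_pos_of_mem_Ioo
        ⟨by linarith [(abs_le.1 him).1], by linarith [(abs_le.1 him).2]⟩
      positivity
    have h3 := hV.differentiableAt_laplaceExpNeg h2
    have h4 : DifferentiableAt ℂ (fun z => laplaceExpNeg V (Complex.exp z)) z :=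
      h3.comp z Complex.differentiableAt_exp
    unfold wedgeNum
    exact (DifferentiableAt.mul (by fun_prop)
      ((Complex.differentiableAt_exp.div h4 h1).const_mul _)).differentiableWithinAt

theorem quarter_le_norm_wedgeDen {a : ℝ} {n : ℕ} (ha : 0 ≤ a) (hn : 2 ≤ n) {α : ℝ}
    (hα : |α| ≤ Real.pi / 2) :
    1 / 4 ≤ ‖wedgeDen a ((Real.log (n + a - 1 / 2) : ℝ) + α * Complex.I)‖ := by
  have hn2' : (2 : ℝ) ≤ n := by exact_mod_cast hn
  have hpos : 0 < (n : ℝ) + a - 1 / 2 := by linarith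
  have hcos : 0 ≤ Real.cos α := Real.cos_nonneg_of_mem_Icc (abs_le.1 hα)
  have hre : (((Real.log (n + a - 1 / 2) : ℝ) : ℂ) + α * Complex.I).re =
      Real.log (n + a - 1 / 2) := by
    simp only [Complex.add_re, Complex.ofReal_re, Complex.mul_re, Complex.I_re, mul_zero,
      Complex.ofReal_im, Complex.I_im, mul_one, sub_self, add_zero]
  -- The radius is n + a - 1/2 = (n - 1) + a + 1/2, which explains the shift and the need for n ≥ 2.
  refine quarter_le_norm_sin_arc (n := n - 1) ha (by omega) ?_ ?_
  · rw [Complex.norm_exp, hre, Real.exp_log hpos, Nat.cast_sub (by omega)]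
    push_cast
    ring
  · rw [Complex.exp_re, hre]
    simp only [Complex.ofReal_im, Complex.I_re, mul_zero, Complex.ofReal_re, Complex.I_im, mul_one,
      Complex.add_im, Complex.mul_im, zero_add, add_zero]
    positivity

namespace IsGrowthFun

variable {ρ a : ℝ} {V : ℂ → ℂ} (hV : IsGrowthFun ρ V)
include hV

omit hV in
theorem norm_wedge_le {L y α E d : ℝ}
    (hΦ : Real.exp E ≤ ‖laplaceExpNeg V (Complex.exp (y + α * Complex.I))‖)
    (hd : 0 < d) (hD : d ≤ ‖wedgeDen a (y + α * Complex.I)‖) :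
    ‖wedgeNum V a L (y + α * Complex.I) / wedgeDen a (y + α * Complex.I)‖ ≤
      Real.pi * Real.exp y * Real.exp ((Real.exp y * Real.cos α - a) * L - E) / d := by
  have hπ := Real.pi_pos
  have h1 : ‖Complex.exp ((Complex.exp (y + α * Complex.I) - a) * L)‖ =
      Real.exp ((Real.exp y * Real.cos α - a) * L) := by
    rw [Complex.norm_exp, Complex.re_mul_ofReal, Complex.sub_re, Complex.exp_re]
    simp
  have h2 : ‖Complex.exp (y + α * Complex.I)‖ = Real.exp y := by
    rw [Complex.norm_exp]; simp
  rw [wedgeNum, norm_div, norm_mul, norm_mul, norm_div, h1, h2, Complex.norm_real,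
    Real.norm_of_nonneg hπ.le, Real.exp_sub]
  have h3 : 0 < ‖laplaceExpNeg V (Complex.exp (y + α * Complex.I))‖ := (Real.exp_pos _).trans_le hΦ
  calc _ ≤ Real.exp ((Real.exp y * Real.cos α - a) * L) *
        (Real.pi * (Real.exp y / Real.exp E)) / d := by gcongr
    _ = _ := by ring

/-- Put T = e^y = V'(x) and ψ = ρφ. The saddle bound gives the exponent cos ψ (T(L - x) + V(x)) + φ
T sin ψ, up to a small multiple of V(x), and the sine in the denominator gives -πT sin ψ. The
tangent inequality bounds the first part by cos ψ V(L), and the rest is negative because φ < π. Here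
ψ < π/2 makes cos ψ positive. -/
theorem eventually_norm_wedge_ray_le (ha : 0 < a) (hB : HasStripBound ρ a V) {φ : ℝ}
    (hφ0 : 0 < φ) (hφ : φ < Real.pi / (2 * ρ)) (hφπ : φ < Real.pi) :
    ∃ A : ℝ, 0 ≤ A ∧ ∀ᶠ y : ℝ in atTop, ∀ L : ℝ, 0 ≤ L → ∀ α : ℝ, |α| = ρ * φ →
      ‖wedgeNum V a L (y + α * Complex.I) / wedgeDen a (y + α * Complex.I)‖ ≤
        A * Real.exp (Real.cos (ρ * φ) * (V L).re) * Real.exp (-y) := by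
  have hρ := hV.order_pos
  have hπ := Real.pi_pos
  obtain ⟨ψ, hψ⟩ : ∃ ψ, ψ = ρ * φ := ⟨_, rfl⟩
  have hψ0 : 0 < ψ := by rw [hψ]; positivity
  have hψ2 : ψ < Real.pi / 2 := by
    rw [lt_div_iff₀ (by positivity)] at hφ
    rw [hψ]; linarith
  have hsin : 0 < Real.sin ψ := Real.sin_pos_of_pos_of_lt_pi hψ0 (by linarith)
  have hcos : 0 < Real.cos ψ := Real.cos_pos_of_mem_Ioo ⟨by linarith, hψ2⟩
  -- The available decay is exp(-4bT). The saddle bound is used with ε = bρ, which costs at most 2bT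
  -- because V(x) ≤ (2/ρ)T, so exp(-2bT) remains.
  obtain ⟨b, hb⟩ : ∃ b, b = (Real.pi - φ) * Real.sin ψ / 4 := ⟨_, rfl⟩
  have hb0 : 0 < b := by
    have := sub_pos.2 hφπ
    rw [hb]; positivity
  rw [← hψ]
  refine ⟨4 * Real.pi / b ^ 2, by positivity, ?_⟩
  filter_upwards [hV.eventually_exists_lower_bound ha.le hB hφ0.le hφ (mul_pos hb0 hρ) 0,
    Real.tendsto_exp_atTop.eventually_ge_atTop (1 / Real.sin ψ)] with y hy hyT L hL α hα
  obtain ⟨x, -, hxd, hxv, hx⟩ := hy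
  have hx := hx α (by rw [hα, hψ])
  have hT : 0 < Real.exp y := Real.exp_pos y
  have hcosα : Real.cos α = Real.cos ψ := by rw [← Real.cos_abs, hα]
  have hαsin : α * Real.sin α = ψ * Real.sin ψ := by
    rcases (abs_eq hψ0.le).1 hα with h | h <;> rw [h]
    rw [Real.sin_neg]; ring
  have hsinα : |Real.sin α| = Real.sin ψ := by
    rcases (abs_eq hψ0.le).1 hα with h | h <;> rw [h]
    · exact abs_of_pos hsin
    · rw [Real.sin_neg, abs_neg, abs_of_pos hsin]
  have him : |((Real.pi : ℂ) * (Complex.exp (y + α * Complex.I) - a)).im| =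
      Real.pi * (Real.exp y * Real.sin ψ) := by
    rw [Complex.im_ofReal_mul, Complex.sub_im, Complex.exp_im, Complex.ofReal_im, sub_zero, abs_mul,
      abs_mul, abs_of_pos hπ]
    simp [hsinα]
  have hT1 : 1 ≤ Real.exp y * Real.sin ψ := by rwa [div_le_iff₀ hsin] at hyT
  have hden : Real.exp (Real.pi * (Real.exp y * Real.sin ψ)) / 4 ≤
      ‖wedgeDen a (y + α * Complex.I)‖ := by
    rw [← him]
    refine exp_div_four_le_norm_sin ?_
    rw [him]
    nlinarith [Real.pi_gt_three]
  refine (norm_wedge_le hx (by positivity) hden).trans ?_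
  have htan := hV.tangent_le x L
  rw [hxd] at htan
  have hψφ : ψ / ρ = φ := by rw [hψ]; field_simp
  have hexp : (Real.exp y * Real.cos α - a) * L -
      (Real.exp y * (Real.cos α * x - α / ρ * Real.sin α) - (Real.cos α + b * ρ) * (V x).re) -
      Real.pi * (Real.exp y * Real.sin ψ) ≤
      Real.cos ψ * (V L).re - 2 * (b * Real.exp y) := by
    have e1 : α / ρ * Real.sin α = φ * Real.sin ψ := by
      rw [div_mul_eq_mul_div, hαsin, mul_div_right_comm, hψφ]
    have e2 : b * ρ * (V x).re ≤ 2 * b * Real.exp y := by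
      calc b * ρ * (V x).re ≤ b * ρ * (2 / ρ * Real.exp y) := by gcongr
        _ = _ := by field_simp
    have e3 : (Real.pi - φ) * Real.sin ψ = 4 * b := by rw [hb]; ring
    have e4 : (Real.pi - φ) * Real.sin ψ * Real.exp y = 4 * b * Real.exp y := by rw [e3]
    have e5 := mul_le_mul_of_nonneg_left htan hcos.le
    have e6 : 0 ≤ a * L := by positivity
    rw [e1, hcosα]
    nlinarith
  -- The remaining decay, after absorbing the Jacobian e^y, is stronger than e^{-y} and is therefore
  -- integrable along the ray.
  have hT2 : Real.exp y * Real.exp (-(2 * (b * Real.exp y))) ≤ 1 / b ^ 2 * Real.exp (-y) := by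
    have h1 : b * Real.exp y ≤ Real.exp (b * Real.exp y) := by
      linarith [Real.add_one_le_exp (b * Real.exp y)]
    have h2 : (b * Real.exp y) ^ 2 ≤ Real.exp (2 * (b * Real.exp y)) := by
      rw [two_mul, Real.exp_add, sq]
      gcongr
    rw [Real.exp_neg, Real.exp_neg, ← div_eq_mul_inv, ← div_eq_mul_inv, div_le_div_iff₀
      (Real.exp_pos _) hT, div_mul_eq_mul_div, one_mul, le_div_iff₀ (by positivity)]
    linarith
  calc _ = 4 * Real.pi * (Real.exp y * Real.exp ((Real.exp y * Real.cos α - a) * L -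
      (Real.exp y * (Real.cos α * x - α / ρ * Real.sin α) - (Real.cos α + b * ρ) * (V x).re) -
      Real.pi * (Real.exp y * Real.sin ψ))) := by
        rw [Real.exp_sub _ (Real.pi * (Real.exp y * Real.sin ψ))]
        have := (Real.exp_pos (Real.pi * (Real.exp y * Real.sin ψ))).ne'
        field_simp
    _ ≤ 4 * Real.pi * (Real.exp y * Real.exp (Real.cos ψ * (V L).re - 2 * (b * Real.exp y))) := by
        gcongr
    _ = 4 * Real.pi * Real.exp (Real.cos ψ * (V L).re) *
        (Real.exp y * Real.exp (-(2 * (b * Real.exp y)))) := by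
        rw [sub_eq_add_neg, Real.exp_add]
        ring
    _ ≤ 4 * Real.pi * Real.exp (Real.cos ψ * (V L).re) * (1 / b ^ 2 * Real.exp (-y)) := by gcongr
    _ = _ := by ring

/-- For fixed `L` the far arcs are harmless: on radius T the size of Φ is governed by exp(T x cos α)
with x → ∞, which beats e^{T L cos α}. The radii n + a - 1/2 avoid the zeros of the sine. Uniformity
in `L` is not needed, since these arcs only serve to reach the full series. -/
theorem eventually_norm_wedge_arc_le (ha : 0 < a) (hB : HasStripBound ρ a V) {φ : ℝ}
    (hφ0 : 0 < φ) (hφ : φ < Real.pi / (2 * ρ)) {L : ℝ} (hL : 0 ≤ L) :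
    ∀ᶠ n : ℕ in atTop, ∀ α : ℝ, |α| ≤ ρ * φ →
      ‖wedgeNum V a L ((Real.log (n + a - 1 / 2) : ℝ) + α * Complex.I) /
        wedgeDen a ((Real.log (n + a - 1 / 2) : ℝ) + α * Complex.I)‖ ≤ 4 * Real.pi := by
  have hρ := hV.order_pos
  have hπ := Real.pi_pos
  obtain ⟨ψ, hψ⟩ : ∃ ψ, ψ = ρ * φ := ⟨_, rfl⟩
  have hψ0 : 0 < ψ := by rw [hψ]; positivity
  have hψ2 : ψ < Real.pi / 2 := by
    rw [lt_div_iff₀ (by positivity)] at hφ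
    rw [hψ]; linarith
  have hcos : 0 < Real.cos ψ := Real.cos_pos_of_mem_Ioo ⟨by linarith, hψ2⟩
  rw [← hψ]
  have htend : Tendsto (fun n : ℕ => Real.log (n + a - 1 / 2)) atTop atTop := by
    refine Real.tendsto_log_atTop.comp ?_
    simp_rw [add_sub_assoc]
    exact tendsto_atTop_add_const_right _ _ tendsto_natCast_atTop_atTop
  -- The threshold for `x` makes T cos α (x - L) at least T(ψ/ρ + 4/ρ + 1). The first two summands
  -- pay for the α sin α term and for (cos α + 1)V(x), and the last leaves exp(-T).
  have h1 := htend.eventually (hV.eventually_exists_lower_bound ha.le hB hφ0.le hφ one_pos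
    (L + (ψ / ρ + 4 / ρ + 1) / Real.cos ψ))
  filter_upwards [h1, eventually_ge_atTop 2] with n hn hn2 α hα
  obtain ⟨x, hxX, -, hxv, hx⟩ := hn
  have hx := hx α (by rw [← hψ]; exact hα)
  have hn2' : (2 : ℝ) ≤ n := by exact_mod_cast hn2
  have hpos : 0 < (n : ℝ) + a - 1 / 2 := by linarith
  obtain ⟨T, hT⟩ : ∃ T, T = (n : ℝ) + a - 1 / 2 := ⟨_, rfl⟩
  rw [← hT] at hx hxv hpos ⊢
  have hexpT : Real.exp (Real.log T) = T := Real.exp_log hpos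
  have hcosα : Real.cos ψ ≤ Real.cos α := by
    rw [← Real.cos_abs α]
    exact Real.cos_le_cos_of_nonneg_of_le_pi (abs_nonneg _) (by linarith) hα
  have hcosα0 : 0 < Real.cos α := hcos.trans_le hcosα
  have hden : 1 / 4 ≤ ‖wedgeDen a ((Real.log T : ℝ) + α * Complex.I)‖ := by
    rw [hT]
    exact quarter_le_norm_wedgeDen ha.le hn2 (by linarith)
  refine (norm_wedge_le hx (by norm_num) hden).trans ?_
  rw [hexpT] at hxv ⊢
  have hexp : (T * Real.cos α - a) * L -
      (T * (Real.cos α * x - α / ρ * Real.sin α) - (Real.cos α + 1) * (V x).re) ≤ -T := by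
    have e1 : α / ρ * Real.sin α ≤ ψ / ρ := by
      rw [div_mul_eq_mul_div]
      gcongr
      calc α * Real.sin α ≤ |α * Real.sin α| := le_abs_self _
        _ = |α| * |Real.sin α| := abs_mul _ _
        _ ≤ |α| * 1 := by gcongr; exact Real.abs_sin_le_one α
        _ ≤ ψ := by linarith
    have e2 : (Real.cos α + 1) * (V x).re ≤ 4 / ρ * T := by
      have := Real.cos_le_one α
      calc (Real.cos α + 1) * (V x).re ≤ 2 * (2 / ρ * T) := by
            gcongr
            · exact (hV.pos x).le
            · linarith
        _ = _ := by ring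
    have e3 : ψ / ρ + 4 / ρ + 1 ≤ Real.cos ψ * (x - L) := by
      have : (ψ / ρ + 4 / ρ + 1) / Real.cos ψ ≤ x - L := by linarith
      rw [div_le_iff₀ hcos] at this
      linarith
    have hxL : 0 ≤ x - L := by
      have : 0 ≤ (ψ / ρ + 4 / ρ + 1) / Real.cos ψ := by positivity
      linarith
    have e4 : Real.cos ψ * (x - L) ≤ Real.cos α * (x - L) := by gcongr
    have e5 : T * (ψ / ρ + 4 / ρ + 1) ≤ T * (Real.cos α * (x - L)) := by
      gcongr
      linarith
    have e6 : T * (α / ρ * Real.sin α) ≤ T * (ψ / ρ) := by gcongr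
    have e7 : 0 ≤ a * L := by positivity
    nlinarith
  calc _ ≤ Real.pi * T * Real.exp (-T) / (1 / 4) := by gcongr
    _ = 4 * Real.pi * (T * Real.exp (-T)) := by ring
    _ ≤ 4 * Real.pi * 1 := by
        gcongr
        rw [Real.exp_neg, ← div_eq_mul_inv, div_le_one (Real.exp_pos _)]
        linarith [Real.add_one_le_exp T]
    _ = _ := by ring

end IsGrowthFun

/-- Integrals over shared vertical sides cancel and horizontal sides concatenate. Continuity is
therefore required only on the horizontal lines. -/
theorem sum_rectIntegral {G : ℂ → ℂ} {ψ : ℝ} {l : ℕ → ℝ} {N : ℕ}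
    (hl : ∀ n, N ≤ n → l n ≤ l (n + 1))
    (h1 : ∀ x : ℝ, l N ≤ x → ContinuousAt (fun x : ℝ => G (x - ψ * Complex.I)) x)
    (h2 : ∀ x : ℝ, l N ≤ x → ContinuousAt (fun x : ℝ => G (x + ψ * Complex.I)) x)
    {K : ℕ} (hK : N ≤ K) :
    l N ≤ l K ∧
      ∑ n ∈ Finset.Ico N K, rectIntegral G (l n) (l (n + 1)) ψ = rectIntegral G (l N) (l K) ψ := by
  induction K, hK using Nat.le_induction with
  | base => simp [rectIntegral]
  | succ K hK ih =>
    obtain ⟨ih1, ih⟩ := ih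
    have hlK := hl K hK
    refine ⟨ih1.trans hlK, ?_⟩
    rw [Finset.sum_Ico_succ_top hK, ih]
    have hint : ∀ f : ℝ → ℂ, (∀ x, l N ≤ x → ContinuousAt f x) →
        (∫ x in (l N)..(l K), f x) + ∫ x in (l K)..(l (K + 1)), f x =
          ∫ x in (l N)..(l (K + 1)), f x := by
      intro f hf
      refine intervalIntegral.integral_add_adjacent_intervals ?_ ?_
      · refine ContinuousOn.intervalIntegrable fun x hx => ?_
        rw [uIcc_of_le ih1] at hx
        exact (hf x hx.1).continuousWithinAt
      · refine ContinuousOn.intervalIntegrable fun x hx => ?_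
        rw [uIcc_of_le hlK] at hx
        exact (hf x (ih1.trans hx.1)).continuousWithinAt
    have e1 := hint _ h1
    have e2 := hint _ h2
    unfold rectIntegral
    rw [← e1, ← e2]
    ring

theorem norm_integral_le_of_exp_neg {f : ℝ → ℂ} {l r A : ℝ} (hl : 0 ≤ l) (hlr : l ≤ r)
    (hA : 0 ≤ A) (h : ∀ x, l ≤ x → ‖f x‖ ≤ A * Real.exp (-x)) : ‖∫ x in l..r, f x‖ ≤ A := by
  have h1 : ‖∫ x in l..r, f x‖ ≤ ∫ x in l..r, A * Real.exp (-x) :=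
    intervalIntegral.norm_integral_le_of_norm_le hlr
      (Eventually.of_forall fun x hx => h x hx.1.le)
      (Continuous.intervalIntegrable (by fun_prop) _ _)
  refine h1.trans ?_
  rw [intervalIntegral.integral_const_mul, intervalIntegral.integral_comp_neg, integral_exp]
  have h2 : Real.exp (-l) ≤ 1 := by rw [Real.exp_le_one_iff]; linarith
  have h3 := Real.exp_pos (-r)
  nlinarith

namespace IsGrowthFun

variable {ρ a : ℝ} {V : ℂ → ℂ} (hV : IsGrowthFun ρ V)
include hV

/-- Growth of `∑ (-r) ^ n / Φ(n + a)` on the positive half-line, `Φ` the Laplace transform of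
`exp (-V)`. -/
theorem exists_norm_sum_le (ha : 0 < a) (hB : HasStripBound ρ a V) {φ : ℝ}
    (hφ0 : 0 < φ) (hφ : φ < Real.pi / (2 * ρ)) (hφπ : φ < Real.pi) :
    ∃ (N : ℕ) (C M : ℝ), 0 ≤ C ∧ ∀ L : ℝ, 0 ≤ L → ∀ᶠ K : ℕ in atTop,
      ‖∑ n ∈ Finset.Ico N K, (-1) ^ n * (Real.exp (n * L) : ℝ) / laplaceExpNeg V ((n : ℂ) + a)‖ ≤
        C * (Real.exp (Real.cos (ρ * φ) * (V L).re) + Real.exp (M * L)) := by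
  have hρ := hV.order_pos
  have hπ := Real.pi_pos
  obtain ⟨ψ, hψ⟩ : ∃ ψ, ψ = ρ * φ := ⟨_, rfl⟩
  have hψ0 : 0 < ψ := by rw [hψ]; positivity
  have hψ2 : ψ < Real.pi / 2 := by
    rw [lt_div_iff₀ (by positivity)] at hφ
    rw [hψ]; linarith
  obtain ⟨A, hA0, hA⟩ := hV.eventually_norm_wedge_ray_le ha hB hφ0 hφ hφπ
  have hne := hV.eventually_exists_lower_bound ha.le hB hφ0.le hφ one_pos 0
  obtain ⟨Y, hY⟩ := eventually_atTop.1 (hA.and (hne.and (eventually_ge_atTop 0)))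
  obtain ⟨l, hl⟩ : ∃ l : ℕ → ℝ, l = fun n : ℕ => Real.log (n + a - 1 / 2) := ⟨_, rfl⟩
  have htend : Tendsto l atTop atTop := by
    rw [hl]
    refine Real.tendsto_log_atTop.comp ?_
    simp_rw [add_sub_assoc]
    exact tendsto_atTop_add_const_right _ _ tendsto_natCast_atTop_atTop
  -- The first vertical side is placed where the ray bound and the nonvanishing of Φ hold. The
  -- finitely many terms below `N` are estimated separately.
  obtain ⟨N, hNY, hN1⟩ := ((htend.eventually_ge_atTop Y).and (eventually_ge_atTop 2)).exists
  have hl0 : 0 ≤ l N := (hY Y le_rfl).2.2.trans hNY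
  have hmono : ∀ n, N ≤ n → l n ≤ l (n + 1) := by
    intro n hn
    have hn1 : (1 : ℝ) ≤ n := by exact_mod_cast (one_le_two.trans hN1).trans hn
    rw [hl]
    apply Real.log_le_log (by linarith)
    push_cast
    linarith
  have hmono' : ∀ n, N ≤ n → l N ≤ l n := fun n hn => by
    induction n, hn using Nat.le_induction with
    | base => exact le_rfl
    | succ n hn ih => exact ih.trans (hmono n hn)
  have hΦ0 : ∀ z : ℂ, l N ≤ z.re → |z.im| ≤ ψ → laplaceExpNeg V (Complex.exp z) ≠ 0 := by
    intro z hz hz'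
    obtain ⟨x, -, -, -, hx⟩ := (hY z.re (hNY.trans hz)).2.1
    have := hx z.im (by rw [← hψ]; exact hz')
    rw [Complex.re_add_im] at this
    exact norm_pos_iff.1 ((Real.exp_pos _).trans_le this)
  have hΦd : ∀ z : ℂ, |z.im| ≤ ψ →
      DifferentiableAt ℂ (fun z => laplaceExpNeg V (Complex.exp z)) z := by
    intro z hz
    have h2 : 0 < (Complex.exp z).re := by
      rw [Complex.exp_re]
      have : 0 < Real.cos z.im := Real.cos_pos_of_mem_Ioo
        ⟨by linarith [(abs_le.1 hz).1], by linarith [(abs_le.1 hz).2]⟩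
      positivity
    exact (hV.differentiableAt_laplaceExpNeg h2).comp z Complex.differentiableAt_exp
  have hNc : ∀ (L : ℝ) (z : ℂ), l N ≤ z.re → |z.im| ≤ ψ → ContinuousAt (wedgeNum V a L) z := by
    intro L z hz hz'
    unfold wedgeNum
    exact (DifferentiableAt.mul (by fun_prop) ((Complex.differentiableAt_exp.div (hΦd z hz')
      (hΦ0 z hz hz')).const_mul _)).continuousAt
  have hDray : ∀ x α : ℝ, |α| = ψ → wedgeDen a (x + α * Complex.I) ≠ 0 := by
    intro x α hα h0
    rw [wedgeDen, Complex.sin_eq_zero_iff] at h0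
    obtain ⟨k, hk⟩ := h0
    have h1 := congrArg Complex.im hk
    have e1 : ((Real.pi : ℂ) * (Complex.exp (x + α * Complex.I) - a)).im =
        Real.pi * (Real.exp x * Real.sin α) := by
      rw [Complex.im_ofReal_mul, Complex.sub_im, Complex.exp_im, Complex.ofReal_im, sub_zero]
      simp
    have e2 : ((k : ℂ) * Real.pi).im = 0 := by simp
    have hs := Real.sin_pos_of_pos_of_lt_pi hψ0 (by linarith)
    rw [e1, e2] at h1
    have h2 : Real.sin α = 0 := by
      have := Real.exp_pos x
      simpa [hπ.ne', this.ne'] using h1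
    rcases (abs_eq hψ0.le).1 hα with h | h <;> rw [h] at h2
    · linarith
    · rw [Real.sin_neg] at h2; linarith
  have hray : ∀ (L α x : ℝ), |α| = ψ → l N ≤ x → ContinuousAt
      (fun x : ℝ => wedgeNum V a L (x + α * Complex.I) / wedgeDen a (x + α * Complex.I)) x := by
    intro L α x hα hx
    have h1 : ContinuousAt (fun z => wedgeNum V a L z / wedgeDen a z) (x + α * Complex.I) :=
      (hNc L _ (by simpa using hx) (by simpa using hα.le)).div
        (differentiable_wedgeDen a).continuous.continuousAt (hDray x α hα)
    exact ContinuousAt.comp (f := fun x : ℝ => (x : ℂ) + α * Complex.I) h1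
      (Continuous.continuousAt (by fun_prop))
  obtain ⟨C₀, hC₀⟩ : ∃ C₀ : ℝ, ∀ α : ℝ, |α| ≤ ψ →
      ‖wedgeNum V a 0 (l N + α * Complex.I) / wedgeDen a (l N + α * Complex.I)‖ ≤ C₀ := by
    have hcont : ContinuousOn (fun α : ℝ => wedgeNum V a 0 (l N + α * Complex.I))
        (Icc (-ψ) ψ) := by
      intro α hα
      exact (ContinuousAt.comp (f := fun α : ℝ => (l N : ℂ) + α * Complex.I)
        (hNc 0 _ (by simp) (by simpa using abs_le.2 hα))
        (Continuous.continuousAt (by fun_prop))).continuousWithinAt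
    obtain ⟨C₀, hC₀⟩ := isCompact_Icc.exists_bound_of_continuousOn hcont
    refine ⟨C₀ / (1 / 4), fun α hα => ?_⟩
    rw [norm_div]
    have h1 := hC₀ α (abs_le.1 hα)
    have h2 : 1 / 4 ≤ ‖wedgeDen a (l N + α * Complex.I)‖ := by
      rw [hl]
      exact quarter_le_norm_wedgeDen ha.le hN1 (by linarith)
    have h3 := (norm_nonneg _).trans h1
    gcongr
  have hC₀0 : 0 ≤ C₀ := (norm_nonneg _).trans (hC₀ 0 (by simpa using hψ0.le))
  -- The kernel depends on `L` only through e^{(s-a)L}, so on the fixed inner arc the bound at L = 0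
  -- is multiplied by at most e^{ML} with M = exp(l N), the radius of that arc.
  have harc : ∀ L : ℝ, 0 ≤ L → ∀ α : ℝ, |α| ≤ ψ →
      ‖wedgeNum V a L (l N + α * Complex.I) / wedgeDen a (l N + α * Complex.I)‖ ≤
        C₀ * Real.exp (Real.exp (l N) * L) := by
    intro L hL α hα
    have h1 : wedgeNum V a L (l N + α * Complex.I) =
        Complex.exp ((Complex.exp (l N + α * Complex.I) - a) * L) *
          wedgeNum V a 0 (l N + α * Complex.I) := by
      simp [wedgeNum]
    rw [h1, mul_div_assoc, norm_mul, mul_comm C₀]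
    refine mul_le_mul ?_ (hC₀ α hα) (norm_nonneg _) (Real.exp_pos _).le
    rw [Complex.norm_exp, Complex.re_mul_ofReal, Complex.sub_re, Complex.exp_re]
    apply Real.exp_le_exp.2
    apply mul_le_mul_of_nonneg_right _ hL
    simp only [Complex.add_re, Complex.ofReal_re, Complex.mul_re, Complex.I_re, mul_zero,
        Complex.ofReal_im, Complex.I_im, mul_one, sub_self, add_zero, Complex.add_im,
        Complex.mul_im, zero_add]
    have := Real.cos_le_one α
    have := Real.exp_pos (l N)
    nlinarith
  refine ⟨N, A + 4 * Real.pi * ψ + ψ * C₀, Real.exp (l N), by positivity, fun L hL => ?_⟩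
  filter_upwards [hV.eventually_norm_wedge_arc_le ha hB hφ0 hφ hL, eventually_ge_atTop N]
    with K hK hNK
  have hlK : (Real.log (K + a - 1 / 2) : ℝ) = l K := by rw [hl]
  rw [hlK, ← hψ] at hK
  have hsum := sum_rectIntegral (G := fun z => wedgeNum V a L z / wedgeDen a z) (ψ := ψ) hmono
    (fun x hx => by
      have := hray L (-ψ) x (by rw [abs_neg, abs_of_pos hψ0]) hx
      simpa [sub_eq_add_neg] using this)
    (fun x hx => hray L ψ x (abs_of_pos hψ0) hx) hNK
  obtain ⟨hNKl, hsum⟩ := hsum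
  have hterm : ∀ n ∈ Finset.Ico N K,
      rectIntegral (fun z => wedgeNum V a L z / wedgeDen a z) (l n) (l (n + 1)) ψ =
      2 * Real.pi * Complex.I *
        ((-1) ^ n * (Real.exp (n * L) : ℝ) / laplaceExpNeg V ((n : ℂ) + a)) := by
    intro n hn
    have hn := (Finset.mem_Ico.1 hn).1
    have e1 : l (n + 1) = Real.log (n + a + 1 / 2) := by
      rw [hl]
      simp only
      congr 1
      push_cast
      ring
    have e2 : l n = Real.log (n + a - 1 / 2) := by rw [hl]
    rw [e1, e2]
    exact hV.rectIntegral_wedge ha (one_le_two.trans (hN1.trans hn)) hψ0 hψ2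
      (fun z hz hz' => hΦ0 z ((hmono' n hn).trans (e2 ▸ hz)) hz') L
  rw [Finset.sum_congr rfl hterm, ← Finset.mul_sum] at hsum
  have hnorm := congrArg norm hsum
  rw [norm_mul] at hnorm
  have h2π : ‖(2 * Real.pi * Complex.I : ℂ)‖ = 2 * Real.pi := by
    simp [abs_of_pos hπ]
  rw [h2π] at hnorm
  obtain ⟨S, hS⟩ : ∃ S, S = Real.exp (Real.cos ψ * (V L).re) := ⟨_, rfl⟩
  obtain ⟨Q, hQ⟩ : ∃ Q, Q = Real.exp (Real.exp (l N) * L) := ⟨_, rfl⟩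
  have hS0 : 0 < S := hS ▸ Real.exp_pos _
  have hQ1 : 1 ≤ Q := hQ ▸ Real.one_le_exp (by positivity)
  have hrayb : ∀ α : ℝ, |α| = ψ →
      ‖∫ x in (l N)..(l K), wedgeNum V a L (x + α * Complex.I) / wedgeDen a (x + α * Complex.I)‖ ≤
        A * S := by
    intro α hα
    refine norm_integral_le_of_exp_neg hl0 hNKl (by positivity) fun x hx => ?_
    rw [hS, hψ]
    exact (hY x (hNY.trans hx)).1 L hL α (by rw [hα, hψ])
  have hb1 := hrayb (-ψ) (by rw [abs_neg, abs_of_pos hψ0])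
  have hb2 := hrayb ψ (abs_of_pos hψ0)
  simp only [Complex.ofReal_neg, neg_mul, ← sub_eq_add_neg] at hb1
  have hvert : ∀ (t B : ℝ), (∀ α : ℝ, |α| ≤ ψ → ‖wedgeNum V a L (t + α * Complex.I) /
      wedgeDen a (t + α * Complex.I)‖ ≤ B) → ‖Complex.I * ∫ y in (-ψ)..ψ,
        wedgeNum V a L (t + y * Complex.I) / wedgeDen a (t + y * Complex.I)‖ ≤ B * (2 * ψ) := by
    intro t B h
    rw [norm_mul, Complex.norm_I, one_mul]
    refine (intervalIntegral.norm_integral_le_of_norm_le_const fun y hy => h y ?_).trans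
      (le_of_eq ?_)
    · rw [uIoc_of_le (by linarith)] at hy
      exact abs_le.2 ⟨hy.1.le, hy.2⟩
    · rw [sub_neg_eq_add, abs_of_pos (by linarith)]
      ring
  have hb3 := hvert (l K) _ hK
  have hb4 := hvert (l N) _ (harc L hL)
  rw [← hQ] at hb4
  have hfin : ‖rectIntegral (fun z => wedgeNum V a L z / wedgeDen a z) (l N) (l K) ψ‖ ≤
      A * S + A * S + 4 * Real.pi * (2 * ψ) + C₀ * Q * (2 * ψ) := by
    unfold rectIntegral
    exact (norm_sub_le _ _).trans (add_le_add ((norm_add_le _ _).trans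
      (add_le_add ((norm_sub_le _ _).trans (add_le_add hb1 hb2)) hb3)) hb4)
  rw [← hnorm] at hfin
  rw [← hψ, ← hS, ← hQ]
  have h1 : 0 ≤ ‖∑ n ∈ Finset.Ico N K,
    (-1) ^ n * ((Real.exp (n * L) : ℝ) : ℂ) / laplaceExpNeg V ((n : ℂ) + a)‖ := norm_nonneg _
  have e1 : 0 ≤ A * Q := by positivity
  have e2 : 0 ≤ 4 * Real.pi * ψ * S := by positivity
  have e3 : 0 ≤ ψ * C₀ * S := by positivity
  have e4 : 4 * Real.pi * ψ ≤ 4 * Real.pi * ψ * Q := le_mul_of_one_le_right (by positivity) hQ1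
  have h3 := Real.pi_gt_three
  nlinarith

end IsGrowthFun

/-! ### Growth of the kernel series on the positive and negative rays -/

/-- `E(z) = ∑ z ^ p / (c Φ(p + a))` with `Φ` the Laplace transform of `exp (-V)`. -/
structure IsKernelSeries (c a : ℝ) (V E : ℂ → ℂ) : Prop where
  c_pos : 0 < c
  a_pos : 0 < a
  hasSum : ∀ z : ℂ, HasSum (fun p : ℕ => z ^ p / (c * laplaceExpNeg V ((p : ℂ) + a))) (E z)

namespace IsGrowthFun

variable {ρ a : ℝ} {V : ℂ → ℂ} (hV : IsGrowthFun ρ V)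
include hV

theorem continuous_re : Continuous fun x : ℝ => (V x).re :=
  Complex.continuous_re.comp hV.continuous_ofReal

theorem laplaceExpNeg_ofReal (s : ℝ) :
    laplaceExpNeg V s = ((∫ x : ℝ, Real.exp (s * x - (V x).re) : ℝ) : ℂ) := by
  rw [laplaceExpNeg, ← integral_complex_ofReal]
  congr 1
  ext x
  push_cast
  rw [hV.coe_re]

/-- Only the piece of the integral over (x, x + η] is kept. There the linear term is smallest at the
left end and -V at the right end. -/
theorem le_integral_exp (hint : ∀ s : ℝ, 0 < s → Integrable fun x : ℝ => Real.exp (s * x - (V x).re))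
    {s η : ℝ} (hs : 0 < s) (hη : 0 < η) (x : ℝ) :
    η * Real.exp (s * x - (V (x + η : ℝ)).re) ≤ ∫ x : ℝ, Real.exp (s * x - (V x).re) := by
  have hi := hint s hs
  have h1 : ∫ t in Ioc x (x + η), Real.exp (s * x - (V (x + η : ℝ)).re) ≤
      ∫ t in Ioc x (x + η), Real.exp (s * t - (V t).re) := by
    refine setIntegral_mono_on (by simp) hi.integrableOn
      measurableSet_Ioc fun t ht => ?_
    apply Real.exp_le_exp.2
    have h2 := hV.mono.monotone ht.2
    have h3 : s * x ≤ s * t := by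
      have := ht.1.le
      gcongr
    have h4 : (V t).re ≤ (V (x + η : ℝ)).re := h2
    linarith
  have h2 : ∫ t in Ioc x (x + η), Real.exp (s * t - (V t).re) ≤
      ∫ t : ℝ, Real.exp (s * t - (V t).re) :=
    setIntegral_le_integral hi (Eventually.of_forall fun t => (Real.exp_pos _).le)
  rw [setIntegral_const, smul_eq_mul] at h1
  simp only [Real.volume_real_Ioc, add_sub_cancel_left] at h1
  rw [max_eq_left hη.le] at h1
  exact h1.trans h2

end IsGrowthFun

theorem integrable_exp_of_pos {ρ : ℝ} {V : ℂ → ℂ} (hV : IsGrowthFun ρ V) {s : ℝ} (hs : 0 < s) :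
    Integrable fun x : ℝ => Real.exp (s * x - (V x).re) := by
  obtain ⟨X, hX⟩ := eventually_atTop.1 (hV.eventually_mul_le (s + 1))
  have hmeas : Continuous fun x : ℝ => Real.exp (s * x - (V x).re) := by
    have := hV.continuous_re
    fun_prop
  have h1 : IntegrableOn (fun x : ℝ => Real.exp (s * x - (V x).re)) (Iic X) := by
    refine (integrableOn_exp_mul_Iic hs X).mono' hmeas.aestronglyMeasurable
      (Eventually.of_forall fun x => ?_)
    rw [Real.norm_of_nonneg (Real.exp_pos _).le]
    apply Real.exp_le_exp.2
    linarith [hV.pos x]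
  have h2 : IntegrableOn (fun x : ℝ => Real.exp (s * x - (V x).re)) (Ioi X) := by
    refine (integrableOn_exp_mul_Ioi (neg_one_lt_zero) X).mono' hmeas.aestronglyMeasurable ?_
    refine (ae_restrict_iff' measurableSet_Ioi).2 (Eventually.of_forall fun x hx => ?_)
    rw [Real.norm_of_nonneg (Real.exp_pos _).le]
    apply Real.exp_le_exp.2
    have := hX x (le_of_lt hx)
    linarith
  rw [← integrableOn_univ, ← Iic_union_Ioi (a := X)]
  exact h1.union h2

namespace IsKernelSeries

variable {ρ c a : ℝ} {V E : ℂ → ℂ} (hE : IsKernelSeries c a V E) (hV : IsGrowthFun ρ V)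
include hE hV

/-- The moments of the kernel at the natural numbers. -/
def _root_.kernelMoment (V : ℂ → ℂ) (c a : ℝ) (p : ℕ) : ℝ :=
  c * ∫ x : ℝ, Real.exp ((p + a) * x - (V x).re)

omit hE in
theorem mul_laplaceExpNeg (p : ℕ) :
    (c : ℂ) * laplaceExpNeg V ((p : ℂ) + a) = kernelMoment V c a p := by
  have := hV.laplaceExpNeg_ofReal (p + a)
  push_cast at this
  rw [this, kernelMoment]
  push_cast
  rfl

omit hV in
theorem add_pos (p : ℕ) : 0 < (p : ℝ) + a := by
  have := hE.a_pos
  positivity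

theorem le_kernelMoment {η : ℝ} (hη : 0 < η) (x : ℝ) (p : ℕ) :
    c * (η * Real.exp ((p + a) * x - (V (x + η : ℝ)).re)) ≤ kernelMoment V c a p := by
  have := hE.c_pos
  rw [kernelMoment]
  gcongr
  exact hV.le_integral_exp (fun s hs => integrable_exp_of_pos hV hs) (hE.add_pos p) hη x

theorem kernelMoment_pos (p : ℕ) : 0 < kernelMoment V c a p := by
  refine lt_of_lt_of_le ?_ (hE.le_kernelMoment hV one_pos 0 p)
  have := hE.c_pos
  positivity

theorem hasSum_moment (z : ℂ) : HasSum (fun p : ℕ => z ^ p / (kernelMoment V c a p : ℂ)) (E z) := by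
  have := hE.hasSum z
  simp_rw [mul_laplaceExpNeg hV] at this
  exact this

/-- The moment is bounded from below at the abscissa x + η instead of x. The excess produces the
geometric factor e^{-ηp}, which makes the series summable. The price is V(x + 2η) in place of V(x),
harmless as η → 0 by regular variation. -/
theorem exp_div_kernelMoment_le {η : ℝ} (hη : 0 < η) {x : ℝ} (hx : 0 ≤ x) (p : ℕ) :
    Real.exp x ^ p / kernelMoment V c a p ≤
      (1 / (c * η) * Real.exp ((V (x + 2 * η : ℝ)).re)) * Real.exp (-η) ^ p := by
  have hc := hE.c_pos
  have ha := hE.a_pos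
  have h := hE.le_kernelMoment hV hη (x + η) p
  have h0 := hE.kernelMoment_pos hV p
  rw [div_le_iff₀ h0]
  have e1 : (x + η + η : ℝ) = x + 2 * η := by ring
  rw [e1] at h
  have e2 : 0 ≤ (1 / (c * η) * Real.exp ((V (x + 2 * η : ℝ)).re)) * Real.exp (-η) ^ p := by
    positivity
  refine le_trans ?_ (mul_le_mul_of_nonneg_left h e2)
  have e3 : (1 / (c * η) * Real.exp ((V (x + 2 * η : ℝ)).re)) * Real.exp (-η) ^ p *
      (c * (η * Real.exp ((p + a) * (x + η) - (V (x + 2 * η : ℝ)).re))) =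
      Real.exp (p * x + a * (x + η)) := by
    rw [← Real.exp_nat_mul, Real.exp_sub]
    have := Real.exp_ne_zero (V (x + 2 * η : ℝ)).re
    field_simp
    rw [← Real.exp_add]
    congr 1
    ring
  rw [e3, ← Real.exp_nat_mul]
  apply Real.exp_le_exp.2
  have : 0 ≤ a * (x + η) := by positivity
  linarith

theorem norm_le_of_norm_eq {η : ℝ} (hη : 0 < η) {x : ℝ} (hx : 0 ≤ x) {z : ℂ}
    (hz : ‖z‖ = Real.exp x) :
    ‖E z‖ ≤ 1 / (c * η) * (1 - Real.exp (-η))⁻¹ * Real.exp ((V (x + 2 * η : ℝ)).re) := by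
  have h1 : HasSum (fun p : ℕ =>
      (1 / (c * η) * Real.exp ((V (x + 2 * η : ℝ)).re)) * Real.exp (-η) ^ p)
      ((1 / (c * η) * Real.exp ((V (x + 2 * η : ℝ)).re)) * (1 - Real.exp (-η))⁻¹) :=
    (hasSum_geometric_of_lt_one (Real.exp_pos _).le
      (by rw [Real.exp_lt_one_iff]; linarith)).mul_left _
  have h2 := (hE.hasSum_moment hV z).norm_le_of_bounded h1 fun p => by
    rw [norm_div, norm_pow, hz, Complex.norm_real, Real.norm_of_nonneg (hE.kernelMoment_pos hV p).le]
    exact hE.exp_div_kernelMoment_le hV hη hx p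
  refine h2.trans (le_of_eq (by ring))

/-- `E` has type at most one with respect to `V`, uniformly in all directions. -/
theorem eventually_norm_le {ε : ℝ} (hε : 0 < ε) :
    ∀ᶠ x : ℝ in atTop, ∀ y : ℝ,
      ‖E (Complex.exp (x + y * Complex.I))‖ ≤ Real.exp ((1 + ε) * (V x).re) := by
  have hρ := hV.order_pos
  have hc := hE.c_pos
  obtain ⟨η, hη0, hη⟩ : ∃ η : ℝ, 0 < η ∧ Real.exp (ρ * (2 * η)) < 1 + ε / 2 := by
    have hcont : Tendsto (fun η : ℝ => Real.exp (ρ * (2 * η))) (𝓝[>] 0) (𝓝 1) := by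
      have : Continuous fun η : ℝ => Real.exp (ρ * (2 * η)) := by fun_prop
      have h := (this.tendsto 0).mono_left (nhdsWithin_le_nhds (s := Ioi 0))
      simpa using h
    obtain ⟨η, h1, h2⟩ := ((hcont.eventually_lt_const (show (1 : ℝ) < 1 + ε / 2 by linarith)).and
      self_mem_nhdsWithin).exists
    exact ⟨η, h2, h1⟩
  obtain ⟨C, hC⟩ : ∃ C, C = 1 / (c * η) * (1 - Real.exp (-η))⁻¹ := ⟨_, rfl⟩
  have hC0 : 0 < C := by
    have : Real.exp (-η) < 1 := by rw [Real.exp_lt_one_iff]; linarith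
    have := sub_pos.2 this
    rw [hC]; positivity
  filter_upwards [eventually_ge_atTop 0, (hV.tendsto_shift_div (2 * η)).eventually_le_const hη,
    hV.tendsto_atTop.eventually_ge_atTop (Real.log C / (ε / 2))] with x hx hxV hxC y
  have h := hE.norm_le_of_norm_eq hV hη0 hx (z := Complex.exp (x + y * Complex.I))
    (by rw [Complex.norm_exp]; simp)
  rw [← hC] at h
  refine h.trans ?_
  rw [div_le_iff₀ (hV.pos x)] at hxV
  rw [div_le_iff₀ (by positivity)] at hxC
  rw [← Real.exp_log hC0, ← Real.exp_add]
  apply Real.exp_le_exp.2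
  linarith

theorem hasFiniteType : HasFiniteType V fun w => E (Complex.exp w) :=
  ⟨1 + 1, by norm_num, hE.eventually_norm_le hV one_pos⟩

theorem indicatorLE_one (θ : ℝ) : IndicatorLE V (fun w => E (Complex.exp w)) θ 1 :=
  fun _ hε => (hE.eventually_norm_le hV hε).mono fun _ hx => hx θ

theorem conj_apply (z : ℂ) : E ((starRingEnd ℂ) z) = (starRingEnd ℂ) (E z) := by
  have h := (hE.hasSum_moment hV z).map (starRingEnd ℂ) Complex.continuous_conj
  refine (hE.hasSum_moment hV _).unique (h.congr_fun fun p => ?_)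
  simp

theorem indicatorLE_neg {θ A : ℝ} (h : IndicatorLE V (fun w => E (Complex.exp w)) θ A) :
    IndicatorLE V (fun w => E (Complex.exp w)) (-θ) A := by
  intro ε hε
  filter_upwards [h ε hε] with x hx
  have : Complex.exp (x + (-θ : ℝ) * Complex.I) =
      (starRingEnd ℂ) (Complex.exp (x + θ * Complex.I)) := by
    rw [← Complex.exp_conj]
    simp
  rw [this, hE.conj_apply hV, Complex.norm_conj]
  exact hx

theorem hasSum_real (x : ℝ) : HasSum (fun p : ℕ => x ^ p / kernelMoment V c a p) (E x).re := by
  have h := Complex.hasSum_re (hE.hasSum_moment hV x)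
  refine h.congr_fun fun p => ?_
  rw [← Complex.ofReal_pow, ← Complex.ofReal_div, Complex.ofReal_re]

theorem sum_le {x : ℝ} (hx : 0 ≤ x) (N : ℕ) :
    ∑ p ∈ Finset.range N, x ^ p / kernelMoment V c a p ≤ (E x).re :=
  sum_le_hasSum _ (fun p _ => div_nonneg (pow_nonneg hx p) (hE.kernelMoment_pos hV p).le)
    (hE.hasSum_real hV x)

theorem norm_le_re {x : ℝ} {z : ℂ} (hz : ‖z‖ ≤ x) : ‖E z‖ ≤ (E x).re := by
  refine (hE.hasSum_moment hV z).norm_le_of_bounded (hE.hasSum_real hV x) fun p => ?_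
  have := hE.kernelMoment_pos hV p
  rw [norm_div, norm_pow, Complex.norm_real, Real.norm_of_nonneg this.le]
  gcongr

/-- On the positive half-line, `E` has type one with respect to `V`. -/
theorem not_indicatorLE {A : ℝ} (hA : A < 1) :
    ¬ IndicatorLE V (fun w => E (Complex.exp w)) 0 A := by
  intro h
  have hc := hE.c_pos
  have ha := hE.a_pos
  obtain ⟨ε, hε⟩ : ∃ ε, ε = (1 - A) / 2 := ⟨_, rfl⟩
  have hε0 : 0 < ε := by rw [hε]; linarith
  -- As A = 1 - 2ε, the product of E(e^x) and exp(ax - V(x)) is at most exp(ax - εV(x)), and V(x) ≥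
  -- (a+1)x/ε reduces this to e^{-x}.
  obtain ⟨X, hX⟩ := eventually_atTop.1 ((h ε hε0).and
    (hV.eventually_mul_le ((a + 1) / ε)))
  have hX1 : ∀ x : ℝ, X ≤ x → (E (Real.exp x : ℝ)).re * Real.exp (a * x - (V x).re) ≤
      Real.exp (-1 * x) := by
    intro x hx
    obtain ⟨h1, h2⟩ := hX x hx
    simp only [Complex.ofReal_zero, zero_mul, add_zero] at h1
    rw [← Complex.ofReal_exp] at h1
    have h3 := (Complex.re_le_norm _).trans h1
    refine (mul_le_mul_of_nonneg_right h3 (Real.exp_pos _).le).trans ?_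
    rw [← Real.exp_add]
    apply Real.exp_le_exp.2
    rw [div_mul_eq_mul_div, div_le_iff₀ hε0] at h2
    have : A = 1 - 2 * ε := by rw [hε]; ring
    rw [this]
    linarith
  obtain ⟨g, hg⟩ : ∃ g : ℝ → ℝ, g = fun x => (Iic X).indicator (fun x =>
    (E (Real.exp X : ℝ)).re * Real.exp (a * x)) x + (Ioi X).indicator (fun x =>
      Real.exp (-1 * x)) x := ⟨_, rfl⟩
  have hgi : Integrable g := by
    rw [hg]
    refine Integrable.add ?_ ?_
    · exact (integrable_indicator_iff measurableSet_Iic).2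
        ((integrableOn_exp_mul_Iic ha X).const_mul _)
    · exact (integrable_indicator_iff measurableSet_Ioi).2
        (integrableOn_exp_mul_Ioi neg_one_lt_zero X)
  have hle : ∀ x : ℝ, (E (Real.exp x : ℝ)).re * Real.exp (a * x - (V x).re) ≤ g x := by
    intro x
    rw [hg]
    rcases le_or_gt x X with hx | hx
    · have h1 : (E (Real.exp x : ℝ)).re ≤ (E (Real.exp X : ℝ)).re := by
        refine (Complex.re_le_norm _).trans (hE.norm_le_re hV ?_)
        rw [Complex.norm_real, Real.norm_of_nonneg (Real.exp_pos _).le]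
        exact Real.exp_le_exp.2 hx
      have h0 : 0 ≤ (E (Real.exp X : ℝ)).re := by
        simpa using hE.sum_le hV (Real.exp_pos X).le 0
      have hx' : x ∉ Ioi X := fun h => absurd h (not_lt.2 hx)
      simp only [indicator_of_mem (show x ∈ Iic X from hx), indicator_of_notMem hx', add_zero]
      refine mul_le_mul h1 (Real.exp_le_exp.2 ?_) (Real.exp_pos _).le h0
      linarith [hV.pos x]
    · have hx' : x ∉ Iic X := fun h => absurd hx (not_lt.2 h)
      simp only [indicator_of_mem (show x ∈ Ioi X from hx), indicator_of_notMem hx', zero_add]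
      exact hX1 x hx.le
  have hterm : ∀ p : ℕ, Integrable fun x : ℝ =>
      Real.exp x ^ p / kernelMoment V c a p * Real.exp (a * x - (V x).re) := by
    intro p
    refine ((integrable_exp_of_pos hV (hE.add_pos p)).div_const (kernelMoment V c a p)).congr
      (Eventually.of_forall fun x => ?_)
    simp only
    rw [div_mul_eq_mul_div, ← Real.exp_nat_mul, ← Real.exp_add]
    congr 2
    ring
  -- The moments are built from the same weight, so every term has integral 1/c. Partial sums thus
  -- have integral N/c, although all are dominated by the integrable function `g`.
  have hval : ∀ p : ℕ, ∫ x : ℝ, Real.exp x ^ p / kernelMoment V c a p *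
      Real.exp (a * x - (V x).re) = 1 / c := by
    intro p
    have h1 : ∀ x : ℝ, Real.exp x ^ p / kernelMoment V c a p * Real.exp (a * x - (V x).re) =
        Real.exp ((p + a) * x - (V x).re) / kernelMoment V c a p := by
      intro x
      rw [div_mul_eq_mul_div, ← Real.exp_nat_mul, ← Real.exp_add]
      congr 2
      ring
    simp_rw [h1]
    rw [integral_div]
    have h2 := (hE.kernelMoment_pos hV p).ne'
    rw [div_eq_div_iff h2 hc.ne', one_mul, mul_comm]
    rfl
  have hN : ∀ N : ℕ, (N : ℝ) * (1 / c) ≤ ∫ x, g x := by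
    intro N
    have h1 : ∫ x : ℝ, ∑ p ∈ Finset.range N, Real.exp x ^ p / kernelMoment V c a p *
        Real.exp (a * x - (V x).re) = N * (1 / c) := by
      rw [integral_finsetSum _ fun p _ => hterm p]
      simp [hval]
    rw [← h1]
    refine integral_mono (integrable_finsetSum _ fun p _ => hterm p) hgi fun x => ?_
    refine le_trans ?_ (hle x)
    rw [← Finset.sum_mul]
    exact mul_le_mul_of_nonneg_right (hE.sum_le hV (Real.exp_pos x).le N) (Real.exp_pos _).le
  obtain ⟨N, hN'⟩ := exists_nat_gt ((∫ x, g x) * c)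
  have := hN N
  rw [mul_one_div, div_le_iff₀ hc] at this
  linarith

/-- Upper bound on the negative half-line when `ρ ≤ 1 / 2`. -/
theorem indicatorLE_pi (hB : HasStripBound ρ a V) (hρ2 : ρ ≤ 1 / 2) :
    IndicatorLE V (fun w => E (Complex.exp w)) Real.pi (Real.cos (ρ * Real.pi)) := by
  have hρ := hV.order_pos
  have hπ := Real.pi_pos
  have hc := hE.c_pos
  intro ε hε
  -- The contour estimate gives the rate cos(ρφ) and requires φ < π. Continuity of the cosine allows
  -- φ so close to π that the loss is below ε/4.
  obtain ⟨φ, hφ1, hφ2, hφ0⟩ : ∃ φ : ℝ, Real.cos (ρ * φ) < Real.cos (ρ * Real.pi) + ε / 4 ∧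
      φ < Real.pi ∧ 0 < φ := by
    have hcont : Tendsto (fun φ : ℝ => Real.cos (ρ * φ)) (𝓝[<] Real.pi)
        (𝓝 (Real.cos (ρ * Real.pi))) := by
      have : Continuous fun φ : ℝ => Real.cos (ρ * φ) := by fun_prop
      exact (this.tendsto _).mono_left nhdsWithin_le_nhds
    obtain ⟨φ, h1, h2, h3⟩ := ((hcont.eventually_lt_const (show Real.cos (ρ * Real.pi) <
      Real.cos (ρ * Real.pi) + ε / 4 by linarith)).and (eventually_mem_nhdsWithin.and
        (mem_nhdsWithin_of_mem_nhds (Ioi_mem_nhds hπ)))).exists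
    exact ⟨φ, h1, h2, h3⟩
  have hφ : φ < Real.pi / (2 * ρ) := by
    refine hφ2.trans_le ?_
    rw [le_div_iff₀ (by positivity)]
    nlinarith
  obtain ⟨N, C, M, hC0, hC⟩ := hV.exists_norm_sum_le hE.a_pos hB hφ0 hφ hφ2
  obtain ⟨D, hD⟩ : ∃ D, D = ∑ n ∈ Finset.range N, 1 / kernelMoment V c a n := ⟨_, rfl⟩
  have hD0 : 0 ≤ D := hD ▸ Finset.sum_nonneg fun n _ => (div_pos one_pos
    (hE.kernelMoment_pos hV n)).le
  have hbound : ∀ L : ℝ, 0 ≤ L → ‖E (Complex.exp (L + Real.pi * Complex.I))‖ ≤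
      D * Real.exp (N * L) +
        C / c * (Real.exp (Real.cos (ρ * φ) * (V L).re) + Real.exp (M * L)) := by
    intro L hL
    have hz : Complex.exp (L + Real.pi * Complex.I) = -(Real.exp L : ℝ) := by
      rw [Complex.exp_add, Complex.exp_pi_mul_I, Complex.ofReal_exp]
      ring
    have hterm : ∀ n : ℕ, (-(Real.exp L : ℝ) : ℂ) ^ n / (c * laplaceExpNeg V ((n : ℂ) + a)) =
        (1 / c : ℂ) * ((-1) ^ n * (Real.exp (n * L) : ℝ) / laplaceExpNeg V ((n : ℂ) + a)) := by
      intro n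
      rw [neg_pow, Real.exp_nat_mul]
      push_cast
      rw [div_mul_div_comm, one_mul]
    have hs := (hE.hasSum (-(Real.exp L : ℝ))).tendsto_sum_nat
    rw [hz]
    refine le_of_tendsto hs.norm ?_
    filter_upwards [hC L hL, eventually_ge_atTop N] with K hK hNK
    rw [← Finset.sum_range_add_sum_Ico _ hNK]
    refine (norm_add_le _ _).trans (add_le_add ?_ ?_)
    · refine (norm_sum_le _ _).trans ?_
      rw [hD, Finset.sum_mul]
      refine Finset.sum_le_sum fun n hn => ?_
      have hn' : (n : ℝ) ≤ N := by exact_mod_cast (Finset.mem_range.1 hn).le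
      rw [mul_laplaceExpNeg hV, norm_div, norm_pow, norm_neg, Complex.norm_real, Complex.norm_real,
        Real.norm_of_nonneg (Real.exp_pos _).le,
        Real.norm_of_nonneg (hE.kernelMoment_pos hV n).le, ← Real.exp_nat_mul, div_mul_eq_mul_div,
        one_mul]
      have := hE.kernelMoment_pos hV n
      gcongr
    · simp_rw [hterm]
      rw [← Finset.mul_sum, norm_mul, norm_div, norm_one, Complex.norm_real,
        Real.norm_of_nonneg hc.le]
      calc _ ≤ 1 / c * (C * (Real.exp (Real.cos (ρ * φ) * (V L).re) + Real.exp (M * L))) := by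
            gcongr
        _ = _ := by ring
  have hcosφ : 0 < Real.cos (ρ * φ) := hV.cos_pos hφ0.le hφ
  obtain ⟨Q, hQ⟩ : ∃ Q, Q = D + 2 * (C / c) + 1 := ⟨_, rfl⟩
  have hQ0 : 0 < Q := by rw [hQ]; positivity
  filter_upwards [eventually_ge_atTop 0, hV.eventually_mul_le (N / (ε / 4)),
    hV.eventually_mul_le (M / (ε / 4)),
    hV.tendsto_atTop.eventually_ge_atTop (Real.log Q / (ε / 4))] with x hx0 hxN hxM hxQ
  refine (hbound x hx0).trans ?_
  rw [div_mul_eq_mul_div, div_le_iff₀ (by positivity)] at hxN hxM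
  rw [div_le_iff₀ (by positivity)] at hxQ
  have hv := hV.pos x
  obtain ⟨S, hS⟩ : ∃ S, S = Real.exp ((Real.cos (ρ * Real.pi) + ε / 2) * (V x).re) := ⟨_, rfl⟩
  have h1 : Real.exp (Real.cos (ρ * φ) * (V x).re) ≤ S := by
    rw [hS]
    apply Real.exp_le_exp.2
    apply mul_le_mul_of_nonneg_right _ hv.le
    linarith
  -- For ρ ≤ 1/2 the target rate is nonnegative, so the terms e^{Nx} and e^{Mx} can be absorbed into
  -- the ε V(x) surplus.
  have hcosπ : 0 ≤ Real.cos (ρ * Real.pi) := by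
    apply Real.cos_nonneg_of_mem_Icc
    constructor <;> nlinarith
  have h4 : 0 ≤ Real.cos (ρ * Real.pi) * (V x).re := by positivity
  have h2 : Real.exp (N * x) ≤ S := by
    rw [hS]
    apply Real.exp_le_exp.2
    nlinarith
  have h3 : Real.exp (M * x) ≤ S := by
    rw [hS]
    apply Real.exp_le_exp.2
    nlinarith
  have hS0 : 0 < S := hS ▸ Real.exp_pos _
  calc _ ≤ D * S + C / c * (S + S) := by gcongr
    _ ≤ Q * S := by rw [hQ]; nlinarith
    _ = Real.exp (Real.log Q + (Real.cos (ρ * Real.pi) + ε / 2) * (V x).re) := by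
        rw [Real.exp_add, Real.exp_log hQ0, hS]
    _ ≤ _ := by
        apply Real.exp_le_exp.2
        nlinarith

end IsKernelSeries

/-! ### Interpolation and propagation of indicators -/

section Indicator

variable {ρ : ℝ} {V F : ℂ → ℂ}

theorem IsGrowthFun.indicatorLE_mono (hV : IsGrowthFun ρ V) {θ A B : ℝ}
    (h : IndicatorLE V F θ A) (hAB : A ≤ B) : IndicatorLE V F θ B := by
  intro ε hε
  filter_upwards [h ε hε] with x hx
  refine hx.trans (Real.exp_le_exp.2 ?_)
  have := (hV.pos x).le
  gcongr

theorem indicatorLE_of_forall_add {θ A : ℝ} (h : ∀ δ > 0, IndicatorLE V F θ (A + δ)) :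
    IndicatorLE V F θ A := by
  intro ε hε
  filter_upwards [h (ε / 2) (half_pos hε) (ε / 2) (half_pos hε)] with x hx
  rw [add_assoc, add_halves] at hx
  exact hx

theorem indicatorLE_of_tendsto {ι : Type*} {l : Filter ι} [l.NeBot] {f : ι → ℝ} {θ A : ℝ}
    (hV : IsGrowthFun ρ V) (hf : Tendsto f l (𝓝 A)) (h : ∀ᶠ i in l, IndicatorLE V F θ (f i)) :
    IndicatorLE V F θ A := by
  refine indicatorLE_of_forall_add fun δ hδ => ?_
  obtain ⟨i, h1, h2⟩ := (h.and (hf.eventually_le_const (show A < A + δ by linarith))).exists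
  exact hV.indicatorLE_mono h1 h2

/-- Phragmén–Lindelöf interpolation between two directions. -/
theorem IsGrowthFun.indicatorLE_interpolate (hV : IsGrowthFun ρ V) (hF : Differentiable ℂ F)
    (hFt : HasFiniteType V F) {θ₁ θ₂ θ₃ A B : ℝ} (h12 : θ₁ ≤ θ₂) (h23 : θ₂ ≤ θ₃) (h13 : θ₁ < θ₃)
    (hlt : θ₃ - θ₁ < Real.pi / ρ) (h1 : IndicatorLE V F θ₁ A) (h3 : IndicatorLE V F θ₃ B) :
    IndicatorLE V F θ₂ ((A * Real.sin (ρ * (θ₃ - θ₂)) + B * Real.sin (ρ * (θ₂ - θ₁))) /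
      Real.sin (ρ * (θ₃ - θ₁))) := by
  have hρ := hV.order_pos
  have hs : 0 < Real.sin (ρ * (θ₃ - θ₁)) := by
    apply Real.sin_pos_of_pos_of_lt_pi
    · have := sub_pos.2 h13
      positivity
    · rwa [lt_div_iff₀ hρ, mul_comm] at hlt
  obtain ⟨s, hs'⟩ : ∃ s, s = Real.sin (ρ * (θ₃ - θ₁)) := ⟨_, rfl⟩
  -- The interpolating expression is itself a ρ-sinusoid in θ. It takes the value A at θ₁ and B at
  -- θ₃.
  have key : ∀ θ, (A * Real.sin (ρ * (θ₃ - θ)) + B * Real.sin (ρ * (θ - θ₁))) / s =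
      (A * Real.sin (ρ * θ₃) - B * Real.sin (ρ * θ₁)) / s * Real.cos (ρ * θ) +
      (B * Real.cos (ρ * θ₁) - A * Real.cos (ρ * θ₃)) / s * Real.sin (ρ * θ) := by
    intro θ
    rw [mul_sub, mul_sub, Real.sin_sub, Real.sin_sub]
    ring
  rw [← hs', key]
  refine hV.indicatorLE_of_sinusoid hF hFt h12 h23 h13 hlt ?_ ?_
  · rw [← key, sub_self, mul_zero, Real.sin_zero, mul_zero, add_zero, hs', mul_div_assoc,
      div_self hs.ne', mul_one]
    exact h1
  · rw [← key, sub_self, mul_zero, Real.sin_zero, mul_zero, zero_add, hs', mul_div_assoc,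
      div_self hs.ne', mul_one]
    exact h3

end Indicator

/-- Power decay of `E` in every closed subsector of the sector complementary to
`|arg z| ≤ π / (2 ρ)`. -/
def HasPowerDecay (ρ : ℝ) (E : ℂ → ℂ) : Prop :=
  ∀ α, Real.pi / (2 * ρ) < α → ∃ β k : ℝ, 0 < β ∧ 0 < k ∧
    ∀ w : ℂ, α ≤ w.im → w.im ≤ 2 * Real.pi - α → 0 ≤ w.re →
      ‖E (Complex.exp w)‖ ≤ k * Real.exp (-β * w.re)

namespace IsKernelSeries

variable {ρ c a : ℝ} {V E : ℂ → ℂ}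

theorem indicatorLE_add_two_pi {θ A : ℝ} (h : IndicatorLE V (fun w => E (Complex.exp w)) θ A) :
    IndicatorLE V (fun w => E (Complex.exp w)) (θ + 2 * Real.pi) A := by
  intro ε hε
  filter_upwards [h ε hε] with x hx
  have : Complex.exp (x + (θ + 2 * Real.pi : ℝ) * Complex.I) =
      Complex.exp (x + θ * Complex.I) := by
    rw [← Complex.exp_periodic (x + θ * Complex.I)]
    congr 1
    push_cast
    ring
  rw [this]
  exact hx

variable (hE : IsKernelSeries c a V E) (hV : IsGrowthFun ρ V)
include hE hV

theorem indicatorLE_two_pi_sub {θ A : ℝ} (h : IndicatorLE V (fun w => E (Complex.exp w)) θ A) :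
    IndicatorLE V (fun w => E (Complex.exp w)) (2 * Real.pi - θ) A := by
  have := indicatorLE_add_two_pi (hE.indicatorLE_neg hV h)
  rwa [neg_add_eq_sub] at this

theorem indicatorLE_abs {θ A : ℝ} (h : IndicatorLE V (fun w => E (Complex.exp w)) θ A) :
    IndicatorLE V (fun w => E (Complex.exp w)) |θ| A := by
  rcases abs_choice θ with h1 | h1 <;> rw [h1]
  · exact h
  · exact hE.indicatorLE_neg hV h

theorem indicatorLE_of_abs {θ A : ℝ} (h : IndicatorLE V (fun w => E (Complex.exp w)) |θ| A) :
    IndicatorLE V (fun w => E (Complex.exp w)) θ A := by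
  rcases abs_choice θ with h1 | h1 <;> rw [h1] at h
  · exact h
  · simpa using hE.indicatorLE_neg hV h

omit hE in
theorem indicatorLE_zero_of_lt (hD : HasPowerDecay ρ E) {θ : ℝ} (h1 : Real.pi / (2 * ρ) < θ)
    (h2 : θ < 2 * Real.pi - Real.pi / (2 * ρ)) :
    IndicatorLE V (fun w => E (Complex.exp w)) θ 0 := by
  obtain ⟨β, k, hβ, hk, h⟩ := hD (min θ (2 * Real.pi - θ)) (lt_min h1 (by linarith))
  intro ε hε
  filter_upwards [eventually_ge_atTop 0,
    hV.tendsto_atTop.eventually_ge_atTop (Real.log k / ε)] with x hx0 hx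
  have h3 := h (x + θ * Complex.I) (by simp) (by
    have := min_le_right θ (2 * Real.pi - θ)
    simp only [Complex.add_im, Complex.ofReal_im, Complex.mul_im, Complex.ofReal_re, Complex.I_im,
      mul_one, Complex.I_re, mul_zero, add_zero, zero_add]
    linarith) (by simpa using hx0)
  refine h3.trans ?_
  rw [← Real.exp_log hk, ← Real.exp_add]
  apply Real.exp_le_exp.2
  rw [div_le_iff₀ hε] at hx
  have : 0 ≤ β * x := by positivity
  simp only [Complex.add_re, Complex.ofReal_re, Complex.mul_re, Complex.I_re, mul_zero,
    Complex.ofReal_im, Complex.I_im, mul_one, sub_self, add_zero]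
  linarith

variable (hEd : Differentiable ℂ E)
include hEd

omit hE hV in
theorem differentiable_comp_exp : Differentiable ℂ fun w => E (Complex.exp w) :=
  hEd.comp Complex.differentiable_exp

/-- Upper bound for the indicator in the sector where it is positive. -/
theorem indicatorLE_cos (hD : HasPowerDecay ρ E) (hρ2 : 1 / 2 < ρ) {θ : ℝ} (h0 : 0 ≤ θ)
    (h1 : θ ≤ Real.pi / (2 * ρ)) :
    IndicatorLE V (fun w => E (Complex.exp w)) θ (Real.cos (ρ * θ)) := by
  have hρ := hV.order_pos
  have hα := hV.half_width_pos
  have hdbl : Real.pi / ρ = 2 * (Real.pi / (2 * ρ)) := by field_simp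
  have hα1 : Real.pi / (2 * ρ) < Real.pi := by
    rw [div_lt_iff₀ (by positivity)]
    nlinarith [Real.pi_pos]
  obtain ⟨α, hαd⟩ : ∃ α, α = Real.pi / (2 * ρ) := ⟨_, rfl⟩
  have hρα : ρ * α = Real.pi / 2 := by rw [hαd]; field_simp
  rw [← hαd] at h1 hα hdbl hα1
  -- The power decay covers only directions strictly beyond π/(2ρ). Interpolating between 1 at 0 and
  -- 0 at θ₃ > π/(2ρ), then letting θ₃ decrease to π/(2ρ), gives cos(ρθ).
  have hf : Tendsto (fun θ₃ : ℝ => (1 * Real.sin (ρ * (θ₃ - θ)) + 0 * Real.sin (ρ * (θ - 0))) /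
      Real.sin (ρ * (θ₃ - 0))) (𝓝[>] α) (𝓝 (Real.cos (ρ * θ))) := by
    have h : ContinuousAt (fun θ₃ : ℝ => (1 * Real.sin (ρ * (θ₃ - θ)) +
        0 * Real.sin (ρ * (θ - 0))) / Real.sin (ρ * (θ₃ - 0))) α := by
      apply ContinuousAt.div (by fun_prop) (by fun_prop)
      rw [sub_zero, hρα, Real.sin_pi_div_two]
      exact one_ne_zero
    have hval : (1 * Real.sin (ρ * (α - θ)) + 0 * Real.sin (ρ * (θ - 0))) /
        Real.sin (ρ * (α - 0)) = Real.cos (ρ * θ) := by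
      rw [mul_sub, sub_zero α, hρα, Real.sin_pi_div_two, Real.sin_pi_div_two_sub]
      ring
    rw [← hval]
    exact h.tendsto.mono_left nhdsWithin_le_nhds
  refine indicatorLE_of_tendsto hV hf ?_
  filter_upwards [self_mem_nhdsWithin,
    mem_nhdsWithin_of_mem_nhds (Iio_mem_nhds (show α < 2 * α by linarith)),
    mem_nhdsWithin_of_mem_nhds (Iio_mem_nhds (show α < 2 * Real.pi - α by linarith))]
    with θ₃ h3 h4 h5
  rw [mem_Ioi] at h3
  rw [mem_Iio] at h4 h5
  refine hV.indicatorLE_interpolate (differentiable_comp_exp hEd) (hE.hasFiniteType hV) h0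
    (by linarith) (by linarith) (by rw [hdbl]; linarith) (hE.indicatorLE_one hV 0)
    (indicatorLE_zero_of_lt hV hD (by rwa [← hαd]) (by rwa [← hαd]))

/-- The opening π of the upper half-plane is less than π/ρ, and cos(ρθ) takes the known upper bounds
1 and cos(ρπ) at its two ends, so a single comparison suffices. -/
theorem indicatorLE_cos_of_le_half (hB : HasStripBound ρ a V) (hρ2 : ρ ≤ 1 / 2) {θ : ℝ}
    (h0 : 0 ≤ θ) (h1 : θ ≤ Real.pi) :
    IndicatorLE V (fun w => E (Complex.exp w)) θ (Real.cos (ρ * θ)) := by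
  have hρ := hV.order_pos
  have hπ := Real.pi_pos
  have h := hV.indicatorLE_of_sinusoid (p := 1) (q := 0) (differentiable_comp_exp hEd)
    (hE.hasFiniteType hV) h0 h1 hπ (by
      rw [sub_zero, lt_div_iff₀ hρ]
      nlinarith) (by simpa using hE.indicatorLE_one hV 0)
      (by simpa using hE.indicatorLE_pi hV hB hρ2)
  simpa using h

/-- Lower bound for the indicator in the sector where it is positive. -/
theorem not_indicatorLE_of_lt_cos {θ A : ℝ} (h1 : |θ| < Real.pi / (2 * ρ))
    (hA : A < Real.cos (ρ * θ)) : ¬ IndicatorLE V (fun w => E (Complex.exp w)) θ A := by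
  intro h
  have hρ := hV.order_pos
  have hcos := hV.cos_pos (abs_nonneg θ) h1
  have hdbl : Real.pi / ρ = 2 * (Real.pi / (2 * ρ)) := by field_simp
  have hA' : A < Real.cos (ρ * |θ|) := by
    rwa [← abs_of_pos hρ, ← abs_mul, Real.cos_abs]
  replace h := hE.indicatorLE_abs hV h
  obtain ⟨φ, hφ⟩ : ∃ φ, φ = |θ| := ⟨_, rfl⟩
  rw [← hφ] at h hA' hcos h1
  have hφ0 : 0 ≤ φ := hφ ▸ abs_nonneg θ
  rcases hφ0.eq_or_lt with h0 | h0
  · rw [← h0] at h hA'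
    simp only [mul_zero, Real.cos_zero] at hA'
    exact hE.not_indicatorLE hV hA' h
  -- Conjugation symmetry gives the same bound at -φ. The comparison sinusoid is (A / cos(ρφ))
  -- cos(ρθ), with value below 1 at 0, contrary to type one on the positive ray.
  have h2 := hV.indicatorLE_of_sinusoid (p := A / Real.cos (ρ * φ)) (q := 0) (θ₂ := 0)
    (differentiable_comp_exp hEd) (hE.hasFiniteType hV) (by linarith) h0.le (by linarith)
    (show φ - -φ < Real.pi / ρ by rw [hdbl]; linarith) (by
      rw [mul_neg, Real.cos_neg, div_mul_cancel₀ _ hcos.ne', zero_mul, add_zero]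
      exact hE.indicatorLE_neg hV h) (by
      rw [div_mul_cancel₀ _ hcos.ne', zero_mul, add_zero]
      exact h)
  simp only [mul_zero, Real.cos_zero, mul_one, zero_mul, add_zero] at h2
  exact hE.not_indicatorLE hV ((div_lt_one hcos).2 hA') h2

/-- Outside the open sector of positivity the indicator is at most zero. -/
theorem indicatorLE_zero (hD : HasPowerDecay ρ E) (hρ2 : 1 / 2 < ρ) {θ : ℝ}
    (h1 : Real.pi / (2 * ρ) ≤ θ) (h2 : θ ≤ 2 * Real.pi - Real.pi / (2 * ρ)) :
    IndicatorLE V (fun w => E (Complex.exp w)) θ 0 := by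
  have hρ := hV.order_pos
  have h0 : IndicatorLE V (fun w => E (Complex.exp w)) (Real.pi / (2 * ρ)) 0 := by
    have h := hE.indicatorLE_cos hV hEd hD hρ2 hV.half_width_pos.le le_rfl
    have : ρ * (Real.pi / (2 * ρ)) = Real.pi / 2 := by field_simp
    rwa [this, Real.cos_pi_div_two] at h
  rcases h1.eq_or_lt with h1 | h1
  · rwa [← h1]
  rcases h2.eq_or_lt with h2 | h2
  · rw [h2]
    exact hE.indicatorLE_two_pi_sub hV h0
  exact indicatorLE_zero_of_lt hV hD h1 h2

/-- Negativity of the indicator spreads over the complementary sector. -/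
theorem exists_neg_indicatorLE_right (hD : HasPowerDecay ρ E) (hρ2 : 1 / 2 < ρ) {θ φ A : ℝ}
    (hA : A < 0) (h : IndicatorLE V (fun w => E (Complex.exp w)) θ A)
    (h1 : Real.pi / (2 * ρ) ≤ θ) (h2 : θ ≤ φ) (h3 : φ < 2 * Real.pi - Real.pi / (2 * ρ))
    (h4 : φ - θ ≤ Real.pi / (2 * ρ)) :
    ∃ B < 0, IndicatorLE V (fun w => E (Complex.exp w)) φ B := by
  have hρ := hV.order_pos
  have hα := hV.half_width_pos
  have hdbl : Real.pi / ρ = 2 * (Real.pi / (2 * ρ)) := by field_simp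
  -- A direction beyond φ at which the indicator is at most 0, less than π/ρ away from θ.
  -- Interpolation at φ then yields A times a positive quotient of sines.
  obtain ⟨θ₃, h5, h6⟩ : ∃ θ₃, φ < θ₃ ∧
      θ₃ < min (2 * Real.pi - Real.pi / (2 * ρ)) (θ + 2 * (Real.pi / (2 * ρ))) :=
    exists_between (lt_min h3 (by linarith))
  obtain ⟨h6, h7⟩ := lt_min_iff.1 h6
  refine ⟨_, ?_, hV.indicatorLE_interpolate (differentiable_comp_exp hEd) (hE.hasFiniteType hV)
    h2 h5.le (by linarith) (by rw [hdbl]; linarith) h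
    (hE.indicatorLE_zero hV hEd hD hρ2 (by linarith) h6.le)⟩
  have hpos : ∀ t : ℝ, 0 < t → t < 2 * (Real.pi / (2 * ρ)) → 0 < Real.sin (ρ * t) := by
    intro t ht ht2
    apply Real.sin_pos_of_pos_of_lt_pi (by positivity)
    rw [← hdbl, lt_div_iff₀ hρ] at ht2
    linarith
  have h8 := hpos (θ₃ - φ) (by linarith) (by linarith)
  have h9 := hpos (θ₃ - θ) (by linarith) (by linarith)
  apply div_neg_of_neg_of_pos _ h9
  rw [zero_mul, add_zero]
  exact mul_neg_of_neg_of_pos hA h8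

/-- A negative indicator at the end of an interval of length `π / ρ` on which the indicator is
nonpositive forces the indicator to be `-∞` inside. -/
theorem forall_indicatorLE_of_neg (hD : HasPowerDecay ρ E) (hρ2 : 1 / 2 < ρ) {θ A : ℝ}
    (hA : A < 0) (h : IndicatorLE V (fun w => E (Complex.exp w)) θ A)
    (h1 : Real.pi / (2 * ρ) ≤ θ) (h2 : θ + 3 * (Real.pi / (2 * ρ)) ≤ 2 * Real.pi) (B : ℝ) :
    IndicatorLE V (fun w => E (Complex.exp w)) (θ + Real.pi / (2 * ρ)) B := by
  have hρ := hV.order_pos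
  have hα := hV.half_width_pos
  have hdbl : Real.pi / ρ = 2 * (Real.pi / (2 * ρ)) := by field_simp
  obtain ⟨α, hαd⟩ : ∃ α, α = Real.pi / (2 * ρ) := ⟨_, rfl⟩
  have hρα : ρ * α = Real.pi / 2 := by rw [hαd]; field_simp
  -- On an interval of length π/ρ - s the interpolated value at θ + π/(2ρ) is A cos(ρs)/sin(ρs),
  -- which tends to -∞ as the length approaches the critical one.
  have hlim : Tendsto (fun s : ℝ => A * Real.cos (ρ * s) / Real.sin (ρ * s)) (𝓝[>] 0) atBot := by
    have hs : Tendsto (fun s : ℝ => Real.sin (ρ * s)) (𝓝[>] 0) (𝓝[>] 0) := by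
      refine tendsto_nhdsWithin_iff.2 ⟨?_, ?_⟩
      · have : Continuous fun s : ℝ => Real.sin (ρ * s) := by fun_prop
        have h := this.tendsto 0
        simp only [mul_zero, Real.sin_zero] at h
        exact h.mono_left nhdsWithin_le_nhds
      · filter_upwards [self_mem_nhdsWithin,
          mem_nhdsWithin_of_mem_nhds (Iio_mem_nhds (show (0 : ℝ) < Real.pi / ρ by positivity))]
          with s hs1 hs2
        rw [mem_Iio, lt_div_iff₀ hρ] at hs2
        rw [mem_Ioi] at hs1
        exact Real.sin_pos_of_pos_of_lt_pi (by positivity) (by linarith)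
    have hc : Tendsto (fun s : ℝ => A * Real.cos (ρ * s)) (𝓝[>] 0) (𝓝 A) := by
      have : Continuous fun s : ℝ => A * Real.cos (ρ * s) := by fun_prop
      have h := this.tendsto 0
      simp only [mul_zero, Real.cos_zero, mul_one] at h
      exact h.mono_left nhdsWithin_le_nhds
    exact hc.neg_mul_atTop hA hs.inv_tendsto_nhdsGT_zero
  obtain ⟨s, hs1, hs2, hs3⟩ := ((hlim.eventually_le_atBot B).and
    (eventually_mem_nhdsWithin.and (mem_nhdsWithin_of_mem_nhds (Iio_mem_nhds hα)))).exists
  rw [mem_Ioi] at hs2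
  rw [← hαd] at h1 h2 hα hdbl hs3 ⊢
  have h3 := hV.indicatorLE_interpolate (θ₂ := θ + α) (θ₃ := θ + 2 * α - s)
    (differentiable_comp_exp hEd) (hE.hasFiniteType hV)
    (by linarith) (by linarith) (by linarith) (by rw [hdbl]; linarith) h
    (hE.indicatorLE_zero hV hEd hD hρ2 (by linarith) (by linarith))
  refine hV.indicatorLE_mono h3 ?_
  have e1 : ρ * (θ + 2 * α - s - (θ + α)) = Real.pi / 2 - ρ * s := by rw [← hρα]; ring
  have e2 : ρ * (θ + 2 * α - s - θ) = Real.pi - ρ * s := by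
    have : Real.pi = 2 * (ρ * α) := by rw [hρα]; ring
    rw [this]; ring
  rw [e1, e2, Real.sin_pi_div_two_sub, Real.sin_pi_sub, zero_mul, add_zero]
  exact hs1

/-- An indicator equal to `-∞` in one direction is `-∞` everywhere. -/
theorem forall_indicatorLE_zero {θ : ℝ} (h0 : 0 ≤ θ)
    (h : ∀ B, IndicatorLE V (fun w => E (Complex.exp w)) θ B) (B : ℝ) :
    IndicatorLE V (fun w => E (Complex.exp w)) 0 B := by
  have hρ := hV.order_pos
  have hα := hV.half_width_pos
  have hdbl : Real.pi / ρ = 2 * (Real.pi / (2 * ρ)) := by field_simp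
  obtain ⟨α, hαd⟩ : ∃ α, α = Real.pi / (2 * ρ) := ⟨_, rfl⟩
  have hρα : ρ * α = Real.pi / 2 := by rw [hαd]; field_simp
  rw [← hαd] at hα hdbl
  -- Interpolation between φ - α/2, where the indicator is at most 1, and θ, where it is -∞: the
  -- value at θ is chosen so that the interpolated value at φ is exactly B. The opening is at most
  -- 3α/2, below π/ρ = 2α.
  have step : ∀ θ φ : ℝ, (∀ B, IndicatorLE V (fun w => E (Complex.exp w)) θ B) → φ ≤ θ →
      θ ≤ φ + α → ∀ B, IndicatorLE V (fun w => E (Complex.exp w)) φ B := by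
    intro θ φ h h1 h2 B
    have e1 : 0 < Real.sin (ρ * (φ - (φ - α / 2))) := by
      apply Real.sin_pos_of_pos_of_lt_pi
      · rw [sub_sub_cancel]; positivity
      · rw [sub_sub_cancel]; linarith [Real.pi_pos]
    have e2 : 0 < Real.sin (ρ * (θ - (φ - α / 2))) := by
      apply Real.sin_pos_of_pos_of_lt_pi
      · have : 0 < θ - (φ - α / 2) := by linarith
        positivity
      · have : ρ * (θ - (φ - α / 2)) ≤ ρ * (3 / 2 * α) := by gcongr; linarith
        linarith [Real.pi_pos]
    have h3 := hV.indicatorLE_interpolate (θ₁ := φ - α / 2) (θ₂ := φ)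
      (differentiable_comp_exp hEd) (hE.hasFiniteType hV)
      (by linarith) h1 (by linarith) (by rw [hdbl]; linarith) (hE.indicatorLE_one hV _)
      (h ((B * Real.sin (ρ * (θ - (φ - α / 2))) - 1 * Real.sin (ρ * (θ - φ))) /
        Real.sin (ρ * (φ - (φ - α / 2)))))
    rwa [div_mul_cancel₀ _ e1.ne', add_sub_cancel, mul_div_cancel_right₀ _ e2.ne'] at h3
  have ind : ∀ n : ℕ, ∀ φ : ℝ, 0 ≤ φ → φ ≤ n * α →
      (∀ B, IndicatorLE V (fun w => E (Complex.exp w)) φ B) →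
      ∀ B, IndicatorLE V (fun w => E (Complex.exp w)) 0 B := by
    intro n
    induction n with
    | zero =>
      intro φ h1 h2 h
      have : φ = 0 := le_antisymm (by simpa using h2) h1
      rwa [this] at h
    | succ n ih =>
      intro φ h1 h2 h
      push_cast at h2
      refine ih (max 0 (φ - α)) (le_max_left _ _) (max_le (by positivity) (by linarith))
        (step φ _ h (max_le h1 (by linarith)) ?_)
      linarith [le_max_right 0 (φ - α)]
  obtain ⟨n, hn⟩ := exists_nat_ge (θ / α)
  rw [div_le_iff₀ hα] at hn
  exact ind n θ h0 hn h B

/-- For ρ > 1 the complementary sector has opening 2π - π/ρ > π/ρ. It therefore contains an interval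
of critical length π/ρ starting at a direction of negative indicator, which forces the indicator to
be -∞ at the midpoint and then at 0. -/
theorem not_indicatorLE_neg_of_one_lt (hD : HasPowerDecay ρ E) (hρ1 : 1 < ρ) {θ A : ℝ}
    (h1 : |θ| ≤ Real.pi) (hA : A < 0) : ¬ IndicatorLE V (fun w => E (Complex.exp w)) θ A := by
  intro h
  have hρ := hV.order_pos
  have hα := hV.half_width_pos
  have hρ2 : 1 / 2 < ρ := by linarith
  rcases lt_or_ge |θ| (Real.pi / (2 * ρ)) with h2 | h2
  · refine hE.not_indicatorLE_of_lt_cos hV hEd h2 (hA.trans ?_) h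
    have := hV.cos_pos (abs_nonneg θ) h2
    rwa [← abs_of_pos hρ, ← abs_mul, Real.cos_abs] at this
  have hα2 : Real.pi / (2 * ρ) < Real.pi / 2 := by
    rw [div_lt_div_iff₀ (by positivity) (by positivity)]
    nlinarith [Real.pi_pos]
  replace h := hE.indicatorLE_abs hV h
  obtain ⟨φ, hφ⟩ : ∃ φ, φ = |θ| := ⟨_, rfl⟩
  rw [← hφ] at h h1 h2
  -- The interval [ψ, ψ + π/ρ] must end by 2π - π/(2ρ), which holds when ψ ≤ π - π/(2ρ). A larger
  -- direction is reflected across the negative axis, moved by spreading to π + π/(2ρ), and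
  -- reflected back.
  obtain ⟨ψ, B, hB, h3, h4, h5⟩ : ∃ ψ B : ℝ, B < 0 ∧ Real.pi / (2 * ρ) ≤ ψ ∧
      ψ ≤ Real.pi - Real.pi / (2 * ρ) ∧ IndicatorLE V (fun w => E (Complex.exp w)) ψ B := by
    rcases le_or_gt φ (Real.pi - Real.pi / (2 * ρ)) with h3 | h3
    · exact ⟨φ, A, hA, h2, h3, h⟩
    · obtain ⟨B, hB, h4⟩ := hE.exists_neg_indicatorLE_right hV hEd hD hρ2
        (φ := Real.pi + Real.pi / (2 * ρ)) hA
        (hE.indicatorLE_two_pi_sub hV h) (by linarith) (by linarith) (by linarith) (by linarith)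
      refine ⟨Real.pi - Real.pi / (2 * ρ), B, hB, by linarith, le_rfl, ?_⟩
      have := hE.indicatorLE_two_pi_sub hV h4
      convert this using 1
      ring
  exact hE.not_indicatorLE hV zero_lt_one (hE.forall_indicatorLE_zero hV hEd (by linarith)
    (hE.forall_indicatorLE_of_neg hV hEd hD hρ2 hB h5 h3 (by linarith)) 0)

/-- If `ρ ≤ 1`, a negative value of the indicator anywhere makes it negative at `π`. -/
theorem exists_neg_indicatorLE_pi (hD : HasPowerDecay ρ E) (hρ2 : 1 / 2 < ρ) (hρ1 : ρ ≤ 1)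
    {θ A : ℝ} (h1 : |θ| ≤ Real.pi) (hA : A < 0)
    (h : IndicatorLE V (fun w => E (Complex.exp w)) θ A) :
    ∃ B < 0, IndicatorLE V (fun w => E (Complex.exp w)) Real.pi B := by
  have hρ := hV.order_pos
  have hα := hV.half_width_pos
  rcases lt_or_ge |θ| (Real.pi / (2 * ρ)) with h2 | h2
  · refine absurd h (hE.not_indicatorLE_of_lt_cos hV hEd h2 (hA.trans ?_))
    have := hV.cos_pos (abs_nonneg θ) h2
    rwa [← abs_of_pos hρ, ← abs_mul, Real.cos_abs] at this
  have hα1 : Real.pi / (2 * ρ) < Real.pi := by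
    rw [div_lt_iff₀ (by positivity)]
    nlinarith [Real.pi_pos]
  -- Since ρ ≤ 1, the distance from any direction in [π/(2ρ), π] to π is at most π/(2ρ), so one
  -- spreading step suffices.
  have hα2 : Real.pi / 2 ≤ Real.pi / (2 * ρ) := by
    rw [div_le_div_iff₀ (by positivity) (by positivity)]
    nlinarith [Real.pi_pos]
  exact hE.exists_neg_indicatorLE_right hV hEd hD hρ2 hA (hE.indicatorLE_abs hV h) h2 h1
    (by linarith) (by linarith)

end IsKernelSeries

/-! ### Multiplicative convolution and the reflection formula -/

section MellinTools

theorem integrable_of_exp_bounds {f : ℝ → ℂ} (hf : Continuous f) {p q C D : ℝ} (hp : 0 < p)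
    (hq : 0 < q) (h1 : ∀ᶠ x in atBot, ‖f x‖ ≤ C * Real.exp (p * x))
    (h2 : ∀ᶠ x in atTop, ‖f x‖ ≤ D * Real.exp (-q * x)) : Integrable f := by
  refine hf.locallyIntegrable.integrable_of_isBigO_atBot_atTop
    (g := fun x => Real.exp (p * x)) (g' := fun x => Real.exp (-q * x)) ?_
    ⟨Iic 0, Iic_mem_atBot 0, integrableOn_exp_mul_Iic hp 0⟩ ?_
    ⟨Ioi 0, Ioi_mem_atTop 0, integrableOn_exp_mul_Ioi (neg_lt_zero.2 hq) 0⟩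
  · refine Asymptotics.IsBigO.of_bound C (h1.mono fun x hx => ?_)
    rwa [Real.norm_of_nonneg (Real.exp_pos _).le]
  · refine Asymptotics.IsBigO.of_bound D (h2.mono fun x hx => ?_)
    rwa [Real.norm_of_nonneg (Real.exp_pos _).le]

/-- Product of two Mellin transforms (in logarithmic coordinates) as the Mellin transform of the
multiplicative convolution. -/
theorem integral_exp_mul_integral_exp {A e : ℝ → ℂ} {σ : ℂ}
    (hf : Integrable fun x : ℝ => Complex.exp (σ * x) * A x)
    (hg : Integrable fun x : ℝ => Complex.exp (-σ * x) * e x) :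
    (∫ x : ℝ, Complex.exp (-σ * x) * e x) * (∫ x : ℝ, Complex.exp (σ * x) * A x) =
      ∫ y : ℝ, Complex.exp (σ * y) * ∫ x : ℝ, A (y + x) * e x := by
  have h := integral_convolution (ContinuousLinearMap.mul ℂ ℂ) hg.comp_neg hf
  rw [ContinuousLinearMap.mul_apply', integral_neg_eq_self
    (fun x : ℝ => Complex.exp (-σ * x) * e x)] at h
  rw [← h]
  congr 1
  ext y
  rw [convolution, ← integral_neg_eq_self, ← integral_const_mul]
  congr 1
  ext x
  simp only [neg_neg, ContinuousLinearMap.mul_apply', sub_neg_eq_add]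
  have : Complex.exp (σ * (y + x : ℝ)) = Complex.exp (σ * y) * Complex.exp (σ * x) := by
    rw [← Complex.exp_add]
    push_cast
    ring_nf
  have h2 : Complex.exp (-σ * x) * Complex.exp (σ * x) = 1 := by
    rw [← Complex.exp_add]
    simp
  rw [this]
  linear_combination (Complex.exp (σ * y) * A (y + x) * e x) * h2

theorem integrable_exp_mul_exp_neg_exp {σ : ℂ} (hσ : 0 < σ.re) :
    Integrable fun x : ℝ => Complex.exp (σ * x) * Complex.exp (-(Real.exp x : ℝ)) := by
  have hn : ∀ x : ℝ, ‖Complex.exp (σ * x) * Complex.exp (-(Real.exp x : ℝ))‖ =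
      Real.exp (σ.re * x - Real.exp x) := by
    intro x
    rw [← Complex.exp_add, Complex.norm_exp]
    simp [-Complex.ofReal_exp, sub_eq_add_neg]
  refine integrable_of_exp_bounds (p := σ.re) (q := 1) (C := 1) (D := 1) (by fun_prop) hσ one_pos
    (Eventually.of_forall fun x => ?_) ?_
  · rw [hn, one_mul]
    apply Real.exp_le_exp.2
    linarith [Real.exp_pos x]
  · filter_upwards [eventually_ge_atTop (2 * (σ.re + 1))] with x hx
    rw [hn, one_mul]
    apply Real.exp_le_exp.2
    have h0 : 0 ≤ x := by linarith
    have := Real.quadratic_le_exp_of_nonneg h0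
    nlinarith

theorem integral_exp_mul_exp_neg_exp {σ : ℂ} (hσ : 0 < σ.re) :
    ∫ x : ℝ, Complex.exp (σ * x) * Complex.exp (-(Real.exp x : ℝ)) = Complex.Gamma σ := by
  rw [Complex.Gamma_eq_integral hσ, Complex.GammaIntegral_eq_mellin,
    ← mellin_comp_log (fun x => Complex.exp (-(Real.exp x : ℝ)))]
  refine setIntegral_congr_fun measurableSet_Ioi fun t ht => ?_
  simp only
  rw [Real.exp_log ht]
  push_cast
  rfl

theorem integral_exp_neg_exp_mul (y : ℝ) :
    ∫ x : ℝ, Complex.exp (-(Real.exp (y + x) : ℝ)) *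
      (Complex.exp x * Complex.exp (-(Real.exp x : ℝ))) = 1 / (1 + Complex.exp y) := by
  have hpos : 0 < 1 + Real.exp y := by positivity
  have h1 := mellin_comp_log (fun x => Complex.exp (-(1 + Real.exp y : ℝ) * (Real.exp x : ℝ))) 1
  have h2 : mellin (fun t => Complex.exp (-(1 + Real.exp y : ℝ) * (Real.exp (Real.log t) : ℝ))) 1 =
      1 / (1 + Complex.exp y) := by
    have h3 := integral_exp_mul_complex_Ioi (a := -(1 + Real.exp y : ℝ))
      (by rw [Complex.neg_re, Complex.ofReal_re]; linarith) 0
    rw [Complex.ofReal_zero, mul_zero, Complex.exp_zero] at h3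
    rw [mellin]
    refine (setIntegral_congr_fun measurableSet_Ioi fun t ht => ?_).trans (h3.trans ?_)
    · rw [Real.exp_log ht, sub_self, Complex.cpow_zero, one_smul]
    · push_cast
      rw [neg_div_neg_eq]
  rw [← h2, h1]
  congr 1
  ext x
  rw [Real.exp_add, one_mul, mul_left_comm, ← Complex.exp_add]
  congr 2
  push_cast
  ring

/-- The convolution identity for e^{-t} and t e^{-t} produces 1/(1 + u), so the integral factors as
Γ(σ)Γ(1 - σ), and the reflection formula evaluates it. -/
theorem integral_exp_div_one_add_exp {σ : ℂ} (h0 : 0 < σ.re) (h1 : σ.re < 1) :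
    ∫ y : ℝ, Complex.exp (σ * y) * (1 / (1 + Complex.exp y)) =
      Real.pi / Complex.sin (Real.pi * σ) := by
  have h1' : 0 < (1 - σ).re := by simpa using h1
  have he : ∀ x : ℝ, Complex.exp (-σ * x) * (Complex.exp x * Complex.exp (-(Real.exp x : ℝ))) =
      Complex.exp ((1 - σ) * x) * Complex.exp (-(Real.exp x : ℝ)) := by
    intro x
    rw [← mul_assoc, ← Complex.exp_add]
    ring_nf
  have h := integral_exp_mul_integral_exp (A := fun x => Complex.exp (-(Real.exp x : ℝ)))
    (e := fun x => Complex.exp x * Complex.exp (-(Real.exp x : ℝ)))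
    (integrable_exp_mul_exp_neg_exp h0) (by
      simp_rw [he]
      exact integrable_exp_mul_exp_neg_exp h1')
  simp_rw [he, integral_exp_neg_exp_mul] at h
  rw [integral_exp_mul_exp_neg_exp h0, integral_exp_mul_exp_neg_exp h1', mul_comm,
    Complex.Gamma_mul_Gamma_one_sub] at h
  exact h.symm

/-- Cauchy's estimate turns the bound on the strip into a uniform bound for the derivative near
`w₀`, which justifies differentiation under the integral. Half the distance to the boundary serves
both as the radius of the neighbourhood and as that of the Cauchy circles. -/
theorem differentiableAt_integral_comp_add {F : ℂ → ℂ} (hF : Differentiable ℂ F) {K η : ℝ}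
    (hK : ∀ w : ℂ, |w.im| < η → ‖F w‖ ≤ K) {e : ℝ → ℂ} (he : Integrable e) {w₀ : ℂ}
    (hw₀ : |w₀.im| < η) : DifferentiableAt ℂ (fun w => ∫ x : ℝ, F (w + x) * e x) w₀ := by
  obtain ⟨r, hr⟩ : ∃ r, r = (η - |w₀.im|) / 2 := ⟨_, rfl⟩
  have hr0 : 0 < r := by rw [hr]; linarith
  have him : ∀ w ∈ Metric.ball w₀ r, |w.im| < |w₀.im| + r := by
    intro w hw
    have h1 := (Complex.abs_im_le_norm (w - w₀)).trans_lt (mem_ball_iff_norm.1 hw)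
    rw [Complex.sub_im] at h1
    have := abs_sub_abs_le_abs_sub w.im w₀.im
    linarith
  have hmeas : ∀ w : ℂ, AEStronglyMeasurable (fun x : ℝ => F (w + x) * e x) volume := by
    intro w
    refine Continuous.aestronglyMeasurable ?_ |>.mul he.aestronglyMeasurable
    have := hF.continuous
    fun_prop
  have hd : Continuous (deriv F) := hF.contDiff.continuous_deriv (by decide : (1 : WithTop ℕ∞) ≤ 1)
  have hderiv : ∀ w ∈ Metric.ball w₀ r, ∀ x : ℝ, ‖deriv F (w + x)‖ ≤ K / r := by
    intro w hw x
    refine Complex.norm_deriv_le_of_forall_mem_sphere_norm_le hr0 hF.diffContOnCl fun z hz => ?_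
    apply hK
    have h1 := (Complex.abs_im_le_norm (z - (w + x))).trans_eq (mem_sphere_iff_norm.1 hz)
    have h2 : (z - (w + x)).im = z.im - w.im := by simp
    rw [h2] at h1
    have := abs_sub_abs_le_abs_sub z.im w.im
    have := him w hw
    have : |w₀.im| + r + r = η := by rw [hr]; ring
    linarith
  refine (hasDerivAt_integral_of_dominated_loc_of_deriv_le (Metric.ball_mem_nhds w₀ hr0)
    (Eventually.of_forall hmeas) (F' := fun w x => deriv F (w + x) * e x)
    (bound := fun x => K / r * ‖e x‖) ?_ ?_ ?_ (he.norm.const_mul _) ?_).2.differentiableAt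
  · refine he.norm.const_mul K |>.mono' (hmeas w₀) (Eventually.of_forall fun x => ?_)
    rw [norm_mul]
    gcongr
    exact hK _ (by simpa using hw₀)
  · refine Continuous.aestronglyMeasurable ?_ |>.mul he.aestronglyMeasurable
    fun_prop
  · refine Eventually.of_forall fun x w hw => ?_
    rw [norm_mul]
    gcongr
    exact hderiv w hw x
  · refine Eventually.of_forall fun x w _ => ?_
    have h1 := (hF (w + x)).hasDerivAt.comp_add_const w x
    exact h1.mul_const _

end MellinTools

/-! ### The functional equation and continuation of the moment function -/

/-- The kernel `c z ^ a exp (-V(z))` on the positive half-line, in logarithmic coordinates. -/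
def kernelOnLine (V : ℂ → ℂ) (c a : ℝ) (x : ℝ) : ℂ :=
  c * Complex.exp (a * x) * Complex.exp (-V x)

/-- The Mellin transform of `t ↦ E(-t)`, in logarithmic coordinates. -/
def mellinNeg (E : ℂ → ℂ) (σ : ℂ) : ℂ := ∫ x : ℝ, Complex.exp (σ * x) * E (-Complex.exp x)

namespace IsKernelSeries

variable {ρ c a : ℝ} {V E : ℂ → ℂ}

theorem mellinNeg_eq_mellin (σ : ℂ) :
    mellinNeg E σ = mellin (fun t => E (-Complex.exp (Real.log t : ℝ))) σ := by
  rw [mellin_comp_log (fun x => E (-Complex.exp x))]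
  rfl

theorem exp_mul_kernelOnLine (s : ℂ) (x : ℝ) :
    Complex.exp (s * x) * kernelOnLine V c a x = c * Complex.exp ((s + a) * x - V x) := by
  have : (s + a) * x - V x = s * x + a * x + -V x := by ring
  rw [kernelOnLine, this, Complex.exp_add, Complex.exp_add]
  ring

theorem integral_exp_mul_kernelOnLine (s : ℂ) :
    ∫ x : ℝ, Complex.exp (s * x) * kernelOnLine V c a x = c * laplaceExpNeg V (s + a) := by
  simp_rw [exp_mul_kernelOnLine]
  rw [integral_const_mul]
  rfl

variable (hE : IsKernelSeries c a V E) (hV : IsGrowthFun ρ V)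
include hV

theorem continuous_kernelOnLine : Continuous (kernelOnLine V c a) := by
  have := hV.continuous_ofReal
  exact (continuous_const.mul (by fun_prop)).mul this.neg.cexp

include hE

omit hV in
theorem norm_exp_mul_kernelOnLine (s : ℂ) (x : ℝ) :
    ‖Complex.exp (s * x) * kernelOnLine V c a x‖ =
      c * Real.exp ((s.re + a) * x - (V x).re) := by
  rw [exp_mul_kernelOnLine, norm_mul, Complex.norm_exp, Complex.norm_real,
    Real.norm_of_nonneg hE.c_pos.le]
  simp

theorem integrable_exp_mul_kernelOnLine {s : ℂ} (hs : 0 < s.re + a) :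
    Integrable fun x : ℝ => Complex.exp (s * x) * kernelOnLine V c a x := by
  have hc : Continuous (kernelOnLine V c a) := continuous_kernelOnLine hV
  refine ((integrable_exp_of_pos hV hs).const_mul c).mono'
    (Continuous.aestronglyMeasurable (by fun_prop)) (Eventually.of_forall fun x => ?_)
  rw [hE.norm_exp_mul_kernelOnLine]

theorem integrable_kernelOnLine : Integrable (kernelOnLine V c a) := by
  have h := hE.integrable_exp_mul_kernelOnLine hV (s := 0) (by simpa using hE.a_pos)
  simpa using h

/-- `∫ E(-u t) e(t) dt / t = 1 / (1 + u)` for `|u| < 1`. -/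
theorem integral_mul_kernelOnLine_of_re_neg {w : ℂ} (hw : w.re < 0) :
    ∫ x : ℝ, E (-Complex.exp (w + x)) * kernelOnLine V c a x = 1 / (1 + Complex.exp w) := by
  have hu : ‖Complex.exp w‖ < 1 := by rwa [Complex.norm_exp, Real.exp_lt_one_iff]
  have hterm : ∀ (p : ℕ) (x : ℝ),
      (-Complex.exp (w + x)) ^ p / (kernelMoment V c a p : ℂ) * kernelOnLine V c a x =
      (-Complex.exp w) ^ p / (kernelMoment V c a p : ℂ) *
        (Complex.exp ((p : ℂ) * x) * kernelOnLine V c a x) := by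
    intro p x
    rw [Complex.exp_add, ← neg_mul, mul_pow, ← Complex.exp_nat_mul]
    ring
  have hpos : ∀ p : ℕ, 0 < ((p : ℂ)).re + a := fun p => by simpa using hE.add_pos p
  have hint : ∀ p : ℕ, Integrable fun x : ℝ =>
      (-Complex.exp (w + x)) ^ p / (kernelMoment V c a p : ℂ) * kernelOnLine V c a x := by
    intro p
    simp_rw [hterm]
    exact (hE.integrable_exp_mul_kernelOnLine hV (hpos p)).const_mul _
  have hval : ∀ p : ℕ, ∫ x : ℝ,
      (-Complex.exp (w + x)) ^ p / (kernelMoment V c a p : ℂ) * kernelOnLine V c a x =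
      (-Complex.exp w) ^ p := by
    intro p
    simp_rw [hterm]
    rw [integral_const_mul, integral_exp_mul_kernelOnLine, mul_laplaceExpNeg hV,
      div_mul_cancel₀]
    exact_mod_cast (hE.kernelMoment_pos hV p).ne'
  have hnorm : ∀ p : ℕ, ∫ x : ℝ,
      ‖(-Complex.exp (w + x)) ^ p / (kernelMoment V c a p : ℂ) * kernelOnLine V c a x‖ =
      ‖Complex.exp w‖ ^ p := by
    intro p
    have h0 := hE.kernelMoment_pos hV p
    simp_rw [hterm, norm_mul _ (Complex.exp _ * kernelOnLine V c a _),
      hE.norm_exp_mul_kernelOnLine]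
    rw [integral_const_mul, integral_const_mul, norm_div, norm_pow, norm_neg, Complex.norm_real,
      Real.norm_of_nonneg h0.le, Complex.natCast_re]
    change _ * kernelMoment V c a p = _
    rw [div_mul_cancel₀ _ h0.ne']
  -- Integrating the series for E termwise gives the geometric series in -u. The norms of the terms
  -- integrate to |u|^p, so the exchange is legitimate precisely for |u| < 1.
  have h1 := hasSum_integral_of_summable_integral_norm hint (by
    simp_rw [hnorm]
    exact summable_geometric_of_lt_one (norm_nonneg _) hu)
  simp_rw [hval] at h1
  have h2 := hasSum_geometric_of_norm_lt_one (ξ := -Complex.exp w) (by rwa [norm_neg])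
  rw [sub_neg_eq_add, ← one_div] at h2
  refine Eq.trans ?_ (h1.unique h2)
  congr 1
  ext x
  rw [tsum_mul_right, (hE.hasSum_moment hV _).tsum_eq]

-- Outside the unit disc the power decay applies in a sector about the negative axis, which exists
-- because π/(2ρ) < π. Inside it, the coefficients of E are positive, so |E| ≤ E(1).
omit hV in
theorem exists_norm_neg_exp_le (hV : IsGrowthFun ρ V) (hD : HasPowerDecay ρ E)
    (hρ2 : 1 / 2 < ρ) : ∃ η K : ℝ, 0 < η ∧ η < Real.pi ∧
      ∀ w : ℂ, |w.im| < η → ‖E (-Complex.exp w)‖ ≤ K := by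
  have hρ := hV.order_pos
  have hα := hV.half_width_pos
  have hα1 : Real.pi / (2 * ρ) < Real.pi := by
    rw [div_lt_iff₀ (by positivity)]
    nlinarith [Real.pi_pos]
  obtain ⟨α, h1, h2⟩ := exists_between hα1
  obtain ⟨β, k, hβ, hk, h⟩ := hD α h1
  refine ⟨Real.pi - α, max k (E (1 : ℝ)).re, by linarith, by linarith, fun w hw => ?_⟩
  obtain ⟨h3, h4⟩ := abs_lt.1 hw
  rcases le_or_gt 0 w.re with h0 | h0
  · have h5 := h (w + Real.pi * Complex.I) (by simp; linarith) (by simp; linarith) (by simpa using h0)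
    rw [Complex.exp_add, Complex.exp_pi_mul_I, mul_neg_one] at h5
    refine le_max_of_le_left (h5.trans ?_)
    have : Real.exp (-β * (w + Real.pi * Complex.I).re) ≤ 1 := by
      rw [Real.exp_le_one_iff]
      simp
      positivity
    exact mul_le_of_le_one_right hk.le this
  · refine le_max_of_le_right (hE.norm_le_re hV ?_)
    rw [norm_neg, Complex.norm_exp, Real.exp_le_one_iff]
    exact h0.le

/-- `∫ E(-u t) e(t) dt / t = 1 / (1 + u)` for `u > 0`. -/
theorem integral_mul_kernelOnLine (hEd : Differentiable ℂ E) (hD : HasPowerDecay ρ E)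
    (hρ2 : 1 / 2 < ρ) (y : ℝ) :
    ∫ x : ℝ, E (-Complex.exp (y + x)) * kernelOnLine V c a x = 1 / (1 + Complex.exp y) := by
  obtain ⟨η, K, hη, hηπ, hK⟩ := hE.exists_norm_neg_exp_le hV hD hρ2
  have hF : Differentiable ℂ fun w => E (-Complex.exp w) :=
    hEd.comp Complex.differentiable_exp.neg
  have hopen : IsOpen {w : ℂ | |w.im| < η} :=
    isOpen_lt (by fun_prop) continuous_const
  have hconv : Convex ℝ {w : ℂ | |w.im| < η} := by
    have : {w : ℂ | |w.im| < η} = Complex.imLm ⁻¹' (Ioo (-η) η) := by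
      ext w; simp [abs_lt]
    rw [this]
    exact (convex_Ioo _ _).linear_preimage _
  have h1 : AnalyticOnNhd ℂ (fun w : ℂ => ∫ x : ℝ, E (-Complex.exp (w + x)) *
      kernelOnLine V c a x) {w : ℂ | |w.im| < η} := by
    refine DifferentiableOn.analyticOnNhd (fun w hw => ?_) hopen
    exact (differentiableAt_integral_comp_add hF hK (hE.integrable_kernelOnLine hV)
      hw).differentiableWithinAt
  have hne : ∀ w ∈ {w : ℂ | |w.im| < η}, 1 + Complex.exp w ≠ 0 := by
    intro w hw h0
    have hw' : |w.im| < Real.pi := lt_trans hw hηπ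
    have h2 : Complex.exp w = Complex.exp (Real.pi * Complex.I) := by
      rw [Complex.exp_pi_mul_I]
      linear_combination h0
    obtain ⟨n, hn⟩ := Complex.exp_eq_exp_iff_exists_int.1 h2
    have h3 := congrArg Complex.im hn
    simp at h3
    rw [h3, abs_lt] at hw'
    have hπ := Real.pi_pos
    have h4 : (n : ℝ) < 0 := by nlinarith [hw'.2]
    have h5 : (-1 : ℝ) < n := by nlinarith [hw'.1]
    norm_cast at h4 h5
    have h6 : (-1 : ℤ) < n := by exact_mod_cast h5
    omega
  have h2 : AnalyticOnNhd ℂ (fun w : ℂ => 1 / (1 + Complex.exp w)) {w : ℂ | |w.im| < η} := by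
    refine DifferentiableOn.analyticOnNhd (fun w hw => ?_) hopen
    refine DifferentiableAt.differentiableWithinAt ?_
    have := hne w hw
    fun_prop (disch := assumption)
  -- Both sides are holomorphic on the strip |Im w| < η, where η < π excludes the poles of 1/(1 +
  -- e^w), and they agree for Re w < 0.
  have h3 := h1.eqOn_of_preconnected_of_eventuallyEq h2 hconv.isPreconnected (z₀ := -1)
    (by simpa using hη) (by
      have : ∀ᶠ w : ℂ in 𝓝 (-1), w.re < 0 :=
        Complex.continuous_re.continuousAt.eventually_lt_const (by simp)
      filter_upwards [this] with w hw
      exact hE.integral_mul_kernelOnLine_of_re_neg hV hw)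
  exact h3 (show |((y : ℂ)).im| < η by simpa using hη)

end IsKernelSeries

namespace IsKernelSeries

variable {ρ c a : ℝ} {V E : ℂ → ℂ}

theorem eventually_norm_neg_exp_le (hV : IsGrowthFun ρ V) {B : ℝ} (hB : B < 0)
    (h : IndicatorLE V (fun w => E (Complex.exp w)) Real.pi B) (N : ℝ) :
    ∀ᶠ x : ℝ in atTop, ‖E (-Complex.exp x)‖ ≤ Real.exp (-N * x) := by
  filter_upwards [h (-B / 2) (by linarith), hV.eventually_mul_le (N / (-B / 2))] with x h1 h2
  rw [Complex.exp_add, Complex.exp_pi_mul_I, mul_neg_one] at h1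
  refine h1.trans (Real.exp_le_exp.2 ?_)
  rw [div_mul_eq_mul_div, div_le_iff₀ (by linarith)] at h2
  linarith

theorem differentiableAt_mellinNeg (hEd : Differentiable ℂ E) {K : ℝ}
    (hK : ∀ x : ℝ, ‖E (-Complex.exp x)‖ ≤ K)
    (hN : ∀ N : ℝ, ∀ᶠ x : ℝ in atTop, ‖E (-Complex.exp x)‖ ≤ Real.exp (-N * x)) {σ : ℂ}
    (hσ : 0 < σ.re) : DifferentiableAt ℂ (mellinNeg E) σ := by
  rw [funext mellinNeg_eq_mellin]
  have hc : ContinuousOn (fun t : ℝ => E (-Complex.exp (Real.log t : ℝ))) (Ioi 0) := by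
    have h1 : ContinuousOn (fun t : ℝ => ((Real.log t : ℝ) : ℂ)) (Ioi 0) :=
      Complex.continuous_ofReal.comp_continuousOn
        (Real.continuousOn_log.mono fun t ht => (ne_of_gt ht : t ≠ 0))
    exact hEd.continuous.comp_continuousOn h1.cexp.neg
  refine mellin_differentiableAt_of_isBigO_rpow (a := σ.re + 1) (b := 0)
    (hc.locallyIntegrableOn measurableSet_Ioi) ?_ (by linarith) ?_ hσ
  · refine Asymptotics.IsBigO.of_bound 1 ?_
    filter_upwards [Real.tendsto_log_atTop.eventually (hN (σ.re + 1)), eventually_gt_atTop 0]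
      with t ht h0
    rw [one_mul, Real.norm_of_nonneg (Real.rpow_nonneg h0.le _), Real.rpow_def_of_pos h0,
      mul_comm (Real.log t)]
    exact ht
  · refine Asymptotics.IsBigO.of_bound K (Eventually.of_forall fun t => ?_)
    rw [neg_zero, Real.rpow_zero, norm_one, mul_one]
    exact hK _

/-- Functional equation of the Mellin transforms of `e` and of `t ↦ E(-t)`. -/
theorem mul_mellinNeg (hE : IsKernelSeries c a V E) (hV : IsGrowthFun ρ V)
    (hEd : Differentiable ℂ E) (hD : HasPowerDecay ρ E) (hρ2 : 1 / 2 < ρ) {K : ℝ}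
    (hK : ∀ x : ℝ, ‖E (-Complex.exp x)‖ ≤ K)
    (hN : ∀ N : ℝ, ∀ᶠ x : ℝ in atTop, ‖E (-Complex.exp x)‖ ≤ Real.exp (-N * x)) {σ : ℂ}
    (h0 : 0 < σ.re) (h1 : σ.re < 1) (h2 : σ.re < a) :
    c * laplaceExpNeg V (-σ + a) * mellinNeg E σ = Real.pi / Complex.sin (Real.pi * σ) := by
  have hEc := hEd.continuous
  have hf : Integrable fun x : ℝ => Complex.exp (σ * x) * E (-Complex.exp x) := by
    refine integrable_of_exp_bounds (p := σ.re) (q := 1) (C := K) (D := 1) (by fun_prop) h0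
      one_pos (Eventually.of_forall fun x => ?_) ?_
    · rw [norm_mul, Complex.norm_exp, mul_comm]
      have := hK x
      simp only [Complex.mul_re, Complex.ofReal_re, Complex.ofReal_im, mul_zero, sub_zero]
      gcongr
    · filter_upwards [hN (σ.re + 1)] with x hx
      rw [norm_mul, Complex.norm_exp, one_mul]
      refine (mul_le_mul_of_nonneg_left hx (Real.exp_pos _).le).trans_eq ?_
      rw [← Real.exp_add]
      simp only [Complex.mul_re, Complex.ofReal_re, Complex.ofReal_im, mul_zero, sub_zero]
      ring_nf
  have h := integral_exp_mul_integral_exp hf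
    (hE.integrable_exp_mul_kernelOnLine hV (s := -σ) (by rw [Complex.neg_re]; linarith))
  rw [integral_exp_mul_kernelOnLine] at h
  refine h.trans ?_
  rw [← integral_exp_div_one_add_exp h0 h1]
  congr 1
  ext y
  rw [← hE.integral_mul_kernelOnLine hV hEd hD hρ2 y]
  congr 2
  ext x
  push_cast
  rfl

/-- If the indicator of `E` is negative at `π`, then the moment function has no continuation
which is analytic at a negative integer. -/
theorem not_continuesToNonzero (hE : IsKernelSeries c a V E) (hV : IsGrowthFun ρ V)
    (hEd : Differentiable ℂ E) (hD : HasPowerDecay ρ E) (hρ2 : 1 / 2 < ρ) {B : ℝ} (hB : B < 0)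
    (h : IndicatorLE V (fun w => E (Complex.exp w)) Real.pi B) (k : ℕ) :
    ¬ ContinuesToNonzero (fun s => c * laplaceExpNeg V (s + a)) (-(k : ℂ) - 1) := by
  rintro ⟨U, g, hU, hUc, hUr, hsU, hgm, hgeq, hga, -⟩
  have ha := hE.a_pos
  have hc : (c : ℂ) ≠ 0 := by exact_mod_cast hE.c_pos.ne'
  have hN := eventually_norm_neg_exp_le hV hB h
  obtain ⟨η, K, hη, -, hK⟩ := hE.exists_norm_neg_exp_le hV hD hρ2
  replace hK : ∀ x : ℝ, ‖E (-Complex.exp x)‖ ≤ K := fun x => hK x (by simpa using hη)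
  obtain ⟨m, hm⟩ : ∃ m : ℂ → ℂ, m = fun s => c * laplaceExpNeg V (s + a) := ⟨_, rfl⟩
  -- The functional equation reads m·H = π near the imaginary axis on the left. Because E(-t) decays
  -- faster than any power, H is holomorphic for all Re s < 0, and the sine makes it vanish at the
  -- negative integers.
  obtain ⟨H, hH⟩ : ∃ H : ℂ → ℂ, H = fun s => mellinNeg E (-s) * Complex.sin (Real.pi * (-s)) :=
    ⟨_, rfl⟩
  have hopen : IsOpen {s : ℂ | s.re < 0} := isOpen_lt Complex.continuous_re continuous_const
  have hHa : AnalyticOnNhd ℂ H {s : ℂ | s.re < 0} := by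
    refine DifferentiableOn.analyticOnNhd (fun s hs => ?_) hopen
    have h1 : DifferentiableAt ℂ (mellinNeg E) (-s) :=
      differentiableAt_mellinNeg hEd hK hN (by simpa using hs)
    rw [hH]
    refine DifferentiableAt.differentiableWithinAt (DifferentiableAt.mul ?_ (by fun_prop))
    exact h1.comp s differentiableAt_id.neg
  have hma : ∀ s : ℂ, -a < s.re → AnalyticAt ℂ m s := by
    intro s hs
    have ho : IsOpen {s : ℂ | -a < s.re} := isOpen_lt continuous_const Complex.continuous_re
    refine DifferentiableOn.analyticAt (s := {s : ℂ | -a < s.re}) (fun s hs => ?_)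
      (ho.mem_nhds hs)
    rw [hm]
    have hs' : -a < s.re := hs
    have h1 : DifferentiableAt ℂ (laplaceExpNeg V) (s + a) :=
      hV.differentiableAt_laplaceExpNeg (by simp; linarith)
    refine DifferentiableAt.differentiableWithinAt (DifferentiableAt.const_mul ?_ _)
    exact DifferentiableAt.comp (g := laplaceExpNeg V) (f := fun s : ℂ => s + a) s h1
      (differentiableAt_id.add_const _)
  obtain ⟨b, hb⟩ : ∃ b, b = min 1 a := ⟨_, rfl⟩
  have hb0 : 0 < b := hb ▸ lt_min one_pos ha
  have hprod : ∀ s : ℂ, -b < s.re → s.re < 0 → m s * H s = Real.pi := by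
    intro s h1 h2
    have hb1 : b ≤ 1 := hb ▸ min_le_left _ _
    have hba : b ≤ a := hb ▸ min_le_right _ _
    have h3 := hE.mul_mellinNeg hV hEd hD hρ2 hK hN (σ := -s) (by simpa using h2)
      (by rw [Complex.neg_re]; linarith) (by rw [Complex.neg_re]; linarith)
    rw [neg_neg] at h3
    have h4 : Complex.sin (Real.pi * (-s)) ≠ 0 := by
      intro h0
      obtain ⟨n, hn⟩ := Complex.sin_eq_zero_iff.1 h0
      rw [mul_comm] at hn
      have h5 := mul_right_cancel₀ (by exact_mod_cast Real.pi_ne_zero) hn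
      have h6 := congrArg Complex.re h5
      simp only [Complex.neg_re, Complex.intCast_re] at h6
      have h7 : (0 : ℝ) < n := by linarith
      have h8 : (n : ℝ) < 1 := by linarith
      have h9 : (0 : ℤ) < n := by exact_mod_cast h7
      have h10 : n < (1 : ℤ) := by exact_mod_cast h8
      omega
    rw [hm, hH]
    simp only
    rw [← mul_assoc, h3, div_mul_cancel₀ _ h4]
  -- A meromorphic continuation of m to the whole plane: m itself on the right, π/H on the left, the
  -- two agreeing on -b < Re s < 0.
  obtain ⟨Q, hQ⟩ : ∃ Q : ℂ → ℂ, Q = fun s => if -(b / 2) < s.re then m s else Real.pi / H s :=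
    ⟨_, rfl⟩
  have hQr : ∀ s : ℂ, s.re < 0 → ∀ᶠ z in 𝓝 s, Q z = Real.pi / H z := by
    intro s hs
    filter_upwards [hopen.mem_nhds hs] with z hz
    rw [hQ]
    simp only
    split_ifs with h1
    · have h2 := hprod z (by linarith) hz
      have h3 : H z ≠ 0 := by
        intro h0
        rw [h0, mul_zero] at h2
        exact Real.pi_ne_zero (by exact_mod_cast h2.symm)
      rw [← h2, mul_div_cancel_right₀ _ h3]
    · rfl
  have hQm : ∀ s : ℂ, MeromorphicAt Q s := by
    intro s
    rcases lt_or_ge (-(b / 2)) s.re with h1 | h1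
    · have h2 : ∀ᶠ z in 𝓝 s, Q z = m z := by
        filter_upwards [(isOpen_lt continuous_const Complex.continuous_re).mem_nhds h1] with z hz
        rw [hQ]
        exact if_pos hz
      have h3 : -a < s.re := by
        have hba : b ≤ a := hb ▸ min_le_right _ _
        linarith
      exact ((hma s h3).congr (h2.mono fun z hz => hz.symm)).meromorphicAt
    · have h2 : s.re < 0 := by linarith
      have h3 : MeromorphicAt (fun z => Real.pi / H z) s :=
        (MeromorphicAt.const _ _).div (hHa s h2).meromorphicAt
      exact h3.congr ((hQr s h2).filter_mono nhdsWithin_le_nhds |>.mono fun z hz => hz.symm)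
  have hdm : MeromorphicOn (g - Q) U := fun s hs => (hgm s hs).sub (hQm s)
  have h1U : (1 : ℂ) ∈ U := hUr (by simp)
  have htop1 : meromorphicOrderAt (g - Q) 1 = ⊤ := by
    rw [meromorphicOrderAt_eq_top_iff]
    have : ∀ᶠ z : ℂ in 𝓝 1, 0 < z.re :=
      Complex.continuous_re.continuousAt.eventually_const_lt (by simp)
    refine (this.filter_mono nhdsWithin_le_nhds).mono fun z hz => ?_
    rw [Pi.sub_apply, hgeq z hz, hQ]
    simp only
    rw [if_pos (by linarith), hm, sub_self]
  obtain ⟨s₀, hs₀⟩ : ∃ s₀ : ℂ, s₀ = -(k : ℂ) - 1 := ⟨_, rfl⟩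
  rw [← hs₀] at hsU hga
  have hs₀re : s₀.re < 0 := by
    rw [hs₀]
    simp only [Complex.sub_re, Complex.neg_re, Complex.natCast_re, Complex.one_re]
    have : (0 : ℝ) ≤ k := k.cast_nonneg
    linarith
  -- Identity theorem for meromorphic functions on the connected set `U`: g - Q vanishes identically
  -- near 1, hence near s₀. So gH = π on a punctured neighbourhood of s₀, while continuity and H(s₀)
  -- = 0 give the limit 0.
  have htop : meromorphicOrderAt (g - Q) s₀ = ⊤ := by
    by_contra hne
    exact hdm.meromorphicOrderAt_ne_top_of_isPreconnected hUc hsU h1U hne htop1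
  rw [meromorphicOrderAt_eq_top_iff] at htop
  have hHne : ∀ᶠ z in 𝓝[≠] s₀, H z ≠ 0 := by
    rcases (hHa s₀ hs₀re).eventually_eq_zero_or_eventually_ne_zero with h1 | h1
    · exfalso
      have hconv : Convex ℝ {s : ℂ | s.re < 0} := convex_halfSpace_re_lt 0
      have h2 := hHa.eqOn_zero_of_preconnected_of_eventuallyEq_zero hconv.isPreconnected hs₀re h1
      have h3 : ((-(b / 2) : ℝ) : ℂ) ∈ {s : ℂ | s.re < 0} := by
        simp only [mem_ofPred_eq, Complex.ofReal_re]; linarith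
      have h4 := hprod ((-(b / 2) : ℝ) : ℂ) (by rw [Complex.ofReal_re]; linarith) h3
      rw [h2 h3, Pi.zero_apply, mul_zero] at h4
      exact Real.pi_ne_zero (by exact_mod_cast h4.symm)
    · exact h1
  have hev : ∀ᶠ z in 𝓝[≠] s₀, g z * H z = Real.pi := by
    filter_upwards [htop, hHne, (hQr s₀ hs₀re).filter_mono nhdsWithin_le_nhds] with z h1 h2 h3
    rw [Pi.sub_apply, sub_eq_zero] at h1
    rw [h1, h3, div_mul_cancel₀ _ h2]
  have hlim : Tendsto (fun z => g z * H z) (𝓝[≠] s₀) (𝓝 (g s₀ * H s₀)) :=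
    (hga.continuousAt.mul (hHa s₀ hs₀re).continuousAt).tendsto.mono_left nhdsWithin_le_nhds
  have hH0 : H s₀ = 0 := by
    rw [hH]
    simp only
    have : Complex.sin (Real.pi * (-s₀)) = 0 := by
      rw [Complex.sin_eq_zero_iff]
      refine ⟨k + 1, ?_⟩
      rw [hs₀]
      push_cast
      ring
    rw [this, mul_zero]
  have := tendsto_nhds_unique (tendsto_const_nhds.congr' (hev.mono fun z hz => hz.symm)) hlim
  rw [hH0, mul_zero] at this
  exact Real.pi_ne_zero (by exact_mod_cast this)

end IsKernelSeries

/-! ### From the kernel axioms to the growth function and the kernel series -/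

section Reduction

theorem assocFun_nonneg {M : ℕ → ℝ} (h0 : M 0 = 1) (t : ℝ) : 0 ≤ assocFun M t :=
  Real.iSup_nonneg' ⟨0, by simp [h0]⟩

/-- A bounded quantity divided by log t tends to 0, so log M(t)/log t converges to ρ and the limsup
in the order of the sequence is a limit. -/
theorem AdmitsProximateOrder.omegaSeq_eq {M : ℕ → ℝ} {ord : ℝ → ℝ} {ρ : ℝ} (hρ : 0 < ρ)
    (hord : IsProximateOrder ord ρ) (h : AdmitsProximateOrder M ord) : omegaSeq M = 1 / ρ := by
  obtain ⟨A, B, hAB⟩ := h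
  have hinv : Tendsto (fun t : ℝ => (Real.log t)⁻¹) atTop (𝓝 0) :=
    tendsto_inv_atTop_zero.comp Real.tendsto_log_atTop
  have hdiff : Tendsto (fun t : ℝ => ord t - Real.log (assocFun M t) / Real.log t) atTop (𝓝 0) := by
    refine tendsto_of_tendsto_of_tendsto_of_le_of_le' (g := fun t => A * (Real.log t)⁻¹)
      (h := fun t => B * (Real.log t)⁻¹) ?_ ?_ ?_ ?_
    · simpa using hinv.const_mul A
    · simpa using hinv.const_mul B
    · filter_upwards [hAB, Real.tendsto_log_atTop.eventually_gt_atTop 0] with t ht h0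
      rw [← div_eq_mul_inv, div_le_iff₀ h0, mul_comm]
      exact ht.1
    · filter_upwards [hAB, Real.tendsto_log_atTop.eventually_gt_atTop 0] with t ht h0
      rw [← div_eq_mul_inv, le_div_iff₀ h0, mul_comm]
      exact ht.2
  have hlim : Tendsto (fun t : ℝ => Real.log (assocFun M t) / Real.log t) atTop (𝓝 ρ) := by
    have := hord.lim.sub hdiff
    rw [sub_zero] at this
    exact this.congr fun t => by ring
  have hmax : Tendsto (fun t : ℝ => max 0 (Real.log (assocFun M t) / Real.log t)) atTop (𝓝 ρ) := by
    have := tendsto_const_nhds (x := (0 : ℝ)).max hlim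
    rwa [max_eq_right hρ.le] at this
  rw [omegaSeq, seqOrder, hmax.limsup_eq]

theorem IsMaergoizFun.isGrowthFun {γ ρ : ℝ} {ord : ℝ → ℝ} {V : ℂ → ℂ} (hρ : 0 < ρ)
    (h : IsMaergoizFun γ ord ρ V) (hγ : 1 / ρ ≤ γ) : IsGrowthFun ρ V := by
  have hsub : logSector 0 (Real.pi / ρ) ⊆ logSector 0 (γ * Real.pi) := by
    intro w hw
    unfold logSector at hw ⊢
    rw [mem_ofPred_eq] at hw ⊢
    refine hw.trans_le ?_
    have : Real.pi / ρ = 1 / ρ * Real.pi := by ring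
    rw [this]
    gcongr
  refine ⟨hρ, h.holo.mono hsub, ?_, fun x => ?_, h.pos, h.mono, h.convex.convexOn, ?_⟩
  · intro u hu w hw
    obtain ⟨t, ht, h1⟩ := (h.regular.mono hsub) u hu w hw
    refine ⟨t, ht, ?_⟩
    filter_upwards [Real.tendsto_exp_atTop.eventually h1] with x hx
    simpa only [Real.log_exp] using hx
  · have hx : (x : ℂ) ∈ logSector 0 (γ * Real.pi) := by
      apply hsub
      rw [mem_strip]
      simp only [Complex.ofReal_im, abs_zero]
      have := Real.pi_pos
      positivity
    have h1 := h.conj x hx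
    rw [Complex.conj_ofReal] at h1
    exact Complex.conj_eq_iff_im.1 h1.symm
  · refine (h.order.lim.comp Real.tendsto_exp_atTop).congr fun x => ?_
    simp only [Function.comp_apply, Real.log_exp]

variable {M : ℕ → ℝ} {e E V : ℂ → ℂ} {ρ c a : ℝ}

/-- The associated function is nonnegative because M₀ = 1, so the decay axiom bounds the kernel on
closed substrips, and taking logarithms of c |z|^a e^{-Re V} gives the bound. This controls V as Re
w → -∞, where regular variation at +∞ gives nothing. -/
theorem IsKernelPair.hasStripBound (h : IsKernelPair M e E) (h0 : M 0 = 1)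
    (hω : omegaSeq M * Real.pi = Real.pi / ρ) (hc : 0 < c)
    (he : ∀ w ∈ logSector 0 (Real.pi / ρ),
      e w = (c : ℂ) * Complex.exp ((a : ℂ) * w) * Complex.exp (-V w)) :
    HasStripBound ρ a V := by
  intro α hα
  obtain ⟨k₁, k₂, hk₁, hk₂, h1⟩ := h.decay (Real.pi / (2 * ρ) - α) (by linarith)
  refine ⟨Real.log (k₁ / c), fun w hw => ?_⟩
  have hmem : w ∈ logSector 0 (Real.pi / ρ) := mem_strip.2 (hw.trans_lt hα)
  have h2 := h1 w (by
    rw [hω]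
    unfold logSector
    rw [mem_ofPred_eq, sub_zero]
    have : Real.pi / ρ = 2 * (Real.pi / (2 * ρ)) := by field_simp
    rw [this]
    linarith)
  have h3 : k₁ * Real.exp (-assocFun M (Real.exp w.re / k₂)) ≤ k₁ := by
    apply mul_le_of_le_one_right hk₁.le
    rw [Real.exp_le_one_iff, neg_nonpos]
    exact assocFun_nonneg h0 _
  have h4 := h2.trans h3
  rw [he w hmem, norm_mul, norm_mul, Complex.norm_exp, Complex.norm_exp, Complex.norm_real,
    Real.norm_of_nonneg hc.le, mul_assoc, ← Real.exp_add, mul_comm, ← le_div_iff₀ hc,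
    ← Real.le_log_iff_exp_le (by positivity)] at h4
  simp only [Complex.mul_re, Complex.ofReal_re, Complex.ofReal_im, zero_mul, sub_zero,
    Complex.neg_re] at h4
  linarith

theorem momentFun_eq (hρ : 0 < ρ)
    (he : ∀ w ∈ logSector 0 (Real.pi / ρ),
      e w = (c : ℂ) * Complex.exp ((a : ℂ) * w) * Complex.exp (-V w)) :
    momentFun e = fun s => c * laplaceExpNeg V (s + a) := by
  ext s
  rw [momentFun, mellin_comp_log (fun x => e x), ← IsKernelSeries.integral_exp_mul_kernelOnLine]
  congr 1
  ext x
  rw [he x, kernelOnLine]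
  rw [mem_strip]
  simp only [Complex.ofReal_im, abs_zero]
  have := Real.pi_pos
  positivity

theorem IsKernelPair.isKernelSeries (h : IsKernelPair M e E) (hρ : 0 < ρ) (hc : 0 < c) (ha : 0 < a)
    (he : ∀ w ∈ logSector 0 (Real.pi / ρ),
      e w = (c : ℂ) * Complex.exp ((a : ℂ) * w) * Complex.exp (-V w)) :
    IsKernelSeries c a V E := by
  refine ⟨hc, ha, fun z => ?_⟩
  have h1 := h.series z
  rw [momentFun_eq hρ he] at h1
  exact h1

theorem IsKernelPair.hasPowerDecay (h : IsKernelPair M e E)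
    (hω : omegaSeq M * Real.pi = Real.pi / ρ) : HasPowerDecay ρ E := by
  intro α hα
  rcases lt_or_ge Real.pi α with hπ | hπ
  -- For α > π the sector is empty.
  · exact ⟨1, 1, one_pos, one_pos, fun w h1 h2 => by linarith⟩
  obtain ⟨β, hβ, h1⟩ := h.decay_neg
  have hdbl : Real.pi / ρ = 2 * (Real.pi / (2 * ρ)) := by field_simp
  -- This opening lies strictly between 2π - 2α, that of the required closed sector, and 2π - π/ρ,
  -- the bound in the axiom, because α > π/(2ρ).
  obtain ⟨k, hk, h2⟩ := h1 (2 * Real.pi - Real.pi / (2 * ρ) - α) 1 (by linarith)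
    (by rw [hω, hdbl]; linarith) one_pos
  refine ⟨β, k, hβ, hk, fun w h3 h4 h5 => ?_⟩
  have h6 := h2 w (by
    unfold logSector
    rw [mem_ofPred_eq, abs_lt]
    constructor <;> linarith) (by rw [Complex.norm_exp]; exact Real.one_le_exp h5)
  rwa [Complex.norm_exp, ← Real.exp_mul, mul_comm w.re] at h6

theorem IsProximateOrder.comp_mul_left {ord : ℝ → ℝ} (h : IsProximateOrder ord ρ) {k : ℝ}
    (hk : 0 < k) : IsProximateOrder (fun t => ord (k * t)) ρ := by
  have hkt : Tendsto (fun t : ℝ => k * t) atTop atTop := tendsto_id.const_mul_atTop hk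
  refine ⟨?_, h.lim.comp hkt, ?_⟩
  · obtain ⟨c, h1, h2⟩ := h.regular
    refine ⟨c / k, fun t ht => h1 _ ?_, ?_⟩
    · rwa [div_lt_iff₀' hk] at ht
    · refine h2.comp (by fun_prop) fun t ht => ?_
      rwa [mem_Ioi, div_lt_iff₀' hk] at ht
  · have h1 := h.lim_deriv.comp hkt
    have h2 : Tendsto (fun r : ℝ => Real.log r / Real.log (k * r)) atTop (𝓝 1) := by
      have h3 : Tendsto (fun r : ℝ => 1 - Real.log k * (Real.log (k * r))⁻¹) atTop (𝓝 1) := by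
        have := ((tendsto_inv_atTop_zero.comp (Real.tendsto_log_atTop.comp hkt)).const_mul
          (Real.log k)).const_sub 1
        simpa using this
      refine h3.congr' ?_
      filter_upwards [eventually_gt_atTop 0, (Real.tendsto_log_atTop.comp hkt).eventually_gt_atTop 0]
        with r h0 hr
      simp only [Function.comp_apply] at hr
      have h5 : Real.log (k * r) ≠ 0 := hr.ne'
      have h4 := Real.log_mul hk.ne' h0.ne'
      field_simp
      linarith
    have h6 := h1.mul h2
    rw [zero_mul] at h6
    refine h6.congr' ?_
    filter_upwards [(Real.tendsto_log_atTop.comp hkt).eventually_gt_atTop 0] with r hr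
    simp only [Function.comp_apply] at hr ⊢
    have h5 : Real.log (k * r) ≠ 0 := hr.ne'
    rw [deriv_comp_mul_left, smul_eq_mul]
    field_simp

end Reduction

/-! ### Translation to extended-real indicators -/

section ExtendedReal

theorem ennrealLog_enorm_le_iff (z : ℂ) (b : ℝ) :
    ENNReal.log ‖z‖ₑ ≤ (b : EReal) ↔ ‖z‖ ≤ Real.exp b := by
  have h : (b : EReal) = ENNReal.log (ENNReal.ofReal (Real.exp b)) := by
    rw [ENNReal.log_ofReal_of_pos (Real.exp_pos b), Real.log_exp]
  rw [h, ENNReal.log_le_log_iff, ← ofReal_norm,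
    ENNReal.ofReal_le_ofReal_iff (Real.exp_pos b).le]

theorem ennrealLog_enorm_div_le_iff (z : ℂ) {D : ℝ} (hD : 0 < D) (b : ℝ) :
    ENNReal.log ‖z‖ₑ / (D : EReal) ≤ (b : EReal) ↔ ‖z‖ ≤ Real.exp (D * b) := by
  rw [EReal.div_le_iff_le_mul (by exact_mod_cast hD) (EReal.coe_ne_top D), ← EReal.coe_mul,
    ennrealLog_enorm_le_iff]

end ExtendedReal

theorem IndicatorLE.congr {V E : ℂ → ℂ} {θ φ A : ℝ}
    (h : IndicatorLE V (fun w => E (Complex.exp w)) θ A)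
    (hθ : Complex.exp (θ * Complex.I) = Complex.exp (φ * Complex.I)) :
    IndicatorLE V (fun w => E (Complex.exp w)) φ A := by
  intro ε hε
  filter_upwards [h ε hε] with x hx
  rw [Complex.exp_add, ← hθ, ← Complex.exp_add]
  exact hx

namespace IsMaergoizFun

variable {γ ρ : ℝ} {ord : ℝ → ℝ} {V E : ℂ → ℂ}

/-- By `equiv`, V(log(kr)) equals (kr)^{ord(kr)} times a factor tending to 1. Dividing by
r^{ord(kr)} leaves k^{ord(kr)}, which tends to k^ρ. This is the source of |λ|^ρ in the final
formulas. -/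
theorem tendsto_div_rpow (h : IsMaergoizFun γ ord ρ V) (hord : Tendsto ord atTop (𝓝 ρ)) {k : ℝ}
    (hk : 0 < k) :
    Tendsto (fun r : ℝ => (V (Real.log (k * r) : ℝ)).re / r ^ ord (k * r)) atTop (𝓝 (k ^ ρ)) := by
  have hkt : Tendsto (fun t : ℝ => k * t) atTop atTop := tendsto_id.const_mul_atTop hk
  have h1 := ((hord.comp hkt).mul_const (Real.log k)).sub (h.equiv.comp hkt)
  rw [sub_zero] at h1
  have h2 := (Real.continuous_exp.tendsto _).comp h1
  rw [Real.rpow_def_of_pos hk, mul_comm (Real.log k)]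
  refine h2.congr' ?_
  filter_upwards [eventually_gt_atTop 0, (Real.tendsto_log_atTop.comp hkt).eventually_gt_atTop 0]
    with r h0 hr
  simp only [Function.comp_apply] at hr ⊢
  have hv := h.pos (Real.log (k * r))
  rw [Real.rpow_def_of_pos h0, ← Real.exp_log hv, ← Real.exp_sub, Real.exp_log hv, sub_mul,
    div_mul_cancel₀ _ hr.ne']
  congr 1
  rw [Real.log_mul hk.ne' h0.ne']
  ring

variable {lam : ℂ}

theorem mul_exp_arg (hlam : lam ≠ 0) {r : ℝ} (hr : 0 < r) (θ : ℝ) :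
    lam * (r * Complex.exp (θ * Complex.I)) =
      Complex.exp (Real.log (‖lam‖ * r) + (θ + lam.arg : ℝ) * Complex.I) := by
  have h1 : 0 < ‖lam‖ * r := mul_pos (norm_pos_iff.2 hlam) hr
  rw [Complex.exp_add, ← Complex.ofReal_exp, Real.exp_log h1]
  push_cast
  rw [add_mul, Complex.exp_add]
  have h2 := Complex.norm_mul_exp_arg_mul_I lam
  linear_combination (-r * Complex.exp (θ * Complex.I)) * h2

/-- Multiplication by λ shifts the direction by arg λ and the logarithmic radius by log |λ|. The
limit of V(log(|λ| r)) / r^{ord(|λ| r)} converts the two normalisations, the strict inequality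
absorbing the error. -/
theorem genIndicator_le (h : IsMaergoizFun γ ord ρ V) (hord : Tendsto ord atTop (𝓝 ρ))
    (hlam : lam ≠ 0) {θ A : ℝ}
    (hI : IndicatorLE V (fun w => E (Complex.exp w)) (θ + lam.arg) A) :
    genIndicator (fun t => ord (‖lam‖ * t)) (fun z => E (lam * z)) θ ≤
      ((‖lam‖ ^ ρ * A : ℝ) : EReal) := by
  have hk : 0 < ‖lam‖ := norm_pos_iff.2 hlam
  have hκ : 0 < ‖lam‖ ^ ρ := Real.rpow_pos_of_pos hk ρ
  have hkt : Tendsto (fun t : ℝ => ‖lam‖ * t) atTop atTop := tendsto_id.const_mul_atTop hk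
  refine EReal.le_of_forall_lt_iff_le.1 fun b hb => ?_
  replace hb : ‖lam‖ ^ ρ * A < b := by exact_mod_cast hb
  obtain ⟨ε, hε, hεb⟩ : ∃ ε > 0, ‖lam‖ ^ ρ * (A + ε) < b := by
    refine ⟨(b - ‖lam‖ ^ ρ * A) / (2 * ‖lam‖ ^ ρ), div_pos (sub_pos.2 hb) (by positivity), ?_⟩
    field_simp
    linarith
  have h1 := (h.tendsto_div_rpow hord hk).mul_const (A + ε)
  unfold genIndicator
  refine limsup_le_of_le (by isBoundedDefault) ?_
  filter_upwards [h1.eventually_lt_const hεb, eventually_gt_atTop 0,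
    (Real.tendsto_log_atTop.comp hkt).eventually (hI ε hε)] with r hr h0 hF
  have hD : 0 < r ^ ord (‖lam‖ * r) := Real.rpow_pos_of_pos h0 _
  rw [ennrealLog_enorm_div_le_iff _ hD, mul_exp_arg hlam h0]
  refine hF.trans (Real.exp_le_exp.2 ?_)
  rw [div_mul_eq_mul_div, div_lt_iff₀ hD] at hr
  simp only [Function.comp_apply]
  linarith

theorem indicatorLE_of_genIndicator_le (h : IsMaergoizFun γ ord ρ V)
    (hord : Tendsto ord atTop (𝓝 ρ)) (hlam : lam ≠ 0) {θ A : ℝ}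
    (hI : genIndicator (fun t => ord (‖lam‖ * t)) (fun z => E (lam * z)) θ ≤
      ((‖lam‖ ^ ρ * A : ℝ) : EReal)) :
    IndicatorLE V (fun w => E (Complex.exp w)) (θ + lam.arg) A := by
  have hk : 0 < ‖lam‖ := norm_pos_iff.2 hlam
  have hκ : 0 < ‖lam‖ ^ ρ := Real.rpow_pos_of_pos hk ρ
  intro ε hε
  have hlt : ‖lam‖ ^ ρ * (A + ε / 2) < ‖lam‖ ^ ρ * (A + ε) := by
    gcongr
    linarith
  have hlt2 : genIndicator (fun t => ord (‖lam‖ * t)) (fun z => E (lam * z)) θ <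
      ((‖lam‖ ^ ρ * (A + ε / 2) : ℝ) : EReal) := by
    refine hI.trans_lt ?_
    have : ‖lam‖ ^ ρ * A < ‖lam‖ ^ ρ * (A + ε / 2) := by
      gcongr
      linarith
    exact_mod_cast this
  have h1 := (h.tendsto_div_rpow hord hk).mul_const (A + ε)
  have h2 : ∀ᶠ r : ℝ in atTop, 0 < r ∧ ‖E (Complex.exp (Real.log (‖lam‖ * r) +
      (θ + lam.arg : ℝ) * Complex.I))‖ ≤ Real.exp ((A + ε) * (V (Real.log (‖lam‖ * r) : ℝ)).re) := by
    unfold genIndicator at hlt2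
    filter_upwards [h1.eventually_const_lt hlt, eventually_gt_atTop 0,
      eventually_lt_of_limsup_lt hlt2 (by isBoundedDefault)] with r hr h0 hF
    have hD : 0 < r ^ ord (‖lam‖ * r) := Real.rpow_pos_of_pos h0 _
    have hF' := hF.le
    rw [ennrealLog_enorm_div_le_iff _ hD, mul_exp_arg hlam h0] at hF'
    refine ⟨h0, hF'.trans (Real.exp_le_exp.2 ?_)⟩
    rw [div_mul_eq_mul_div, lt_div_iff₀ hD] at hr
    linarith
  have h3 : Tendsto (fun x : ℝ => Real.exp x / ‖lam‖) atTop atTop :=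
    Real.tendsto_exp_atTop.atTop_div_const hk
  filter_upwards [h3.eventually h2] with x hx
  have := hx.2
  rw [mul_div_cancel₀ _ hk.ne', Real.log_exp] at this
  exact this

theorem isProximateOrderOf {c a : ℝ} (h : IsMaergoizFun γ ord ρ V) (hV : IsGrowthFun ρ V)
    (hord : IsProximateOrder ord ρ) (hE : IsKernelSeries c a V E) (hEd : Differentiable ℂ E)
    (hlam : lam ≠ 0) :
    IsProximateOrderOf (fun t => ord (‖lam‖ * t)) ρ (fun z => E (lam * z)) := by
  have hk : 0 < ‖lam‖ := norm_pos_iff.2 hlam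
  have hκ : 0 < ‖lam‖ ^ ρ := Real.rpow_pos_of_pos hk ρ
  have hkt : Tendsto (fun t : ℝ => ‖lam‖ * t) atTop atTop := tendsto_id.const_mul_atTop hk
  have hlim := h.tendsto_div_rpow hord.lim hk
  have hbdd : ∀ r : ℝ, BddAbove ((fun z : ℂ => ‖E (lam * z)‖) '' Metric.sphere 0 r) := by
    intro r
    have : Continuous fun z : ℂ => ‖E (lam * z)‖ := by
      have := hEd.continuous
      fun_prop
    exact (isCompact_sphere _ _).bddAbove_image this.continuousOn
  refine ⟨hEd.comp (differentiable_id.const_mul lam), hord.comp_mul_left hk, ?_, ?_⟩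
  -- If the type were at most 0, the maximum modulus, and with it |E| on the positive ray, would
  -- eventually be at most exp(V/2), contrary to type one there.
  · by_contra hneg
    rw [not_lt] at hneg
    have hlt : typeRel (fun t => ord (‖lam‖ * t)) (fun z => E (lam * z)) <
        ((‖lam‖ ^ ρ * (1 / 4) : ℝ) : EReal) := by
      refine hneg.trans_lt ?_
      have : (0 : ℝ) < ‖lam‖ ^ ρ * (1 / 4) := by positivity
      exact_mod_cast this
    have h1 := hlim.mul_const (1 / 2)
    have h2 : ∀ᶠ r : ℝ in atTop, 0 < r ∧ ‖E (Real.exp (Real.log (‖lam‖ * r)) : ℝ)‖ ≤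
        Real.exp (1 / 2 * (V (Real.log (‖lam‖ * r) : ℝ)).re) := by
      unfold typeRel at hlt
      filter_upwards [h1.eventually_const_lt (show ‖lam‖ ^ ρ * (1 / 4) < ‖lam‖ ^ ρ * (1 / 2) by
        gcongr; norm_num), eventually_gt_atTop 0,
        eventually_lt_of_limsup_lt hlt (by isBoundedDefault)] with r hr h0 hF
      have hD : 0 < r ^ ord (‖lam‖ * r) := Real.rpow_pos_of_pos h0 _
      refine ⟨h0, ?_⟩
      have hF' : Real.log (maxModulus (fun z => E (lam * z)) r) / r ^ ord (‖lam‖ * r) <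
          ‖lam‖ ^ ρ * (1 / 4) := by exact_mod_cast hF
      rw [div_lt_iff₀ hD] at hF'
      rw [div_mul_eq_mul_div, lt_div_iff₀ hD] at hr
      have hmem : ‖E (Real.exp (Real.log (‖lam‖ * r)) : ℝ)‖ ≤
          maxModulus (fun z => E (lam * z)) r := by
        refine le_csSup (hbdd r) ⟨(‖lam‖ * r : ℝ) / lam, ?_, ?_⟩
        · rw [mem_sphere_zero_iff_norm, norm_div, Complex.norm_real,
            Real.norm_of_nonneg (by positivity)]
          field_simp
        · simp only
          rw [mul_div_cancel₀ _ hlam, Real.exp_log (by positivity)]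
      refine hmem.trans ((Real.le_exp_log _).trans (Real.exp_le_exp.2 ?_))
      linarith
    refine hE.not_indicatorLE hV (A := 1 / 2) (by norm_num) fun ε hε => ?_
    have h3 : Tendsto (fun x : ℝ => Real.exp x / ‖lam‖) atTop atTop :=
      Real.tendsto_exp_atTop.atTop_div_const hk
    filter_upwards [h3.eventually h2] with x hx
    have h4 := hx.2
    rw [mul_div_cancel₀ _ hk.ne', Real.log_exp, Complex.ofReal_exp] at h4
    simp only [Complex.ofReal_zero, zero_mul, add_zero]
    refine h4.trans (Real.exp_le_exp.2 ?_)
    have := hV.pos x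
    gcongr
    linarith
  · refine lt_of_le_of_lt ?_ (EReal.coe_lt_top (‖lam‖ ^ ρ * 2 + 1))
    unfold typeRel
    refine limsup_le_of_le (by isBoundedDefault) ?_
    filter_upwards [(hlim.mul_const 2).eventually_lt_const (show ‖lam‖ ^ ρ * 2 <
      ‖lam‖ ^ ρ * 2 + 1 by linarith), eventually_gt_atTop 0,
      (Real.tendsto_log_atTop.comp hkt).eventually (hE.eventually_norm_le hV one_pos)]
      with r hr h0 hF
    have hD : 0 < r ^ ord (‖lam‖ * r) := Real.rpow_pos_of_pos h0 _
    have hv := h.pos (Real.log (‖lam‖ * r))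
    rw [div_mul_eq_mul_div, div_lt_iff₀ hD] at hr
    have hle : maxModulus (fun z => E (lam * z)) r ≤
        Real.exp ((1 + 1) * (V (Real.log (‖lam‖ * r) : ℝ)).re) := by
      refine csSup_le ((NormedSpace.sphere_nonempty.2 h0.le).image _) ?_
      rintro _ ⟨z, hz, rfl⟩
      have h1 := hF (z.arg + lam.arg)
      rw [mem_sphere_zero_iff_norm] at hz
      have h2 := mul_exp_arg hlam h0 z.arg
      rw [← hz, Complex.norm_mul_exp_arg_mul_I] at h2
      simp only [Function.comp_apply] at h1
      rw [← hz, ← h2] at h1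
      simp only
      rw [← hz]
      exact h1
    have hlog : Real.log (maxModulus (fun z => E (lam * z)) r) ≤
        (1 + 1) * (V (Real.log (‖lam‖ * r) : ℝ)).re := by
      -- When the maximum modulus is 0, `Real.log` takes its default value 0, and the bound holds
      -- since V is positive.
      rcases le_or_gt (maxModulus (fun z => E (lam * z)) r) 0 with h1 | h1
      · have h2 : 0 ≤ maxModulus (fun z => E (lam * z)) r := by
          refine Real.sSup_nonneg ?_
          rintro _ ⟨z, -, rfl⟩
          exact norm_nonneg _
        rw [le_antisymm h1 h2, Real.log_zero]
        positivity
      · rwa [Real.log_le_iff_le_exp h1]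
    have : Real.log (maxModulus (fun z => E (lam * z)) r) / r ^ ord (‖lam‖ * r) ≤
        ‖lam‖ ^ ρ * 2 + 1 := by
      rw [div_le_iff₀ hD]
      linarith
    exact_mod_cast this

end IsMaergoizFun

end

/-! ### Assembly of the four statements -/

theorem mainTheorem7 (M : ℕ → ℝ) (hM : IsStronglyRegular M)
    (ord : ℝ → ℝ) (ρ : ℝ) (hρ : 0 < ρ) (hord : IsProximateOrder ord ρ)
    (hMord : AdmitsProximateOrder M ord)
    (e E : ℂ → ℂ) (hE : IsAssociatedKernelPair M ord ρ e E)
    (lam : ℂ) (hlam : lam ≠ 0) :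
    IsProximateOrderOf (fun t => ord (‖lam‖ * t)) ρ (fun z => E (lam * z)) ∧
    (∀ θ : ℝ,
      (|θ + lam.arg| ≤ min Real.pi (Real.pi / (2 * ρ)) →
        genIndicatorPlus (fun t => ord (‖lam‖ * t)) (fun z => E (lam * z)) θ =
          ((‖lam‖ ^ ρ * Real.cos (ρ * (θ + lam.arg)) : ℝ) : EReal)) ∧
      (1 / 2 ≤ ρ → min Real.pi (Real.pi / (2 * ρ)) ≤ |θ + lam.arg| → |θ + lam.arg| ≤ Real.pi →
        genIndicatorPlus (fun t => ord (‖lam‖ * t)) (fun z => E (lam * z)) θ = 0)) ∧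
    (1 < ρ → ∀ θ : ℝ,
      genIndicator (fun t => ord (‖lam‖ * t)) (fun z => E (lam * z)) θ =
        genIndicatorPlus (fun t => ord (‖lam‖ * t)) (fun z => E (lam * z)) θ) ∧
    (ρ ≤ 1 / 2 → ∀ θ : ℝ, |θ + lam.arg| ≤ Real.pi →
      genIndicatorPlus (fun t => ord (‖lam‖ * t)) (fun z => E (lam * z)) θ =
        ((‖lam‖ ^ ρ * Real.cos (ρ * (θ + lam.arg)) : ℝ) : EReal)) ∧
    (1 / 2 < ρ → ρ ≤ 1 →
      (∃ k : ℕ, 1 ≤ k ∧ ContinuesToNonzero (momentFun e) (-(k : ℂ) - 1)) → ∀ θ : ℝ,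
      genIndicator (fun t => ord (‖lam‖ * t)) (fun z => E (lam * z)) θ =
        genIndicatorPlus (fun t => ord (‖lam‖ * t)) (fun z => E (lam * z)) θ) := by
  obtain ⟨hK, γ, V, c, a, hγ, hMV, hc, ha, he⟩ := hE
  have hω := hMord.omegaSeq_eq hρ hord
  have hωπ : omegaSeq M * Real.pi = Real.pi / ρ := by rw [hω]; ring
  rw [hωπ] at he
  rw [hω] at hγ
  have hV := hMV.isGrowthFun hρ hγ
  have hES := hK.isKernelSeries hρ hc ha he
  have hB := hK.hasStripBound hM.zero hωπ hc he
  have hD := hK.hasPowerDecay hωπ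
  have hEd := hK.entire
  have hκ : 0 < ‖lam‖ ^ ρ := Real.rpow_pos_of_pos (norm_pos_iff.2 hlam) ρ
  have hα := hV.half_width_pos
  have hα_lt : 1 / 2 < ρ → Real.pi / (2 * ρ) < Real.pi := fun h => by
    rw [div_lt_iff₀ (by positivity)]
    nlinarith [Real.pi_pos]
  have hα_ge : ρ ≤ 1 / 2 → Real.pi ≤ Real.pi / (2 * ρ) := fun h => by
    rw [le_div_iff₀ (by positivity)]
    nlinarith [Real.pi_pos]
  have habs : ∀ x : ℝ, Real.cos (ρ * |x|) = Real.cos (ρ * x) := fun x => by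
    rw [← Real.cos_abs (ρ * x), abs_mul, abs_of_pos hρ]
  have hupper : ∀ θ : ℝ, |θ + lam.arg| ≤ min Real.pi (Real.pi / (2 * ρ)) →
      genIndicator (fun t => ord (‖lam‖ * t)) (fun z => E (lam * z)) θ ≤
        ((‖lam‖ ^ ρ * Real.cos (ρ * (θ + lam.arg)) : ℝ) : EReal) := by
    intro θ hθ
    obtain ⟨h1, h2⟩ := le_min_iff.1 hθ
    refine hMV.genIndicator_le hord.lim hlam (hES.indicatorLE_of_abs hV ?_)
    rw [← habs]
    rcases le_or_gt ρ (1 / 2) with h3 | h3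
    · exact hES.indicatorLE_cos_of_le_half hV hEd hB h3 (abs_nonneg _) h1
    · exact hES.indicatorLE_cos hV hEd hD h3 (abs_nonneg _) h2
  have hlower : ∀ θ : ℝ, |θ + lam.arg| < Real.pi / (2 * ρ) →
      ((‖lam‖ ^ ρ * Real.cos (ρ * (θ + lam.arg)) : ℝ) : EReal) ≤
        genIndicator (fun t => ord (‖lam‖ * t)) (fun z => E (lam * z)) θ := by
    intro θ hθ
    by_contra hlt
    obtain ⟨b, hb1, hb2⟩ := EReal.lt_iff_exists_real_btwn.1 (not_le.1 hlt)
    have hb2' : b < ‖lam‖ ^ ρ * Real.cos (ρ * (θ + lam.arg)) := by exact_mod_cast hb2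
    refine hES.not_indicatorLE_of_lt_cos hV hEd (A := b / ‖lam‖ ^ ρ) hθ ?_
      (hMV.indicatorLE_of_genIndicator_le hord.lim hlam ?_)
    · rwa [div_lt_iff₀' hκ]
    · rw [mul_div_cancel₀ _ hκ.ne']
      exact hb1.le
  have hzero : 1 / 2 < ρ → ∀ θ : ℝ, Real.pi / (2 * ρ) ≤ |θ + lam.arg| → |θ + lam.arg| ≤ Real.pi →
      genIndicatorPlus (fun t => ord (‖lam‖ * t)) (fun z => E (lam * z)) θ = 0 := by
    intro h3 θ h1 h2
    have h4 := hα_lt h3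
    have h5 := hMV.genIndicator_le hord.lim hlam
      (hES.indicatorLE_of_abs hV (hES.indicatorLE_zero hV hEd hD h3 h1 (by linarith)))
    rw [mul_zero] at h5
    exact max_eq_left h5
  have hmain : ∀ θ : ℝ, |θ + lam.arg| ≤ min Real.pi (Real.pi / (2 * ρ)) →
      genIndicatorPlus (fun t => ord (‖lam‖ * t)) (fun z => E (lam * z)) θ =
        ((‖lam‖ ^ ρ * Real.cos (ρ * (θ + lam.arg)) : ℝ) : EReal) := by
    intro θ hθ
    have h1 := hupper θ hθ
    rcases (le_min_iff.1 hθ).2.eq_or_lt with h2 | h2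
    -- On the edge of the sector the cosine vanishes, so the upper bound alone determines h⁺. The
    -- lower bound is available only in the open sector.
    · have h3 : Real.cos (ρ * (θ + lam.arg)) = 0 := by
        rw [← habs, h2]
        have : ρ * (Real.pi / (2 * ρ)) = Real.pi / 2 := by field_simp
        rw [this, Real.cos_pi_div_two]
      rw [h3, mul_zero] at h1 ⊢
      exact max_eq_left h1
    · have h3 := hV.cos_pos (abs_nonneg _) h2
      rw [habs] at h3
      rw [genIndicatorPlus, le_antisymm h1 (hlower θ h2)]
      exact max_eq_right (by exact_mod_cast (mul_pos hκ h3).le)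
  -- The direction is replaced by its principal representative modulo 2π, since the propagation
  -- lemmas work with |φ| ≤ π.
  have hneg : ∀ θ : ℝ, ¬ 0 ≤ genIndicator (fun t => ord (‖lam‖ * t)) (fun z => E (lam * z)) θ →
      ∃ φ A : ℝ, |φ| ≤ Real.pi ∧ A < 0 ∧
        IndicatorLE V (fun w => E (Complex.exp w)) φ A := by
    intro θ hθ
    obtain ⟨b, hb1, hb2⟩ := EReal.lt_iff_exists_real_btwn.1 (not_le.1 hθ)
    have hb2' : b < 0 := by exact_mod_cast hb2
    refine ⟨(Complex.exp ((θ + lam.arg : ℝ) * Complex.I)).arg, b / ‖lam‖ ^ ρ,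
      Complex.abs_arg_le_pi _, div_neg_of_neg_of_pos hb2' hκ,
      (hMV.indicatorLE_of_genIndicator_le hord.lim hlam (θ := θ) ?_).congr ?_⟩
    · rw [mul_div_cancel₀ _ hκ.ne']
      exact hb1.le
    · have h1 := Complex.norm_mul_exp_arg_mul_I (Complex.exp ((θ + lam.arg : ℝ) * Complex.I))
      rw [Complex.norm_exp_ofReal_mul_I, Complex.ofReal_one, one_mul] at h1
      exact h1.symm
  refine ⟨hMV.isProximateOrderOf hV hord hES hEd hlam, fun θ => ⟨hmain θ, fun h1 h2 h3 => ?_⟩,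
    fun h1 θ => ?_, fun h1 θ h2 => hmain θ (le_min h2 (h2.trans (hα_ge h1))),
    fun h1 h2 hcont θ => ?_⟩
  · rcases h1.eq_or_lt with h4 | h4
    -- At ρ = 1/2 the two ranges meet only at |θ + arg λ| = π, where cos(π/2) = 0. This case belongs
    -- to the contour argument, not to the power decay.
    · have h5 : Real.pi / (2 * ρ) = Real.pi := by rw [← h4]; ring
      rw [h5, min_self] at h2
      have h6 : |θ + lam.arg| = Real.pi := le_antisymm h3 h2
      rw [hmain θ (by rw [h5, min_self]; exact h3), ← habs, h6, ← h4, one_div_mul_eq_div,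
        Real.cos_pi_div_two, mul_zero, EReal.coe_zero]
    · rw [min_eq_right (hα_lt h4).le] at h2
      exact hzero h4 θ h2 h3
  · by_contra hne
    obtain ⟨φ, A, hφ, hA, h3⟩ := hneg θ fun h => hne (max_eq_right h).symm
    exact hES.not_indicatorLE_neg_of_one_lt hV hEd hD h1 hφ hA h3
  · by_contra hne
    obtain ⟨φ, A, hφ, hA, h3⟩ := hneg θ fun h => hne (max_eq_right h).symm
    obtain ⟨B, hB, h4⟩ := hES.exists_neg_indicatorLE_pi hV hEd hD h1 h2 hφ hA h3
    obtain ⟨k, -, hk⟩ := hcont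
    rw [momentFun_eq hρ he] at hk
    exact hES.not_continuesToNonzero hV hEd hD h1 hB h4 k hk
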